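/- Let $d\in\mathbb N$, $1\le p<\infty$, $T>0$, and let $f:L^p(\mathbb R^d)\to L^p(\mathbb R^d)$ (real-valued functions, norm $\|\cdot\|$) satisfy $(F_f)$: $f(0)=0$, and there is $L_f>0$ with $\|f(u)-f(v)\|\le L_f\|u-v\|$ for all $u,v\in L^p(\mathbb R^d)$. A kernel $m\in L^1_{loc}([0,\infty);\mathbb R)$, not almost everywhere zero, is called completely positive if for every $\mu>0$ the solutions $s_\mu,r_\mu\in L^1_{loc}([0,\infty))$ of $s_\mu+\mu\, m*s_\mu=1$ and $r_\mu+\mu\, m*r_\mu=m$ are nonnegative, where $(a*b)(t)=\int_0^t a(t-\sigma)b(\sigma)\,d\sigma$. With $\hat m(\lambda)=\int_0^\infty e^{-\lambda t}m(t)\,dt$, its propagation function $w(t,\tau)$, $t,\tau\ge0$, is the function such that, for each $\tau\ge0$, $w(\cdot,\tau)$ is nondecreasing, left-continuous and of bounded variation on $[0,\infty)$, $w(0,\tau)=0$, and $$\int_0^\infty e^{-\lambda t}w(t,\tau)\,dt=\frac{e^{-\tau/\hat m(\lambda)}}{\lambda},\qquad \lambda>0 .$$ Let $T(\tau)$, $\tau\ge0$,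 be the heat semigroup on $L^p(\mathbb R^d)$: $T(0)=I$, and for $\tau>0$, $T(\tau)$ is convolution with $(4\pi\tau)^{-d/2}e^{-|x|^2/(4\tau)}$. The resolvent family determined by $m$ is $$S_m(t)v=-\int_0^\infty T(\tau)v\;d_\tau w(t,\tau),\qquad t\ge0,\ v\in L^p(\mathbb R^d),$$ where $-d_\tau w(t,\cdot)$ is the probability measure on $[0,\infty)$ that gives $(\tau,\infty)$ the mass $w(t,\tau)$ for every $\tau\ge0$. Then every completely positive kernel $m$ determines such a family $S_m$. For every $\varphi\in C([0,T];L^p(\mathbb R^d))$ and every completely positive $m$ the generalized mild equation $$u(t)=\varphi(t)+\int_0^tS_m(t-\sigma)f(u(\sigma))\,d\sigma,\qquad t\in[0,T],$$ has a unique solution $u=u_m(\cdot,\varphi)\in C([0,T];L^p(\mathbb R^d))$; it depends on $m$ only through the restriction $m|_{(0,T)}$, and the solution map $(\varphi,m)\mapsto u_m(\cdot,\varphi)$ is continuous from $C([0,T];L^p(\mathbb R^d))\times\mathcal K_T$ into $C([0,T];L^p(\mathbb R^d))$. Here $\mathcal K_T\subset L^1(0,T)$ is the set of restrictions to $(0,T)$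 of completely positive kernels, with the topology of $L^1(0,T)$, and $C([0,T];L^p(\mathbb R^d))$ carries the supremum norm. -/

import Mathlib

open MeasureTheory Set Filter Topology
open scoped ENNReal

noncomputable section

namespace RayleighStokes

/-- The space `L^p(ℝ^d)` of real-valued functions, for Lebesgue measure. -/
abbrev LpSpace (d : ℕ) (p : ℝ≥0∞) : Type :=
  Lp ℝ p (volume : Measure (EuclideanSpace ℝ (Fin d)))

/-- The Gaussian heat kernel `G(τ, x) = (4πτ)^{-d/2} exp(-|x|² / (4τ))`. -/
def heatKernel (d : ℕ) (τ : ℝ) (x : EuclideanSpace ℝ (Fin d)) : ℝ :=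
  (4 * Real.pi * τ) ^ (-(d : ℝ) / 2) * Real.exp (-‖x‖ ^ 2 / (4 * τ))

theorem continuous_heatKernel (d : ℕ) (τ : ℝ) : Continuous (heatKernel d τ) := by
  unfold heatKernel
  fun_prop

theorem heatKernel_nonneg (d : ℕ) {τ : ℝ} (hτ : 0 < τ) (x : EuclideanSpace ℝ (Fin d)) :
    0 ≤ heatKernel d τ x := by
  unfold heatKernel
  positivity

theorem integrable_heatKernel (d : ℕ) {τ : ℝ} (hτ : 0 < τ) :
    Integrable (heatKernel d τ) volume := by
  have hb : 0 < 1 / (4 * τ) := by positivity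
  have h := (GaussianFourier.integrable_cexp_neg_mul_sq_norm_add
    (b := ((1 / (4 * τ) : ℝ) : ℂ)) (by simpa using hτ) 0
    (0 : EuclideanSpace ℝ (Fin d))).norm
  refine (h.const_mul ((4 * Real.pi * τ) ^ (-(d : ℝ) / 2))).congr (ae_of_all _ fun x => ?_)
  have e : -((1 / (4 * τ) : ℝ) : ℂ) * (‖x‖ : ℂ) ^ 2
      + 0 * ((inner ℝ (0 : EuclideanSpace ℝ (Fin d)) x : ℝ) : ℂ)
      = ((-‖x‖ ^ 2 / (4 * τ) : ℝ) : ℂ) := by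
    push_cast
    ring
  simp only [heatKernel]
  rw [e, Complex.norm_exp_ofReal]

/-- The pointwise heat convolution `x ↦ ∫ G(τ, x - y) v(y) dy`. -/
def heatConv (d : ℕ) (τ : ℝ) (v : EuclideanSpace ℝ (Fin d) → ℝ)
    (x : EuclideanSpace ℝ (Fin d)) : ℝ :=
  ∫ y, heatKernel d τ (x - y) * v y

theorem memLp_heatConv {d : ℕ} {p : ℝ≥0∞} [h1 : Fact (1 ≤ p)] [h2 : Fact (p ≠ ∞)]
    {τ : ℝ} (hτ : 0 < τ) (v : LpSpace d p) : MemLp (heatConv d τ v) p volume := by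
  have hp0 : p ≠ 0 := (zero_lt_one.trans_le h1.out).ne'
  have hq : 0 < p.toReal := ENNReal.toReal_pos hp0 h2.out
  have hv : StronglyMeasurable (v : EuclideanSpace ℝ (Fin d) → ℝ) := Lp.stronglyMeasurable v
  have hGm : Measurable (heatKernel d τ) := (continuous_heatKernel d τ).measurable
  have hmeas : StronglyMeasurable (heatConv d τ v) := by
    refine StronglyMeasurable.integral_prod_right'
      (f := fun z : EuclideanSpace ℝ (Fin d) × EuclideanSpace ℝ (Fin d) =>
        heatKernel d τ (z.1 - z.2) * v z.2) ?_
    exact ((hGm.comp (measurable_fst.sub measurable_snd)).mul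
      (hv.measurable.comp measurable_snd)).stronglyMeasurable
  refine ⟨hmeas.aestronglyMeasurable, ?_⟩
  rw [eLpNorm_lt_top_iff_lintegral_rpow_enorm_lt_top hp0 h2.out]
  set γ : Measure (EuclideanSpace ℝ (Fin d)) :=
    volume.withDensity (fun y => ENNReal.ofReal (heatKernel d τ y)) with hγ
  have hγfin : IsFiniteMeasure γ :=
    isFiniteMeasure_withDensity_ofReal (integrable_heatKernel d hτ).2
  set C : ℝ≥0∞ := γ univ ^ (1 / (1 : ℝ≥0∞).toReal - 1 / p.toReal) with hC
  have hCtop : C ≠ ∞ := by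
    refine ENNReal.rpow_ne_top_of_nonneg ?_ (measure_ne_top _ _)
    have : 1 ≤ p.toReal := by
      simpa using (ENNReal.toReal_le_toReal ENNReal.one_ne_top h2.out).2 h1.out
    simp only [ENNReal.toReal_one, div_one, sub_nonneg]
    exact (div_le_one hq).2 this
  have hpt : ∀ x, ‖heatConv d τ v x‖ₑ ^ p.toReal
      ≤ C ^ p.toReal * ∫⁻ y, ‖v (x - y)‖ₑ ^ p.toReal ∂γ := by
    intro x
    have hvx : StronglyMeasurable fun y => v (x - y) :=
      hv.comp_measurable (measurable_const.sub measurable_id)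
    have a1 : ‖heatConv d τ v x‖ₑ ≤ eLpNorm (fun y => v (x - y)) 1 γ := by
      calc ‖heatConv d τ v x‖ₑ ≤ ∫⁻ y, ‖heatKernel d τ (x - y) * v y‖ₑ :=
            enorm_integral_le_lintegral_enorm _
        _ = ∫⁻ y, ENNReal.ofReal (heatKernel d τ (x - y)) * ‖v (x - (x - y))‖ₑ := by
            refine lintegral_congr fun y => ?_
            rw [enorm_mul, Real.enorm_of_nonneg (heatKernel_nonneg d hτ _), sub_sub_cancel]
        _ = ∫⁻ y, ENNReal.ofReal (heatKernel d τ y) * ‖v (x - y)‖ₑ :=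
            lintegral_sub_left_eq_self
              (fun y => ENNReal.ofReal (heatKernel d τ y) * ‖v (x - y)‖ₑ) x
        _ = eLpNorm (fun y => v (x - y)) 1 γ := by
            rw [eLpNorm_one_eq_lintegral_enorm, hγ,
              lintegral_withDensity_eq_lintegral_mul _ hGm.ennreal_ofReal hvx.enorm]
            rfl
    have a2 := eLpNorm_le_eLpNorm_mul_rpow_measure_univ h1.out
      (hvx.aestronglyMeasurable (μ := γ))
    calc ‖heatConv d τ v x‖ₑ ^ p.toReal
        ≤ (eLpNorm (fun y => v (x - y)) p γ * C) ^ p.toReal :=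
          ENNReal.rpow_le_rpow (a1.trans a2) hq.le
      _ = C ^ p.toReal * ∫⁻ y, ‖v (x - y)‖ₑ ^ p.toReal ∂γ := by
          rw [ENNReal.mul_rpow_of_nonneg _ _ hq.le, mul_comm,
            eLpNorm_eq_lintegral_rpow_enorm_toReal hp0 h2.out]
          congr 1
          rw [← ENNReal.rpow_mul, one_div_mul_cancel hq.ne', ENNReal.rpow_one]
  refine (lintegral_mono hpt).trans_lt ?_
  have hjm : Measurable fun z : EuclideanSpace ℝ (Fin d) × EuclideanSpace ℝ (Fin d) =>
      ‖v (z.1 - z.2)‖ₑ ^ p.toReal :=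
    ((hv.measurable.comp (measurable_fst.sub measurable_snd)).enorm).pow_const _
  rw [lintegral_const_mul _ hjm.lintegral_prod_right',
    lintegral_lintegral_swap hjm.aemeasurable]
  have hin : ∀ y, ∫⁻ x, ‖v (x - y)‖ₑ ^ p.toReal = ∫⁻ x, ‖v x‖ₑ ^ p.toReal := fun y =>
    lintegral_sub_right_eq_self (fun x => ‖v x‖ₑ ^ p.toReal) y
  simp only [hin, lintegral_const]
  have hvfin := (eLpNorm_lt_top_iff_lintegral_rpow_enorm_lt_top hp0 h2.out).1 (Lp.memLp v).2
  exact ENNReal.mul_lt_top (ENNReal.rpow_lt_top_of_nonneg hq.le hCtop)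
    (ENNReal.mul_lt_top hvfin (measure_lt_top _ _))

/-- The heat semigroup `T(τ)` generated by the Laplacian on `L^p(ℝ^d)`, `1 ≤ p < ∞`:
convolution with the heat kernel for `τ > 0`, and the identity at `τ = 0`. -/
def heatSemigroup {d : ℕ} {p : ℝ≥0∞} [Fact (1 ≤ p)] [Fact (p ≠ ∞)]
    (τ : ℝ) (v : LpSpace d p) : LpSpace d p :=
  if hτ : 0 < τ then (memLp_heatConv hτ v).toLp _ else v

/-- `b` is locally integrable on `[0, ∞)`; values at negative times are irrelevant. -/
def LocInt (b : ℝ → ℝ) : Prop :=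
  ∀ R : ℝ, IntegrableOn b (Ioc 0 R) volume

/-- The convolution `(b * s)(t) = ∫₀ᵗ b(t - σ) s(σ) dσ`. -/
def conv (b s : ℝ → ℝ) (t : ℝ) : ℝ :=
  ∫ σ in (0 : ℝ)..t, b (t - σ) * s σ

/-- Completely positive kernels: `b` is in `L¹_loc` and, for every `μ > 0`, the (unique)
locally integrable solutions of `s + μ b * s = 1` and `r + μ b * r = b` are nonnegative.
The zero kernel, which has no Bernstein function `1 / b̂`, is left out. -/
structure CompletelyPositive (b : ℝ → ℝ) : Prop where
  locInt : LocInt b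
  ne_zero : ¬ (∀ᵐ t ∂volume.restrict (Ioi (0 : ℝ)), b t = 0)
  exists_s : ∀ μ : ℝ, 0 < μ → ∃ s : ℝ → ℝ, LocInt s ∧
    (∀ᵐ t ∂volume.restrict (Ioi (0 : ℝ)), s t + μ * conv b s t = 1) ∧
    (∀ᵐ t ∂volume.restrict (Ioi (0 : ℝ)), 0 ≤ s t)
  exists_r : ∀ μ : ℝ, 0 < μ → ∃ r : ℝ → ℝ, LocInt r ∧
    (∀ᵐ t ∂volume.restrict (Ioi (0 : ℝ)), r t + μ * conv b r t = b t) ∧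
    (∀ᵐ t ∂volume.restrict (Ioi (0 : ℝ)), 0 ≤ r t)

/-- The Laplace transform `b̂(lam) = ∫₀^∞ e^{-lam t} b(t) dt`. -/
def laplace (b : ℝ → ℝ) (lam : ℝ) : ℝ :=
  ∫ t in Ioi (0 : ℝ), Real.exp (-lam * t) * b t

/-- `w` is the propagation function of the kernel `b`: for each `τ ≥ 0` the function
`w(·, τ)` is nondecreasing, left-continuous and of bounded variation on `[0, ∞)`, vanishes at
`0`, and has the Laplace transform `lam⁻¹ exp(-τ / b̂(lam))`. -/
structure IsPropagationFunction (b : ℝ → ℝ) (w : ℝ → ℝ → ℝ) : Prop where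
  mono : ∀ τ, 0 ≤ τ → MonotoneOn (fun t => w t τ) (Ici 0)
  bv : ∀ τ, 0 ≤ τ → BoundedVariationOn (fun t => w t τ) (Ici 0)
  at_zero : ∀ τ, 0 ≤ τ → w 0 τ = 0
  left_cont : ∀ τ, 0 ≤ τ → ∀ t, 0 < t → ContinuousWithinAt (fun t => w t τ) (Iic t) t
  laplace_eq : ∀ τ, 0 ≤ τ → ∀ lam : ℝ, 0 < lam →
    laplace (fun t => w t τ) lam = Real.exp (-τ * (1 / laplace b lam)) / lam

/-- `ν` is the Stieltjes measure `-d_τ w(t, τ)` on `[0, ∞)`: it has total mass one and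
distributes its mass according to `w`, where `w(t, ∞) = 0`, so that `ν (τ, ∞) = w(t, τ)`.
At `t = 0`, where `w(0, ·) = 0`, it is the unit mass at `τ = 0`. -/
structure IsNegDtau (w : ℝ → ℝ → ℝ) (t : ℝ) (ν : Measure ℝ) : Prop where
  univ_eq : ν univ = 1
  neg_eq : ν (Iio 0) = 0
  tail_eq : ∀ τ, 0 ≤ τ → ν (Ioi τ) = ENNReal.ofReal (w t τ)

/-- `S` is the resolvent family determined by the kernel `m` through subordination,
`S(t)v = -∫₀^∞ T(τ)v d_τ w(t, τ)`, with `w` the propagation function of `m`. -/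
def IsResolventFamily {d : ℕ} {p : ℝ≥0∞} [Fact (1 ≤ p)] [Fact (p ≠ ∞)]
    (m : ℝ → ℝ) (S : ℝ → LpSpace d p → LpSpace d p) : Prop :=
  ∃ w : ℝ → ℝ → ℝ, IsPropagationFunction m w ∧
    ∃ ν : ℝ → Measure ℝ, (∀ t, 0 ≤ t → IsNegDtau w t (ν t)) ∧
      ∀ t, 0 ≤ t → ∀ v : LpSpace d p,
        Integrable (fun τ => heatSemigroup τ v) (ν t) ∧
        S t v = ∫ τ, heatSemigroup τ v ∂(ν t)

/-- `u ∈ C([0,T]; X)` is a generalized mild solution: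
`u(t) = φ(t) + ∫₀ᵗ S(t - σ) f(u(σ)) dσ` for all `t ∈ [0, T]`. -/
def IsGeneralizedMildSolution {X : Type*} [NormedAddCommGroup X] [NormedSpace ℝ X]
    {T : ℝ} (hT : 0 ≤ T) (S : ℝ → X → X) (f : X → X) (φ u : C(Icc (0 : ℝ) T, X)) : Prop :=
  ∀ t : Icc (0 : ℝ) T,
    IntervalIntegrable (fun σ => S (t - σ) (f (u (projIcc 0 T hT σ)))) volume 0 t ∧
    u t = φ t + ∫ σ in (0 : ℝ)..t, S (t - σ) (f (u (projIcc 0 T hT σ)))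

/-- The elements of `L¹(0,T)` that are restrictions of completely positive kernels. -/
def kernelSet (T : ℝ) : Set (Lp ℝ 1 (volume.restrict (Ioo (0 : ℝ) T))) :=
  {g | ∃ m : ℝ → ℝ, CompletelyPositive m ∧ m =ᵐ[volume.restrict (Ioo (0 : ℝ) T)] g}

end RayleighStokes

end

noncomputable section

namespace RayleighStokes

/-! ### The heat semigroup as a Gaussian average of translations -/

section Heat

variable {d : ℕ} {p : ℝ≥0∞}

/-! Everything rests on one identity: for `k ≥ 0` the Laplace transform in `τ` of the subordinating
measure `ν t` is the relaxation function, `∫ e^{-kτ} ν_t(dτ) = s_k(t) = 1 - k ∫₀ᵗ r_k`, where `r_k +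
k m * r_k = m` (`CompletelyPositive.integral_exp_eq`). Both sides have the same Laplace transform in
`t`; this gives equality almost everywhere, and left-continuity gives it everywhere. The measures of
the propagation function, which are known only through transforms, are thereby reduced to scalar
Volterra equations.

These equations are stable: with a weight `e^{-λt}`, `λ` large, a Gronwall argument bounds `s_k' -
s_k` on `[0,T]` by a multiple of the `L¹(0,T)` distance of the kernels
(`CompletelyPositive.exists_resolvent_stability`). Also `1 - s_k ≤ k ∫₀ᵀ m`, which makes the
measures `ν t`, `t ≤ T`, uniformly tight (`CompletelyPositive.tail_le`).

For fixed `v` the orbit `τ ↦ T(τ)v` is bounded and continuous, hence on compact sets uniformly close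
to a sum of `e^{-kτ} c_k` with integer `k ≥ 0` and vectors `c_k` (Weierstrass after `x = e^{-τ}`).
Integrating against `ν t`, `S_m(t)v` is uniformly close to the sum of `s_k(t) c_k`, with the same
`c_k` for all kernels of bounded mass (`exists_resolventFamily_approx`). Strong continuity in `t`,
strong continuity in `m`, and dependence on `m` only through `(0,T)` all follow. The semigroup law
of `T(τ)` plays no role.

Existence of the family needs the subordinator with exponent `1/m̂`. Since `k r_k` with `k = n/τ`
has transform `(1 + τ/(n m̂))⁻¹` and mass at most one, its `n`-fold convolution powers have
transforms tending to `e^{-τ/m̂}`. Carrying half-line laws to `[0,1]` by `t ↦ e^{-t}` turns this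
into weak compactness of probability measures on a compact space.

Finally, the mild equation is solved by Picard iteration, and Gronwall compares two solutions. The
perturbation of the family is only tested on the compact set of values of `f ∘ u`, where strong
convergence of contractions is uniform. -/

theorem integral_heatKernel_one (d : ℕ) : ∫ x, heatKernel d 1 x = 1 := by
  have h := GaussianFourier.integral_rexp_neg_mul_sq_norm (V := EuclideanSpace ℝ (Fin d))
    (b := 1 / 4) (by norm_num)
  have e : ∀ x : EuclideanSpace ℝ (Fin d), heatKernel d 1 x
      = (4 * Real.pi) ^ (-(d : ℝ) / 2) * Real.exp (-(1 / 4) * ‖x‖ ^ 2) := fun x => by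
    simp only [heatKernel, mul_one]
    congr 2
    ring
  simp_rw [e]
  rw [integral_const_mul, h, finrank_euclideanSpace_fin,
    show Real.pi / (1 / 4) = 4 * Real.pi by ring,
    ← Real.rpow_add (by positivity), show -(d : ℝ) / 2 + d / 2 = 0 by ring, Real.rpow_zero]

/-- The law with density the heat kernel at time one. -/
def heatMeasure (d : ℕ) : Measure (EuclideanSpace ℝ (Fin d)) :=
  volume.withDensity (fun y => ENNReal.ofReal (heatKernel d 1 y))

instance isProbabilityMeasure_heatMeasure (d : ℕ) : IsProbabilityMeasure (heatMeasure d) := by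
  constructor
  rw [heatMeasure, withDensity_apply _ MeasurableSet.univ, Measure.restrict_univ,
    ← ofReal_integral_eq_lintegral_ofReal (integrable_heatKernel d one_pos)
      (ae_of_all _ (heatKernel_nonneg d one_pos)), integral_heatKernel_one, ENNReal.ofReal_one]

/-- Translation of a function in `L^p`. -/
def translate [Fact (1 ≤ p)] (a : EuclideanSpace ℝ (Fin d)) (v : LpSpace d p) : LpSpace d p :=
  Lp.compMeasurePreserving (fun x => x - a) (measurePreserving_sub_right volume a) v

theorem norm_translate [Fact (1 ≤ p)] (a : EuclideanSpace ℝ (Fin d)) (v : LpSpace d p) :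
    ‖translate a v‖ = ‖v‖ :=
  Lp.norm_compMeasurePreserving _ _

theorem translate_sub [Fact (1 ≤ p)] (a : EuclideanSpace ℝ (Fin d)) (u v : LpSpace d p) :
    translate a (u - v) = translate a u - translate a v :=
  map_sub _ _ _

theorem coeFn_translate [Fact (1 ≤ p)] (a : EuclideanSpace ℝ (Fin d)) (v : LpSpace d p) :
    translate a v =ᵐ[volume] fun x => v (x - a) :=
  Lp.coeFn_compMeasurePreserving _ _

theorem continuous_translate [Fact (1 ≤ p)] [h2 : Fact (p ≠ ∞)] (v : LpSpace d p) :
    Continuous fun a => translate a v := by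
  let g : C(EuclideanSpace ℝ (Fin d), C(EuclideanSpace ℝ (Fin d), EuclideanSpace ℝ (Fin d))) :=
    (ContinuousMap.mk (fun q : EuclideanSpace ℝ (Fin d) × EuclideanSpace ℝ (Fin d) => q.2 - q.1)
      (by fun_prop)).curry
  exact Continuous.compMeasurePreservingLp (f := fun _ => v) (g := g) continuous_const g.continuous
    (fun a => measurePreserving_sub_right volume a) h2.out

theorem integrable_translate [Fact (1 ≤ p)] [Fact (p ≠ ∞)] (s : ℝ) (v : LpSpace d p) :
    Integrable (fun z => translate (s • z) v) (heatMeasure d) := by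
  refine Integrable.of_bound ?_ ‖v‖ (ae_of_all _ fun z => (norm_translate _ _).le)
  have : Continuous fun z : EuclideanSpace ℝ (Fin d) => translate (s • z) v :=
    (continuous_translate v).comp (continuous_const_smul s)
  exact this.aestronglyMeasurable

theorem heatKernel_smul (d : ℕ) {τ : ℝ} (hτ : 0 < τ) (z : EuclideanSpace ℝ (Fin d)) :
    heatKernel d 1 z = √τ ^ d * heatKernel d τ (√τ • z) := by
  have h1 : (√τ) ^ d = τ ^ ((d : ℝ) / 2) := by
    rw [Real.sqrt_eq_rpow, ← Real.rpow_natCast, ← Real.rpow_mul hτ.le]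
    ring_nf
  simp only [heatKernel, norm_smul, Real.norm_eq_abs, abs_of_nonneg (Real.sqrt_nonneg τ), mul_pow,
    Real.sq_sqrt hτ.le]
  have h2 : τ ^ (-(d : ℝ) / 2) * τ ^ ((d : ℝ) / 2) = 1 := by
    rw [← Real.rpow_add hτ, show -(d : ℝ) / 2 + d / 2 = 0 by ring, Real.rpow_zero]
  have h3 : -(τ * ‖z‖ ^ 2) / (4 * τ) = -‖z‖ ^ 2 / (4 * 1) := by
    field_simp
  rw [Real.mul_rpow (by positivity) hτ.le, h1, mul_one, h3]
  linear_combination (-(4 * Real.pi) ^ (-(d : ℝ) / 2) * Real.exp (-‖z‖ ^ 2 / (4 * 1))) * h2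

/-- Substituting `y = √τ z` turns the kernel at time `τ` into the one at time one: the probability
measure no longer depends on `τ`, which enters only through the translation. -/
theorem integral_comp_heatMeasure {τ : ℝ} (hτ : 0 < τ) (v : EuclideanSpace ℝ (Fin d) → ℝ)
    (x : EuclideanSpace ℝ (Fin d)) :
    ∫ z, v (x - √τ • z) ∂(heatMeasure d) = heatConv d τ v x := by
  have hs : 0 < √τ := Real.sqrt_pos.2 hτ
  rw [heatMeasure, integral_withDensity_eq_integral_toReal_smul
    (continuous_heatKernel d 1).measurable.ennreal_ofReal (ae_of_all _ fun _ => ENNReal.ofReal_lt_top)]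
  have e : ∀ z : EuclideanSpace ℝ (Fin d),
      (ENNReal.ofReal (heatKernel d 1 z)).toReal • v (x - √τ • z)
      = (fun y => √τ ^ d * (heatKernel d τ y * v (x - y))) (√τ • z) := fun z => by
    rw [ENNReal.toReal_ofReal (heatKernel_nonneg d one_pos z), heatKernel_smul d hτ, smul_eq_mul]
    ring
  rw [integral_congr_ae (ae_of_all _ e),
    Measure.integral_comp_smul volume (fun y => √τ ^ d * (heatKernel d τ y * v (x - y))) √τ,
    integral_const_mul, finrank_euclideanSpace_fin,
    abs_of_pos (by positivity), smul_eq_mul, inv_mul_cancel_left₀ (by positivity), heatConv,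
    ← integral_sub_left_eq_self (fun y => heatKernel d τ y * v (x - y)) volume x]
  simp

/-- Integration over a set of finite measure is a bounded functional on `L^p`. -/
theorem exists_setIntegral_clm [h1 : Fact (1 ≤ p)] {A : Set (EuclideanSpace ℝ (Fin d))}
    (hA : volume A < ∞) :
    ∃ Λ : LpSpace d p →L[ℝ] ℝ, ∃ C : ℝ, (∀ v : LpSpace d p, Λ v = ∫ x in A, v x) ∧
      ∀ v : LpSpace d p, ∫ x in A, ‖v x‖ ≤ C * ‖v‖ := by
  have : IsFiniteMeasure (volume.restrict A) := ⟨by simpa using hA⟩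
  have hint : ∀ v : LpSpace d p, Integrable v (volume.restrict A) := fun v =>
    ((Lp.memLp v).restrict A).integrable h1.out
  set C : ℝ≥0∞ := (volume.restrict A) univ ^ (1 / (1 : ℝ≥0∞).toReal - 1 / p.toReal) with hC
  have hCtop : C ≠ ∞ := by
    refine ENNReal.rpow_ne_top_of_nonneg ?_ (measure_ne_top _ _)
    rcases eq_or_ne p ∞ with rfl | hp
    · simp
    have : 1 ≤ p.toReal := by
      simpa using (ENNReal.toReal_le_toReal ENNReal.one_ne_top hp).2 h1.out
    simp only [ENNReal.toReal_one, div_one, sub_nonneg]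
    exact (div_le_one (by linarith)).2 this
  have hb : ∀ v : LpSpace d p, ∫ x in A, ‖v x‖ ≤ C.toReal * ‖v‖ := fun v => by
    rw [integral_norm_eq_lintegral_enorm (hint v).1, ← eLpNorm_one_eq_lintegral_enorm, Lp.norm_def,
      ← ENNReal.toReal_mul]
    refine ENNReal.toReal_mono (ENNReal.mul_ne_top hCtop (Lp.eLpNorm_ne_top v)) ?_
    rw [mul_comm]
    refine (eLpNorm_le_eLpNorm_mul_rpow_measure_univ h1.out (hint v).1).trans ?_
    gcongr
    exact Measure.restrict_le_self
  refine ⟨LinearMap.mkContinuous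
    { toFun := fun v => ∫ x in A, v x
      map_add' := fun u v => ?_
      map_smul' := fun c v => ?_ } C.toReal fun v => ?_, C.toReal, fun v => rfl, hb⟩
  · rw [← integral_add (hint u) (hint v)]
    exact integral_congr_ae (ae_restrict_of_ae (Lp.coeFn_add u v))
  · rw [RingHom.id_apply, ← integral_smul]
    exact integral_congr_ae (ae_restrict_of_ae (Lp.coeFn_smul c v))
  · exact (norm_integral_le_integral_norm _).trans (hb v)

/-- Written as an average of translates over a fixed probability measure, the heat semigroup
inherits contractivity and strong continuity from translations. The two sides are compared through
integrals over sets of finite measure: these are continuous functionals, so they pass inside the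
Bochner integral, and Fubini finishes. -/
theorem heatSemigroup_eq_integral [h1 : Fact (1 ≤ p)] [h2 : Fact (p ≠ ∞)] (τ : ℝ)
    (v : LpSpace d p) :
    heatSemigroup τ v = ∫ z, translate (√τ • z) v ∂(heatMeasure d) := by
  by_cases hτ : 0 < τ
  swap
  -- For `τ ≤ 0` the convention `√τ = 0` makes every translation trivial, so the formula, and later
  -- continuity in `τ`, holds on all of `ℝ`.
  · have e : ∀ z : EuclideanSpace ℝ (Fin d), translate (√τ • z) v = v := fun z => by
      rw [Real.sqrt_eq_zero_of_nonpos (not_lt.1 hτ), zero_smul]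
      refine Lp.ext ((coeFn_translate 0 v).trans (ae_of_all _ fun x => ?_))
      simp
    simp [heatSemigroup, hτ, e]
  rw [heatSemigroup, dif_pos hτ]
  refine Lp.ext ((MemLp.coeFn_toLp _).trans ?_)
  have hI : ∀ {g : EuclideanSpace ℝ (Fin d) → ℝ}, MemLp g p volume →
      ∀ s, MeasurableSet s → volume s < ∞ → IntegrableOn g s := fun hg s _ hs => by
    have : IsFiniteMeasure (volume.restrict s) := ⟨by simpa using hs⟩
    exact (hg.restrict s).integrable h1.out
  refine ae_eq_of_forall_setIntegral_eq_of_sigmaFinite (hI (memLp_heatConv hτ v))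
    (hI (Lp.memLp _)) fun A hAm hA => ?_
  obtain ⟨Λ, C, hΛ, hC⟩ := exists_setIntegral_clm (d := d) (p := p) hA
  have : IsFiniteMeasure (volume.restrict A) := ⟨by simpa using hA⟩
  rw [← hΛ, ← ContinuousLinearMap.integral_comp_comm _ (integrable_translate _ _)]
  have hv : Measurable (v : EuclideanSpace ℝ (Fin d) → ℝ) := (Lp.stronglyMeasurable v).measurable
  have hae : ∀ z, (fun x => v (x - √τ • z)) =ᵐ[volume.restrict A] translate (√τ • z) v := fun z =>
    ae_restrict_of_ae (coeFn_translate _ v).symm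
  simp_rw [hΛ, ← integral_comp_heatMeasure hτ]
  rw [integral_integral_swap]
  · exact integral_congr_ae (ae_of_all _ fun z => integral_congr_ae (hae z))
  · have hm : Measurable fun q : EuclideanSpace ℝ (Fin d) × EuclideanSpace ℝ (Fin d) =>
        v (q.1 - √τ • q.2) := hv.comp (by fun_prop)
    rw [Function.uncurry_def, integrable_prod_iff' hm.aestronglyMeasurable]
    have hi : ∀ z, Integrable (fun x => v (x - √τ • z)) (volume.restrict A) := fun z =>
      (hI (Lp.memLp (translate (√τ • z) v)) A hAm hA).congr (hae z).symm
    -- Translations are isometries, so the inner integrals are bounded uniformly in `z`; this is the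
    -- integrability that Fubini needs.
    refine ⟨ae_of_all _ hi, Integrable.of_bound (C := C * ‖v‖)
      (hm.norm.stronglyMeasurable.integral_prod_left').aestronglyMeasurable
      (ae_of_all _ fun z => ?_)⟩
    rw [Real.norm_of_nonneg (integral_nonneg fun _ => norm_nonneg _)]
    have : ∫ x in A, ‖v (x - √τ • z)‖ = ∫ x in A, ‖translate (√τ • z) v x‖ :=
      integral_congr_ae ((hae z).fun_comp norm)
    rw [this, ← norm_translate (√τ • z) v]
    exact hC _

theorem continuous_heatSemigroup [Fact (1 ≤ p)] [Fact (p ≠ ∞)] (v : LpSpace d p) :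
    Continuous fun τ => heatSemigroup τ v := by
  simp_rw [heatSemigroup_eq_integral]
  refine continuous_of_dominated (bound := fun _ => ‖v‖)
    (fun τ => (integrable_translate _ v).aestronglyMeasurable)
    (fun τ => ae_of_all _ fun z => (norm_translate _ _).le) (integrable_const _)
    (ae_of_all _ fun z => ?_)
  exact (continuous_translate v).comp (Real.continuous_sqrt.smul continuous_const)

theorem norm_heatSemigroup_le [Fact (1 ≤ p)] [Fact (p ≠ ∞)] (τ : ℝ) (v : LpSpace d p) :
    ‖heatSemigroup τ v‖ ≤ ‖v‖ := by
  rw [heatSemigroup_eq_integral]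
  refine (norm_integral_le_of_norm_le_const (C := ‖v‖)
    (ae_of_all _ fun z => (norm_translate _ _).le)).trans ?_
  simp

theorem heatSemigroup_sub [Fact (1 ≤ p)] [Fact (p ≠ ∞)] (τ : ℝ) (u v : LpSpace d p) :
    heatSemigroup τ (u - v) = heatSemigroup τ u - heatSemigroup τ v := by
  simp_rw [heatSemigroup_eq_integral, translate_sub]
  exact integral_sub (integrable_translate _ _) (integrable_translate _ _)

theorem integrable_heatSemigroup [Fact (1 ≤ p)] [Fact (p ≠ ∞)] (ν : Measure ℝ) [IsFiniteMeasure ν]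
    (v : LpSpace d p) : Integrable (fun τ => heatSemigroup τ v) ν :=
  Integrable.of_bound (continuous_heatSemigroup v).aestronglyMeasurable ‖v‖
    (ae_of_all _ fun τ => norm_heatSemigroup_le τ v)

end Heat

/-! ### Polynomial approximation on the unit interval and exponential sums -/

section Approximation

open scoped unitInterval

variable {X : Type*} [NormedAddCommGroup X] [NormedSpace ℝ X]

/-- Bernstein approximation applies directly to vector-valued functions; regrouping by powers of `x`
puts the coefficients in `X`. -/
theorem exists_polynomial_approx (F : C(I, X)) {ε : ℝ} (hε : 0 < ε) :
    ∃ N : ℕ, ∃ c : ℕ → X, ∀ x : I,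
      ‖F x - ∑ k ∈ Finset.range (N + 1), (x : ℝ) ^ k • c k‖ ≤ ε := by
  obtain ⟨n, hn⟩ := (Metric.tendsto_atTop.1 (bernsteinApproximation_uniform F) ε hε)
  refine ⟨n, fun j => ∑ k : Fin (n + 1), (bernsteinPolynomial ℝ n k).coeff j • F (bernstein.z k),
    fun x => ?_⟩
  have h := (ContinuousMap.dist_le hε.le).1 (hn n le_rfl).le x
  rw [dist_comm, dist_eq_norm] at h
  suffices hs : ∑ j ∈ Finset.range (n + 1), (x : ℝ) ^ j •
      ∑ k : Fin (n + 1), (bernsteinPolynomial ℝ n k).coeff j • F (bernstein.z k)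
      = bernsteinApproximation n F x by
    rw [hs]
    exact h
  rw [bernsteinApproximation.apply]
  simp_rw [Finset.smul_sum]
  rw [Finset.sum_comm]
  refine Finset.sum_congr rfl fun k _ => ?_
  simp_rw [smul_smul]
  rw [← Finset.sum_smul]
  congr 1
  have hdeg : (bernsteinPolynomial ℝ n k).natDegree < n + 1 := by
    have h0 : bernsteinPolynomial ℝ n k ∈ Polynomial.degreeLT ℝ (n + 1) := by
      rw [Polynomial.mem_degreeLT]
      refine lt_of_le_of_lt ?_ (WithBot.coe_lt_coe.2 (Nat.lt_succ_self n))
      refine Polynomial.natDegree_le_iff_degree_le.1 ?_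
      rw [bernsteinPolynomial]
      have hk : (k : ℕ) + (n - k) = n := by omega
      have hX : (1 - Polynomial.X : Polynomial ℝ).natDegree ≤ 1 := by
        refine (Polynomial.natDegree_sub_le _ _).trans ?_
        simp
      calc _ ≤ (((n.choose k : Polynomial ℝ)) * Polynomial.X ^ (k : ℕ)).natDegree
            + ((1 - Polynomial.X : Polynomial ℝ) ^ (n - k)).natDegree :=
              Polynomial.natDegree_mul_le
        _ ≤ (k : ℕ) + (n - k) * 1 := by
            gcongr
            · refine Polynomial.natDegree_mul_le.trans ?_
              simp
            · exact Polynomial.natDegree_pow_le_of_le _ hX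
        _ = n := by omega
    rw [Polynomial.mem_degreeLT] at h0
    by_cases hz : bernsteinPolynomial ℝ n k = 0
    · simp [hz]
    · exact (Polynomial.natDegree_lt_iff_degree_lt hz).2 h0
  have he : bernstein n k x = (bernsteinPolynomial ℝ n k).eval (x : ℝ) := rfl
  rw [he, Polynomial.eval_eq_sum_range' hdeg]
  exact Finset.sum_congr rfl fun j _ => mul_comm _ _

/-- A finite measure on `[0,1]` is determined by its moments. -/
theorem ext_of_moments {P Q : Measure I} [IsFiniteMeasure P] [IsFiniteMeasure Q]
    (h : ∀ n : ℕ, ∫ x : I, (x : ℝ) ^ n ∂P = ∫ x : I, (x : ℝ) ^ n ∂Q) : P = Q := by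
  refine ext_of_forall_integral_eq_of_IsFiniteMeasure fun f => ?_
  have hint : ∀ (R : Measure I) [IsFiniteMeasure R] (g : I → ℝ), Continuous g → Integrable g R :=
    fun R _ g hg => (BoundedContinuousFunction.mkOfCompact ⟨g, hg⟩).integrable R
  by_contra hne
  set δ := |∫ x, f x ∂P - ∫ x, f x ∂Q| with hδ
  have hδpos : 0 < δ := abs_pos.2 (sub_ne_zero.2 hne)
  set M := P.real univ + Q.real univ with hM
  have hMnn : 0 ≤ M := by positivity
  -- With this accuracy the total error is at most `δ M / (2 (M + 1)) < δ`, also when `M = 0`.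
  obtain ⟨N, c, hc⟩ := exists_polynomial_approx f.toContinuousMap
    (show 0 < δ / (2 * (M + 1)) by positivity)
  set q : I → ℝ := fun x => ∑ k ∈ Finset.range (N + 1), (x : ℝ) ^ k • c k with hq
  have hqc : Continuous q := by fun_prop
  have hqeq : ∫ x, q x ∂P = ∫ x, q x ∂Q := by
    simp only [hq, smul_eq_mul]
    rw [integral_finsetSum _ fun k _ => hint P _ (by fun_prop),
      integral_finsetSum _ fun k _ => hint Q _ (by fun_prop)]
    simp_rw [integral_mul_const, h]
  have hd : ∀ (ρ : Measure I) [IsFiniteMeasure ρ],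
      |∫ x, f x ∂ρ - ∫ x, q x ∂ρ| ≤ δ / (2 * (M + 1)) * ρ.real univ := fun ρ _ => by
    rw [← integral_sub (hint ρ _ f.continuous) (hint ρ _ hqc)]
    exact norm_integral_le_of_norm_le_const (ae_of_all _ hc)
  have h1 := hd P
  have h2 := hd Q
  have h3 : δ ≤ δ / (2 * (M + 1)) * M := by
    rw [hM, mul_add]
    refine le_trans ?_ (add_le_add h1 h2)
    rw [hδ, hqeq, abs_sub_comm (∫ x, f x ∂Q) (∫ x, q x ∂Q)]
    exact abs_sub_le _ _ _
  have h4 : δ / (2 * (M + 1)) * M < δ := by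
    rw [div_mul_eq_mul_div, div_lt_iff₀ (by positivity)]
    nlinarith
  linarith

/-- A continuous function on the half-line vanishing near infinity is uniformly approximated
by exponential sums. -/
theorem exists_exp_sum_approx {h : ℝ → X} (hc : Continuous h) {R : ℝ}
    (hR : ∀ t, R ≤ t → h t = 0) {ε : ℝ} (hε : 0 < ε) :
    ∃ N : ℕ, ∃ c : ℕ → X, ∀ t : ℝ, 0 ≤ t →
      ‖h t - ∑ k ∈ Finset.range (N + 1), Real.exp (-k * t) • c k‖ ≤ ε := by
  -- Substitution `x = e^{-t}`. The maximum with `e^{-R}` avoids the logarithm at zero and changes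
  -- nothing, since `h` vanishes from `R` on.
  let F : C(I, X) := ⟨fun x => h (-Real.log (max (x : ℝ) (Real.exp (-R)))), by
    refine hc.comp (Continuous.neg ?_)
    refine Continuous.log (by fun_prop) fun x => ?_
    exact (lt_max_of_lt_right (Real.exp_pos _)).ne'⟩
  obtain ⟨N, c, hN⟩ := exists_polynomial_approx F hε
  refine ⟨N, c, fun t ht => ?_⟩
  have h1 := hN ⟨Real.exp (-t), (Real.exp_pos _).le, Real.exp_le_one_iff.2 (by linarith)⟩
  have h2 : F ⟨Real.exp (-t), (Real.exp_pos _).le, Real.exp_le_one_iff.2 (by linarith)⟩ = h t := by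
    change h (-Real.log (max (Real.exp (-t)) (Real.exp (-R)))) = h t
    rcases le_total t R with htR | htR
    · rw [max_eq_left (Real.exp_le_exp.2 (by linarith)), Real.log_exp, neg_neg]
    · rw [max_eq_right (Real.exp_le_exp.2 (by linarith)), Real.log_exp, neg_neg, hR t htR,
        hR R le_rfl]
  rw [h2] at h1
  convert h1 using 6 with k
  rw [← Real.exp_nat_mul]
  ring_nf

/-- The integral of a bounded continuous function is approximated by a combination of values of
the Laplace transform, uniformly over measures with a common tail bound. -/
theorem exists_laplace_sum_approx [CompleteSpace X] {h : ℝ → X} (hc : Continuous h) {C : ℝ}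
    (hC : ∀ t, ‖h t‖ ≤ C) (B : ℝ) {ε : ℝ} (hε : 0 < ε) :
    ∃ N : ℕ, ∃ c : ℕ → X, ∀ ν : Measure ℝ, IsProbabilityMeasure ν → ν (Iio 0) = 0 →
      (∀ R : ℝ, 0 < R → ν.real (Ioi R) ≤ B / R) →
      ‖∫ t, h t ∂ν - ∑ k ∈ Finset.range (N + 1), (∫ t, Real.exp (-k * t) ∂ν) • c k‖ ≤ ε := by
  have hC0 : 0 ≤ C := (norm_nonneg _).trans (hC 0)
  obtain ⟨R, hRpos, hR⟩ : ∃ R : ℝ, 0 < R ∧ C * (B / R) ≤ ε / 2 := by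
    refine ⟨2 * (C * |B| + 1) / ε, by positivity, ?_⟩
    have hBB := le_abs_self B
    have : C * B ≤ C * |B| := by gcongr
    field_simp
    nlinarith [mul_nonneg hC0 (abs_nonneg B)]
  -- A cutoff equal to one up to `R` and to zero from `2R` on: the part cut off is charged to the
  -- tail bound, the rest is approximated by exponential sums.
  let χ : ℝ → ℝ := fun t => max 0 (min 1 (2 - t / R))
  have hχc : Continuous χ := by fun_prop
  have hχ0 : ∀ t, 2 * R ≤ t → χ t = 0 := fun t ht => by
    refine max_eq_left ((min_le_right _ _).trans ?_)
    have : 2 ≤ t / R := (le_div_iff₀ hRpos).2 ht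
    linarith
  have hχ1 : ∀ t, t ≤ R → χ t = 1 := fun t ht => by
    have : t / R ≤ 1 := (div_le_one hRpos).2 ht
    simp only [χ]
    rw [min_eq_left (by linarith)]
    norm_num
  have hχn : ∀ t, 0 ≤ χ t ∧ χ t ≤ 1 := fun t =>
    ⟨le_max_left _ _, max_le zero_le_one (min_le_left _ _)⟩
  obtain ⟨N, c, hN⟩ := exists_exp_sum_approx (h := fun t => χ t • h t) (hχc.smul hc)
    (R := 2 * R) (fun t ht => by simp [hχ0 t ht]) (half_pos hε)
  -- The approximation was fixed before any measure appeared, hence its uniformity in `ν`.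
  refine ⟨N, c, fun ν hν hν0 hνB => ?_⟩
  have hnn : ∀ᵐ t ∂ν, 0 ≤ t := by
    rw [ae_iff]
    simpa [Iio] using hν0
  have i1 : Integrable h ν := Integrable.of_bound hc.aestronglyMeasurable C (ae_of_all _ hC)
  have i2 : Integrable (fun t => χ t • h t) ν := by
    refine Integrable.of_bound (hχc.smul hc).aestronglyMeasurable C (ae_of_all _ fun t => ?_)
    rw [norm_smul, Real.norm_of_nonneg (hχn t).1]
    exact (mul_le_of_le_one_left (norm_nonneg _) (hχn t).2).trans (hC t)
  have i3 : ∀ k : ℕ, Integrable (fun t => Real.exp (-k * t)) ν := fun k => by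
    refine Integrable.of_bound (by fun_prop) 1 ?_
    filter_upwards [hnn] with t ht
    rw [Real.norm_of_nonneg (Real.exp_pos _).le, Real.exp_le_one_iff, neg_mul]
    have : 0 ≤ (k : ℝ) * t := by positivity
    linarith
  have i4 : Integrable (fun t => ∑ k ∈ Finset.range (N + 1), Real.exp (-k * t) • c k) ν :=
    integrable_finsetSum _ fun k _ => (i3 k).smul_const _
  have e4 : ∑ k ∈ Finset.range (N + 1), (∫ t, Real.exp (-k * t) ∂ν) • c k
      = ∫ t, ∑ k ∈ Finset.range (N + 1), Real.exp (-k * t) • c k ∂ν := by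
    rw [integral_finsetSum _ fun k _ => (i3 k).smul_const _]
    simp_rw [integral_smul_const]
  rw [e4]
  have a1 : ‖∫ t, h t ∂ν - ∫ t, χ t • h t ∂ν‖ ≤ ε / 2 := by
    rw [← integral_sub i1 i2]
    refine le_trans ?_ ((mul_le_mul_of_nonneg_left (hνB R hRpos) hC0).trans hR)
    have : C * ν.real (Ioi R) = ∫ t, (Ioi R).indicator (fun _ => C) t ∂ν := by
      rw [integral_indicator_const _ measurableSet_Ioi, smul_eq_mul, mul_comm]
    rw [this]
    refine norm_integral_le_of_norm_le ((integrable_const C).indicator measurableSet_Ioi)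
      (ae_of_all _ fun t => ?_)
    by_cases ht : t ∈ Ioi R
    · rw [indicator_of_mem ht, show h t - χ t • h t = (1 - χ t) • h t by rw [sub_smul, one_smul],
        norm_smul, Real.norm_of_nonneg (by linarith [(hχn t).2])]
      exact (mul_le_of_le_one_left (norm_nonneg _) (by linarith [(hχn t).1])).trans (hC t)
    · rw [indicator_of_notMem ht, hχ1 t (not_lt.1 ht)]
      simp
  have a2 : ‖∫ t, χ t • h t ∂ν - ∫ t, ∑ k ∈ Finset.range (N + 1), Real.exp (-k * t) • c k ∂ν‖
      ≤ ε / 2 := by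
    rw [← integral_sub i2 i4]
    refine (norm_integral_le_of_norm_le_const (C := ε / 2) ?_).trans (by simp)
    filter_upwards [hnn] with t ht using hN t ht
  have := norm_sub_le_norm_sub_add_norm_sub (∫ t, h t ∂ν) (∫ t, χ t • h t ∂ν)
    (∫ t, ∑ k ∈ Finset.range (N + 1), Real.exp (-k * t) • c k ∂ν)
  linarith

theorem integrableOn_exp_mul_of_bounded {F : ℝ → ℝ} {C lam : ℝ} (hlam : 0 < lam)
    (hF : AEStronglyMeasurable F (volume.restrict (Ioi 0))) (hFC : ∀ t, 0 < t → |F t| ≤ C) :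
    IntegrableOn (fun t => Real.exp (-lam * t) * F t) (Ioi 0) := by
  refine Integrable.mul_bdd (c := C) (integrableOn_exp_mul_Ioi (by linarith) 0) hF ?_
  filter_upwards [ae_restrict_mem measurableSet_Ioi] with t ht using hFC t ht

/-- Bounded functions on the half-line with the same Laplace transform agree almost everywhere. -/
theorem ae_eq_of_laplace_eq {F G : ℝ → ℝ} {C : ℝ}
    (hF : AEStronglyMeasurable F (volume.restrict (Ioi 0)))
    (hG : AEStronglyMeasurable G (volume.restrict (Ioi 0)))
    (hFC : ∀ t, 0 < t → |F t| ≤ C) (hGC : ∀ t, 0 < t → |G t| ≤ C)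
    (h : ∀ lam : ℝ, 0 < lam → laplace F lam = laplace G lam) :
    ∀ᵐ t ∂volume.restrict (Ioi 0), F t = G t := by
  -- The factor `e^{-t}` makes the difference integrable and shifts the exponents `0, 1, 2, …` to
  -- positive ones, where the transforms agree. So `D` annihilates all exponential sums, hence by
  -- uniform approximation all test functions.
  set D : ℝ → ℝ := fun t => Real.exp (-1 * t) * (F t - G t) with hD
  have hFi := fun lam hlam => integrableOn_exp_mul_of_bounded (lam := lam) hlam hF hFC
  have hGi := fun lam hlam => integrableOn_exp_mul_of_bounded (lam := lam) hlam hG hGC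
  have hDi : IntegrableOn D (Ioi 0) := by
    refine ((hFi 1 one_pos).sub (hGi 1 one_pos)).congr (ae_of_all _ fun t => ?_)
    simp only [hD, Pi.sub_apply]
    ring
  have hexp : ∀ k : ℕ, IntegrableOn (fun t => Real.exp (-k * t) * D t) (Ioi 0) ∧
      ∫ t in Ioi 0, Real.exp (-k * t) * D t = 0 := fun k => by
    have hk : (0 : ℝ) < k + 1 := by positivity
    have e : ∀ t, Real.exp (-k * t) * D t
        = Real.exp (-(k + 1 : ℝ) * t) * F t - Real.exp (-(k + 1 : ℝ) * t) * G t := fun t => by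
      simp only [hD]
      rw [← mul_assoc, ← Real.exp_add, ← mul_sub]
      ring_nf
    simp_rw [e]
    refine ⟨(hFi _ hk).sub (hGi _ hk), ?_⟩
    rw [integral_sub (hFi _ hk) (hGi _ hk)]
    exact sub_eq_zero.2 (h _ hk)
  have key : ∀ᵐ t, t ∈ Ioi (0 : ℝ) → D t = 0 := by
    refine isOpen_Ioi.ae_eq_zero_of_integral_contDiff_smul_eq_zero hDi.locallyIntegrableOn
      fun g hg hgc hgs => ?_
    obtain ⟨R, hR⟩ := hgc.isCompact.bddAbove
    have hgR : ∀ t, R + 1 ≤ t → g t = 0 := fun t ht => by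
      by_contra hne
      have := hR (subset_tsupport g (Function.mem_support.2 hne))
      linarith
    have hg0 : ∀ t, t ∉ Ioi (0 : ℝ) → g t • D t = 0 := fun t ht => by
      rw [image_eq_zero_of_notMem_tsupport (fun h => ht (hgs h)), zero_smul]
    rw [← setIntegral_eq_integral_of_forall_compl_eq_zero hg0]
    obtain ⟨M, hM⟩ := hg.continuous.bounded_above_of_compact_support hgc
    have hgD : IntegrableOn (fun t => g t • D t) (Ioi 0) :=
      hDi.bdd_mul hg.continuous.aestronglyMeasurable (ae_of_all _ hM)
    by_contra hne
    set δ := ‖∫ t in Ioi 0, g t • D t‖ with hδ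
    have hδpos : 0 < δ := norm_pos_iff.2 hne
    set K := ∫ t in Ioi 0, ‖D t‖ with hK
    have hKnn : 0 ≤ K := integral_nonneg fun _ => norm_nonneg _
    obtain ⟨N, c, hN⟩ := exists_exp_sum_approx hg.continuous hgR
      (show 0 < δ / (2 * (K + 1)) by positivity)
    have i1 : IntegrableOn (fun t => ∑ k ∈ Finset.range (N + 1), c k * (Real.exp (-k * t) * D t))
        (Ioi 0) := integrable_finsetSum _ fun k _ => (hexp k).1.const_mul _
    have z1 : ∫ t in Ioi 0, ∑ k ∈ Finset.range (N + 1), c k * (Real.exp (-k * t) * D t) = 0 := by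
      rw [integral_finsetSum _ fun k _ => (hexp k).1.const_mul _]
      simp_rw [integral_const_mul, (hexp _).2]
      simp
    have hle : δ ≤ δ / (2 * (K + 1)) * K := by
      have hs : δ = ‖∫ t in Ioi 0, (g t • D t
          - ∑ k ∈ Finset.range (N + 1), c k * (Real.exp (-k * t) * D t))‖ := by
        rw [integral_sub hgD i1, z1, sub_zero]
      rw [hK, ← integral_const_mul]
      refine hs.le.trans ?_
      refine norm_integral_le_of_norm_le (hDi.norm.const_mul _) ?_
      filter_upwards [ae_restrict_mem measurableSet_Ioi] with t ht
      have e : g t • D t - ∑ k ∈ Finset.range (N + 1), c k * (Real.exp (-k * t) * D t)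
          = (g t - ∑ k ∈ Finset.range (N + 1), Real.exp (-k * t) • c k) * D t := by
        rw [sub_mul, Finset.sum_mul, smul_eq_mul]
        congr 1
        refine Finset.sum_congr rfl fun k _ => ?_
        rw [smul_eq_mul]
        ring
      rw [e, norm_mul]
      gcongr
      exact hN t (le_of_lt ht)
    have h4 : δ / (2 * (K + 1)) * K < δ := by
      rw [div_mul_eq_mul_div, div_lt_iff₀ (by positivity)]
      nlinarith
    linarith
  rw [ae_restrict_iff' measurableSet_Ioi]
  filter_upwards [key] with t ht hpos
  have := ht hpos
  simp only [hD, mul_eq_zero, (Real.exp_pos _).ne', false_or] at this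
  linarith

end Approximation

/-! ### Convolutions of nonnegative functions on the half-line -/

section Volterra

/-- The convolution of two `[0,∞]`-valued functions on the line. -/
def lconv (A C : ℝ → ℝ≥0∞) (t : ℝ) : ℝ≥0∞ := ∫⁻ σ, A (t - σ) * C σ

/-- The exponentially weighted integral over `J`. -/
def lweight (lam : ℝ) (J : Set ℝ) (A : ℝ → ℝ≥0∞) : ℝ≥0∞ :=
  ∫⁻ t in J, ENNReal.ofReal (Real.exp (-lam * t)) * A t

theorem measurable_lconv {A C : ℝ → ℝ≥0∞} (hA : Measurable A) (hC : Measurable C) :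
    Measurable (lconv A C) := by
  have : Measurable fun q : ℝ × ℝ => A (q.1 - q.2) * C q.2 :=
    (hA.comp (measurable_fst.sub measurable_snd)).mul (hC.comp measurable_snd)
  exact this.lintegral_prod_right'

theorem lintegral_lconv {A C : ℝ → ℝ≥0∞} (hA : Measurable A) (hC : Measurable C) :
    ∫⁻ t, lconv A C t = (∫⁻ t, A t) * ∫⁻ t, C t := by
  have hm : Measurable fun q : ℝ × ℝ => A (q.1 - q.2) * C q.2 :=
    (hA.comp (measurable_fst.sub measurable_snd)).mul (hC.comp measurable_snd)
  simp only [lconv]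
  rw [lintegral_lintegral_swap hm.aemeasurable]
  have e : ∀ σ, ∫⁻ t, A (t - σ) * C σ = (∫⁻ t, A t) * C σ := fun σ => by
    rw [lintegral_mul_const _ (by fun_prop), lintegral_sub_right_eq_self A σ]
  simp_rw [e]
  rw [lintegral_const_mul _ hC]

theorem lweight_eq_lintegral_indicator {lam : ℝ} {J : Set ℝ} (hJ : MeasurableSet J)
    (A : ℝ → ℝ≥0∞) :
    lweight lam J A = ∫⁻ t, J.indicator (fun t => ENNReal.ofReal (Real.exp (-lam * t)) * A t) t :=
  (lintegral_indicator hJ _).symm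

theorem lweight_mono {lam : ℝ} {J : Set ℝ} {A C : ℝ → ℝ≥0∞}
    (h : ∀ᵐ t ∂volume.restrict J, A t ≤ C t) :
    lweight lam J A ≤ lweight lam J C := by
  refine lintegral_mono_ae ?_
  filter_upwards [h] with t ht
  gcongr

theorem lweight_add {lam : ℝ} {J : Set ℝ} {A C : ℝ → ℝ≥0∞} (hA : Measurable A) :
    lweight lam J (fun t => A t + C t) = lweight lam J A + lweight lam J C := by
  simp only [lweight, mul_add]
  exact lintegral_add_left (by fun_prop) _

theorem lweight_const_mul {lam : ℝ} {J : Set ℝ} {A : ℝ → ℝ≥0∞} (hA : Measurable A) (c : ℝ≥0∞) :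
    lweight lam J (fun t => c * A t) = c * lweight lam J A := by
  simp only [lweight, mul_left_comm _ c]
  exact lintegral_const_mul _ (by fun_prop)

theorem ofReal_exp_mul_split (lam t σ : ℝ) :
    ENNReal.ofReal (Real.exp (-lam * t))
      = ENNReal.ofReal (Real.exp (-lam * (t - σ))) * ENNReal.ofReal (Real.exp (-lam * σ)) := by
  rw [← ENNReal.ofReal_mul (Real.exp_pos _).le, ← Real.exp_add]
  ring_nf

/-- Young's inequality with an exponential weight on a bounded interval. -/
theorem lweight_lconv_le (lam T : ℝ) {A C : ℝ → ℝ≥0∞} (hA : Measurable A) (hC : Measurable C)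
    (hA0 : ∀ t ≤ 0, A t = 0) (hC0 : ∀ t ≤ 0, C t = 0) :
    lweight lam (Ioo 0 T) (lconv A C) ≤ lweight lam (Ioo 0 T) A * lweight lam (Ioo 0 T) C := by
  have hmA : Measurable ((Ioo 0 T).indicator fun t => ENNReal.ofReal (Real.exp (-lam * t)) * A t) :=
    Measurable.indicator (by fun_prop) measurableSet_Ioo
  have hmC : Measurable ((Ioo 0 T).indicator fun t => ENNReal.ofReal (Real.exp (-lam * t)) * C t) :=
    Measurable.indicator (by fun_prop) measurableSet_Ioo
  rw [lweight_eq_lintegral_indicator measurableSet_Ioo A,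
    lweight_eq_lintegral_indicator measurableSet_Ioo C, ← lintegral_lconv hmA hmC]
  refine le_trans ?_ (setLIntegral_le_lintegral (Ioo 0 T) _)
  refine setLIntegral_mono (measurable_lconv hmA hmC) fun t ht => ?_
  simp only [lconv]
  rw [← lintegral_const_mul _ (show Measurable fun σ => A (t - σ) * C σ by fun_prop)]
  refine lintegral_mono fun σ => ?_
  rcases le_or_gt σ 0 with hσ | hσ
  · simp [hC0 σ hσ]
  rcases le_or_gt (t - σ) 0 with hσt | hσt
  · simp [hA0 _ hσt]
  rw [indicator_of_mem (show t - σ ∈ Ioo 0 T from ⟨hσt, by linarith [ht.2]⟩),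
    indicator_of_mem (show σ ∈ Ioo 0 T from ⟨hσ, by linarith [ht.2]⟩),
    ofReal_exp_mul_split lam t σ]
  apply le_of_eq
  ring

/-- The Laplace transform turns convolutions into products. -/
theorem lweight_lconv (lam : ℝ) {A C : ℝ → ℝ≥0∞} (hA : Measurable A) (hC : Measurable C)
    (hA0 : ∀ t ≤ 0, A t = 0) (hC0 : ∀ t ≤ 0, C t = 0) :
    lweight lam (Ioi 0) (lconv A C) = lweight lam (Ioi 0) A * lweight lam (Ioi 0) C := by
  have hind : ∀ {D : ℝ → ℝ≥0∞}, (∀ t ≤ 0, D t = 0) → lweight lam (Ioi 0) D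
      = ∫⁻ t, ENNReal.ofReal (Real.exp (-lam * t)) * D t := fun {D} hD => by
    rw [lweight_eq_lintegral_indicator measurableSet_Ioi]
    refine lintegral_congr fun t => ?_
    by_cases ht : t ∈ Ioi (0 : ℝ)
    · rw [indicator_of_mem ht]
    · rw [indicator_of_notMem ht, hD t (not_lt.1 ht), mul_zero]
  have hAC0 : ∀ t ≤ 0, lconv A C t = 0 := fun t ht => by
    refine (lintegral_congr fun σ => ?_).trans lintegral_zero
    rcases le_or_gt σ 0 with hσ | hσ
    · simp [hC0 σ hσ]
    · simp [hA0 (t - σ) (by linarith)]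
  rw [hind hA0, hind hC0, hind hAC0, ← lintegral_lconv (by fun_prop) (by fun_prop)]
  refine lintegral_congr fun t => ?_
  simp only [lconv]
  rw [← lintegral_const_mul _ (show Measurable fun σ => A (t - σ) * C σ by fun_prop)]
  refine lintegral_congr fun σ => ?_
  rw [ofReal_exp_mul_split lam t σ]
  ring

theorem lweight_le_lintegral {lam T : ℝ} (hlam : 0 ≤ lam) (A : ℝ → ℝ≥0∞) :
    lweight lam (Ioo 0 T) A ≤ ∫⁻ t in Ioo 0 T, A t := by
  refine lintegral_mono_ae ?_
  filter_upwards [ae_restrict_mem measurableSet_Ioo] with t ht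
  refine mul_le_of_le_one_left (zero_le) ?_
  rw [ENNReal.ofReal_le_one, Real.exp_le_one_iff]
  nlinarith [ht.1]

theorem lintegral_le_lweight {lam T : ℝ} (hlam : 0 ≤ lam) {A : ℝ → ℝ≥0∞} (hA : Measurable A) :
    ∫⁻ t in Ioo 0 T, A t ≤ ENNReal.ofReal (Real.exp (lam * T)) * lweight lam (Ioo 0 T) A := by
  rw [lweight, ← lintegral_const_mul _ (by fun_prop)]
  refine lintegral_mono_ae ?_
  filter_upwards [ae_restrict_mem measurableSet_Ioo] with t ht
  rw [← mul_assoc, ← ENNReal.ofReal_mul (Real.exp_pos _).le, ← Real.exp_add]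
  refine le_mul_of_one_le_left (zero_le) ?_
  rw [ENNReal.one_le_ofReal, Real.one_le_exp_iff]
  nlinarith [ht.1, ht.2]

/-- Dominated convergence as the weight exponent tends to infinity. This supplies the smallness for
Gronwall on an interval of any length. -/
theorem exists_lweight_le {T : ℝ} {A : ℝ → ℝ≥0∞} (hA : Measurable A)
    (hfin : ∫⁻ t in Ioo 0 T, A t ≠ ∞) {ε : ℝ≥0∞} (hε : 0 < ε) :
    ∃ lam : ℝ, 0 ≤ lam ∧ lweight lam (Ioo 0 T) A ≤ ε := by
  have h : Tendsto (fun n : ℕ => lweight n (Ioo 0 T) A) atTop (𝓝 (∫⁻ t in Ioo 0 T, 0)) := by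
    refine tendsto_lintegral_of_dominated_convergence A (fun n => by fun_prop) (fun n => ?_) hfin ?_
    · filter_upwards [ae_restrict_mem measurableSet_Ioo] with t ht
      refine mul_le_of_le_one_left (zero_le) ?_
      rw [ENNReal.ofReal_le_one, Real.exp_le_one_iff]
      have : (0 : ℝ) ≤ n * t := mul_nonneg (by positivity) ht.1.le
      linarith
    · filter_upwards [ae_restrict_mem measurableSet_Ioo, ae_lt_top hA hfin] with t ht htop
      rw [show (0 : ℝ≥0∞) = 0 * A t by simp]
      refine ENNReal.Tendsto.mul_const ?_ (Or.inr htop.ne)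
      rw [← ENNReal.ofReal_zero]
      refine ENNReal.tendsto_ofReal (Real.tendsto_exp_atBot.comp ?_)
      have := (tendsto_natCast_atTop_atTop (R := ℝ)).const_mul_atTop ht.1
      refine (tendsto_neg_atTop_atBot.comp this).congr fun n => ?_
      simp [mul_comm]
  rw [lintegral_zero] at h
  obtain ⟨n, hn⟩ := (h.eventually (ge_mem_nhds hε)).exists
  exact ⟨n, by positivity, hn⟩

/-- A Gronwall inequality for Volterra convolution inequalities. -/
theorem lweight_le_two_mul {lam T : ℝ} {β ρ g : ℝ → ℝ≥0∞} (hβ : Measurable β)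
    (hρ : Measurable ρ) (hg : Measurable g) (hβ0 : ∀ t ≤ 0, β t = 0) (hρ0 : ∀ t ≤ 0, ρ t = 0)
    (k : ℝ≥0∞)
    (hfin : lweight lam (Ioo 0 T) β ≠ ∞) (hsmall : k * lweight lam (Ioo 0 T) ρ ≤ 2⁻¹)
    (h : ∀ᵐ t ∂volume.restrict (Ioo 0 T), β t ≤ g t + k * lconv ρ β t) :
    lweight lam (Ioo 0 T) β ≤ 2 * lweight lam (Ioo 0 T) g := by
  set x := lweight lam (Ioo 0 T) β with hx
  set y := lweight lam (Ioo 0 T) g with hy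
  -- The term `x / 2` is absorbed into the left side, which is legitimate only because `x` is
  -- finite.
  have h1 : x ≤ y + 2⁻¹ * x := by
    calc x ≤ lweight lam (Ioo 0 T) (fun t => g t + k * lconv ρ β t) :=
          lweight_mono h
      _ = y + k * lweight lam (Ioo 0 T) (lconv ρ β) := by
          rw [lweight_add hg, lweight_const_mul (measurable_lconv hρ hβ)]
      _ ≤ y + k * (lweight lam (Ioo 0 T) ρ * x) := by
          gcongr
          exact lweight_lconv_le lam T hρ hβ hρ0 hβ0
      _ ≤ y + 2⁻¹ * x := by
          rw [← mul_assoc]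
          gcongr
  rcases eq_or_ne y ∞ with hyt | hyt
  · simp [hyt]
  clear_value x y
  lift x to NNReal using hfin
  lift y to NNReal using hyt
  have h2 : ((x : ℝ≥0∞)) ≤ ((y + 2⁻¹ * x : NNReal) : ℝ≥0∞) := by
    refine h1.trans (le_of_eq ?_)
    push_cast
    rfl
  rw [ENNReal.coe_le_coe] at h2
  have h3 : x ≤ 2 * y := by
    rw [← NNReal.coe_le_coe] at h2 ⊢
    push_cast at h2 ⊢
    linarith
  exact_mod_cast h3

end Volterra

/-! ### Completely positive kernels -/

section CompletelyPositive

theorem LocInt.aestronglyMeasurable {b : ℝ → ℝ} (hb : LocInt b) :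
    AEStronglyMeasurable b (volume.restrict (Ioi 0)) := by
  have : Ioi (0 : ℝ) = ⋃ n : ℕ, Ioc 0 (n : ℝ) := by
    ext t
    simp only [mem_Ioi, mem_iUnion, mem_Ioc]
    exact ⟨fun h => (exists_nat_ge t).imp fun n hn => ⟨h, hn⟩, fun ⟨n, h, _⟩ => h⟩
  rw [this, aestronglyMeasurable_iUnion_iff]
  exact fun n => (hb n).aestronglyMeasurable

theorem LocInt.lintegral_Ioo_ne_top {b : ℝ → ℝ} (hb : LocInt b) (T : ℝ) :
    ∫⁻ t in Ioo 0 T, ‖b t‖ₑ ≠ ∞ :=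
  ((hb T).mono_set Ioo_subset_Ioc_self).2.ne

theorem ae_Ioi_of_forall_Ioo {P : ℝ → Prop}
    (h : ∀ T : ℝ, ∀ᵐ t ∂volume.restrict (Ioo 0 T), P t) : ∀ᵐ t ∂volume.restrict (Ioi 0), P t := by
  have h1 : ∀ᵐ t : ℝ, ∀ n : ℕ, t ∈ Ioo (0 : ℝ) n → P t :=
    ae_all_iff.2 fun n => (ae_restrict_iff' measurableSet_Ioo).1 (h n)
  rw [ae_restrict_iff' measurableSet_Ioi]
  filter_upwards [h1] with t ht hpos
  obtain ⟨n, hn⟩ := exists_nat_gt t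
  exact ht n ⟨hpos, hn⟩

theorem exists_measurable_rep {m : ℝ → ℝ} (hm : LocInt m) :
    ∃ b : ℝ → ℝ, Measurable b ∧ (∀ t ≤ 0, b t = 0) ∧ b =ᵐ[volume.restrict (Ioi 0)] m := by
  have h := hm.aestronglyMeasurable
  refine ⟨(Ioi 0).indicator (h.mk m), h.stronglyMeasurable_mk.measurable.indicator
    measurableSet_Ioi, fun t ht => indicator_of_notMem (not_lt.2 ht) _, ?_⟩
  filter_upwards [h.ae_eq_mk, ae_restrict_mem measurableSet_Ioi] with t ht hpos
  rw [indicator_of_mem hpos, ht]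

/-- For representatives vanishing at nonpositive times the convolution runs over the whole line,
where translation and reflection invariance can be used. -/
theorem conv_eq_integral {a a' c c' : ℝ → ℝ} (ha : a' =ᵐ[volume.restrict (Ioi 0)] a)
    (hc : c' =ᵐ[volume.restrict (Ioi 0)] c) (ha0 : ∀ t ≤ 0, a' t = 0) (hc0 : ∀ t ≤ 0, c' t = 0)
    {t : ℝ} (ht : 0 ≤ t) : conv a c t = ∫ σ, a' (t - σ) * c' σ := by
  have h0 : ∀ σ, σ ∉ Ioo 0 t → a' (t - σ) * c' σ = 0 := fun σ hσ => by
    rcases le_or_gt σ 0 with h | h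
    · simp [hc0 σ h]
    · have : t ≤ σ := not_lt.1 fun h' => hσ ⟨h, h'⟩
      simp [ha0 (t - σ) (by linarith)]
  rw [conv, intervalIntegral.integral_of_le ht, integral_Ioc_eq_integral_Ioo,
    ← setIntegral_eq_integral_of_forall_compl_eq_zero h0]
  refine setIntegral_congr_ae measurableSet_Ioo ?_
  rw [EventuallyEq, ae_restrict_iff' measurableSet_Ioi] at ha hc
  have ha' := (Measure.measurePreserving_sub_left volume t).quasiMeasurePreserving.ae ha
  filter_upwards [ha', hc] with σ h1 h2 hσ
  rw [h1 (by simpa using hσ.2), h2 hσ.1]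

/-- Holds without integrability, since the Bochner integral then defaults to zero. -/
theorem ofReal_integral_le_lintegral (f : ℝ → ℝ) :
    ENNReal.ofReal (∫ x, f x) ≤ ∫⁻ x, ENNReal.ofReal (f x) := by
  by_cases hf : Integrable f
  · rw [integral_eq_lintegral_pos_part_sub_lintegral_neg_part hf]
    refine (ENNReal.ofReal_le_ofReal (sub_le_self _ ENNReal.toReal_nonneg)).trans ?_
    exact ENNReal.ofReal_toReal_le
  · simp [integral_undef hf]

/-- From `m = r + m * r` with `r ≥ 0` the negative part satisfies `m⁻ ≤ r * m⁻`, and the Volterra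
Gronwall inequality with zero forcing gives `m⁻ = 0`. -/
theorem CompletelyPositive.ae_nonneg {m : ℝ → ℝ} (hm : CompletelyPositive m) :
    ∀ᵐ t ∂volume.restrict (Ioi (0 : ℝ)), 0 ≤ m t := by
  obtain ⟨r, hr, hreq, hr0⟩ := hm.exists_r 1 one_pos
  obtain ⟨b, hbm, hb0, hb⟩ := exists_measurable_rep hm.locInt
  obtain ⟨r', hrm, hr'0, hr'⟩ := exists_measurable_rep hr
  suffices ∀ᵐ t ∂volume.restrict (Ioi (0 : ℝ)), 0 ≤ b t by
    filter_upwards [this, hb] with t h1 h2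
    rwa [← h2]
  have key : ∀ᵐ t ∂volume.restrict (Ioi (0 : ℝ)), ENNReal.ofReal (-b t)
      ≤ 0 + 1 * lconv (fun t => ‖r' t‖ₑ) (fun t => ENNReal.ofReal (-b t)) t := by
    have hr'nn : ∀ᵐ σ : ℝ, 0 ≤ r' σ := by
      have h1 : ∀ᵐ t ∂volume.restrict (Ioi (0 : ℝ)), 0 ≤ r' t := by
        filter_upwards [hr', hr0] with t h1 h2
        rwa [h1]
      rw [ae_restrict_iff' measurableSet_Ioi] at h1
      filter_upwards [h1] with t ht
      rcases le_or_gt t 0 with h | h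
      · rw [hr'0 t h]
      · exact ht h
    filter_upwards [hreq, hb, hr', hr0, ae_restrict_mem measurableSet_Ioi] with t h1 h2 h3 h4 ht
    rw [conv_eq_integral hb hr' hb0 hr'0 (le_of_lt ht), one_mul, ← h2] at h1
    rw [zero_add, one_mul]
    have h5 : -b t ≤ ∫ σ, -(b (t - σ) * r' σ) := by
      rw [integral_neg]
      linarith
    refine (ENNReal.ofReal_le_ofReal h5).trans ((ofReal_integral_le_lintegral _).trans ?_)
    rw [lconv, ← lintegral_sub_left_eq_self (fun σ => ‖r' (t - σ)‖ₑ * ENNReal.ofReal (-b σ)) t]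
    refine lintegral_mono_ae ?_
    filter_upwards [hr'nn] with σ hσ
    rw [sub_sub_cancel, Real.enorm_of_nonneg hσ, ← ENNReal.ofReal_mul hσ]
    exact ENNReal.ofReal_le_ofReal (by linarith)
  refine ae_Ioi_of_forall_Ioo fun T => ?_
  have hmono : volume.restrict (Ioo 0 T) ≤ volume.restrict (Ioi (0 : ℝ)) :=
    Measure.restrict_mono Ioo_subset_Ioi_self le_rfl
  have hrfin : ∫⁻ t in Ioo 0 T, ‖r' t‖ₑ ≠ ∞ := by
    have e : ∫⁻ t in Ioo 0 T, ‖r' t‖ₑ = ∫⁻ t in Ioo 0 T, ‖r t‖ₑ :=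
      lintegral_congr_ae (EventuallyEq.fun_comp (ae_mono hmono hr') (‖·‖ₑ))
    rw [e]
    exact hr.lintegral_Ioo_ne_top T
  have hbfin : ∫⁻ t in Ioo 0 T, ‖b t‖ₑ ≠ ∞ := by
    have e : ∫⁻ t in Ioo 0 T, ‖b t‖ₑ = ∫⁻ t in Ioo 0 T, ‖m t‖ₑ :=
      lintegral_congr_ae (EventuallyEq.fun_comp (ae_mono hmono hb) (‖·‖ₑ))
    rw [e]
    exact hm.locInt.lintegral_Ioo_ne_top T
  obtain ⟨lam, hlam, hsmall⟩ := exists_lweight_le (by fun_prop) hrfin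
    (show (0 : ℝ≥0∞) < 2⁻¹ by simp)
  have h := lweight_le_two_mul (lam := lam) (T := T) (β := fun t => ENNReal.ofReal (-b t))
    (ρ := fun t => ‖r' t‖ₑ) (g := fun _ => 0) (by fun_prop) (by fun_prop) (by fun_prop)
    (fun t ht => by simp [hb0 t ht]) (fun t ht => by simp [hr'0 t ht]) 1
    (((lweight_le_lintegral hlam _).trans (lintegral_mono fun t => by
      rw [← ofReal_norm]
      exact ENNReal.ofReal_le_ofReal (neg_le_abs _))).trans_lt hbfin.lt_top).ne
    (by rwa [one_mul]) (ae_mono hmono key)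
  have hz : lweight lam (Ioo 0 T) (fun t => ENNReal.ofReal (-b t)) = 0 := by
    simpa [lweight] using h
  rw [lweight, lintegral_eq_zero_iff (by fun_prop)] at hz
  filter_upwards [hz] with t ht
  simpa [(Real.exp_pos _).not_ge] using ht

/-- `b` is a version of `m` on the half-line that is measurable, nonnegative, and zero for
nonpositive times. -/
structure IsNonnegRep (b m : ℝ → ℝ) : Prop where
  measurable : Measurable b
  nonneg : ∀ t, 0 ≤ b t
  zero : ∀ t ≤ 0, b t = 0
  ae_eq : b =ᵐ[volume.restrict (Ioi 0)] m

theorem exists_isNonnegRep {m : ℝ → ℝ} (hm : LocInt m)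
    (h0 : ∀ᵐ t ∂volume.restrict (Ioi (0 : ℝ)), 0 ≤ m t) : ∃ b, IsNonnegRep b m := by
  obtain ⟨b, h1, h2, h3⟩ := exists_measurable_rep hm
  refine ⟨fun t => max (b t) 0, by fun_prop, fun t => le_max_right _ _,
    fun t ht => by simp [h2 t ht], ?_⟩
  filter_upwards [h0, h3] with t h4 h5
  rw [h5, max_eq_left h4]

theorem IsNonnegRep.lintegral_Ioo_ne_top {b m : ℝ → ℝ} (hb : IsNonnegRep b m) (hm : LocInt m)
    (T : ℝ) : ∫⁻ t in Ioo 0 T, ENNReal.ofReal (b t) ≠ ∞ := by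
  have hmono : volume.restrict (Ioo 0 T) ≤ volume.restrict (Ioi (0 : ℝ)) :=
    Measure.restrict_mono Ioo_subset_Ioi_self le_rfl
  convert hm.lintegral_Ioo_ne_top T using 1
  refine lintegral_congr_ae ?_
  filter_upwards [ae_mono hmono hb.ae_eq] with t ht
  rw [← ht, Real.enorm_of_nonneg (hb.nonneg t)]

/-- The pointwise form of the Volterra equation `x + k b * x = y` on the half-line, for
representatives that vanish for nonpositive times. -/
def IsVolterraSolution (k : ℝ) (b x y : ℝ → ℝ) : Prop :=
  ∀ᵐ t ∂volume.restrict (Ioi (0 : ℝ)), Integrable (fun σ => b (t - σ) * x σ) ∧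
    x t + k * ∫ σ, b (t - σ) * x σ = y t

theorem lconv_ofReal_lt_top {b m x n : ℝ → ℝ} (hb : IsNonnegRep b m) (hx : IsNonnegRep x n)
    (hm : LocInt m) (hn : LocInt n) : ∀ᵐ t ∂volume.restrict (Ioi (0 : ℝ)),
      lconv (fun t => ENNReal.ofReal (b t)) (fun t => ENNReal.ofReal (x t)) t < ∞ := by
  have hb' := hb.measurable
  have hx' := hx.measurable
  refine ae_Ioi_of_forall_Ioo fun T => ?_
  refine ae_lt_top (measurable_lconv (by fun_prop) (by fun_prop)) ?_
  have h := lweight_lconv_le 0 T (A := fun t => ENNReal.ofReal (b t))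
    (C := fun t => ENNReal.ofReal (x t)) (by fun_prop) (by fun_prop)
    (fun t ht => by simp [hb.zero t ht]) (fun t ht => by simp [hx.zero t ht])
  simp only [lweight, neg_zero, zero_mul, Real.exp_zero, ENNReal.ofReal_one, one_mul] at h
  exact (h.trans_lt (ENNReal.mul_lt_top (hb.lintegral_Ioo_ne_top hm T).lt_top
    (hx.lintegral_Ioo_ne_top hn T).lt_top)).ne

theorem isVolterraSolution_of_conv {k : ℝ} {b m x n y : ℝ → ℝ} (hb : IsNonnegRep b m)
    (hx : IsNonnegRep x n) (hm : LocInt m) (hn : LocInt n)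
    (h : ∀ᵐ t ∂volume.restrict (Ioi (0 : ℝ)), n t + k * conv m n t = y t) :
    IsVolterraSolution k b x y := by
  have hb' := hb.measurable
  have hx' := hx.measurable
  filter_upwards [h, hx.ae_eq, lconv_ofReal_lt_top hb hx hm hn, ae_restrict_mem measurableSet_Ioi]
    with t h1 h2 h3 ht
  rw [conv_eq_integral hb.ae_eq hx.ae_eq hb.zero hx.zero (le_of_lt ht), ← h2] at h1
  refine ⟨⟨by fun_prop, ?_⟩, h1⟩
  refine lt_of_eq_of_lt (lintegral_congr fun σ => ?_) h3
  rw [Real.enorm_of_nonneg (mul_nonneg (hb.nonneg _) (hx.nonneg _)),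
    ENNReal.ofReal_mul (hb.nonneg _)]

theorem IsVolterraSolution.ofReal_eq {k : ℝ} (hk : 0 ≤ k) {b x y : ℝ → ℝ} (hb : ∀ t, 0 ≤ b t)
    (hx : ∀ t, 0 ≤ x t) (h : IsVolterraSolution k b x y) :
    ∀ᵐ t ∂volume.restrict (Ioi (0 : ℝ)), ENNReal.ofReal (x t) + ENNReal.ofReal k *
      lconv (fun t => ENNReal.ofReal (b t)) (fun t => ENNReal.ofReal (x t)) t
      = ENNReal.ofReal (y t) := by
  filter_upwards [h] with t ht
  have hnn : 0 ≤ ∫ σ, b (t - σ) * x σ := integral_nonneg fun σ => mul_nonneg (hb _) (hx _)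
  have e : lconv (fun t => ENNReal.ofReal (b t)) (fun t => ENNReal.ofReal (x t)) t
      = ENNReal.ofReal (∫ σ, b (t - σ) * x σ) := by
    rw [ofReal_integral_eq_lintegral_ofReal ht.1
      (ae_of_all _ fun σ => mul_nonneg (hb _) (hx _))]
    refine lintegral_congr fun σ => ?_
    rw [ENNReal.ofReal_mul (hb _)]
  rw [e, ← ENNReal.ofReal_mul hk, ← ENNReal.ofReal_add (hx t) (mul_nonneg hk hnn), ht.2]

/-- Taken in `[0,∞]`, the transformed Volterra equation holds before any transform is known to be
finite. -/
theorem IsVolterraSolution.lweight_eq {k : ℝ} (hk : 0 ≤ k) {b m x n y : ℝ → ℝ}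
    (hb : IsNonnegRep b m) (hx : IsNonnegRep x n) (h : IsVolterraSolution k b x y) (lam : ℝ) :
    lweight lam (Ioi 0) (fun t => ENNReal.ofReal (x t)) + ENNReal.ofReal k *
      (lweight lam (Ioi 0) (fun t => ENNReal.ofReal (b t))
        * lweight lam (Ioi 0) (fun t => ENNReal.ofReal (x t)))
      = lweight lam (Ioi 0) (fun t => ENNReal.ofReal (y t)) := by
  have hb' := hb.measurable
  have hx' := hx.measurable
  rw [← lweight_lconv lam (by fun_prop) (by fun_prop) (fun t ht => by simp [hb.zero t ht])
    (fun t ht => by simp [hx.zero t ht]), ← lweight_const_mul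
      (measurable_lconv (by fun_prop) (by fun_prop)), ← lweight_add (by fun_prop)]
  refine lintegral_congr_ae ?_
  filter_upwards [h.ofReal_eq hk hb.nonneg hx.nonneg] with t ht
  rw [ht]

theorem IsNonnegRep.laplace_eq {b m : ℝ → ℝ} (hb : IsNonnegRep b m) (lam : ℝ) :
    laplace m lam = (lweight lam (Ioi 0) (fun t => ENNReal.ofReal (b t))).toReal := by
  have hb' := hb.measurable
  have : laplace m lam = laplace b lam := by
    refine integral_congr_ae ?_
    filter_upwards [hb.ae_eq] with t ht
    rw [ht]
  rw [this, laplace, integral_eq_lintegral_of_nonneg_ae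
    (ae_of_all _ fun t => mul_nonneg (Real.exp_pos _).le (hb.nonneg t)) (by fun_prop), lweight]
  congr 1
  refine lintegral_congr fun t => ?_
  rw [ENNReal.ofReal_mul (Real.exp_pos _).le]

variable {m b : ℝ → ℝ}

theorem CompletelyPositive.exists_rep (hm : CompletelyPositive m) : ∃ b, IsNonnegRep b m :=
  exists_isNonnegRep hm.locInt hm.ae_nonneg

theorem CompletelyPositive.exists_resolvent (hm : CompletelyPositive m) (hb : IsNonnegRep b m)
    {k : ℝ} (hk : 0 < k) : ∃ r, IsNonnegRep r r ∧ LocInt r ∧ IsVolterraSolution k b r b := by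
  obtain ⟨r, h1, h2, h3⟩ := hm.exists_r k hk
  obtain ⟨r', hr'⟩ := exists_isNonnegRep h1 h3
  have hloc : LocInt r' := fun R => (h1 R).congr
    (EventuallyEq.symm (ae_mono (Measure.restrict_mono Ioc_subset_Ioi_self le_rfl) hr'.ae_eq))
  refine ⟨r', ⟨hr'.measurable, hr'.nonneg, hr'.zero, ae_eq_rfl⟩, hloc,
    isVolterraSolution_of_conv hb hr' hm.locInt h1 ?_⟩
  filter_upwards [h2, hb.ae_eq] with t h4 h5
  rw [h4, h5]

theorem lweight_one {lam : ℝ} (hlam : 0 < lam) :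
    lweight lam (Ioi 0) (fun _ => ENNReal.ofReal 1) = ENNReal.ofReal (1 / lam) := by
  simp only [lweight, ENNReal.ofReal_one, mul_one]
  rw [← ofReal_integral_eq_lintegral_ofReal (integrableOn_exp_mul_Ioi (by linarith) 0)
    (ae_of_all _ fun t => (Real.exp_pos _).le), integral_exp_mul_Ioi (by linarith)]
  simp

/-- Local integrability alone gives no Laplace transform; the relaxation equation does. If `b̂ = ∞`,
then `ŝ + b̂ ŝ = 1/λ` fails both for `ŝ = 0` (left side zero) and for `ŝ > 0` (left side infinite).
-/
theorem CompletelyPositive.lweight_ne_top (hm : CompletelyPositive m) (hb : IsNonnegRep b m)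
    {lam : ℝ} (hlam : 0 < lam) : lweight lam (Ioi 0) (fun t => ENNReal.ofReal (b t)) ≠ ∞ := by
  obtain ⟨s, h1, h2, h3⟩ := hm.exists_s 1 one_pos
  obtain ⟨s', hs'⟩ := exists_isNonnegRep h1 h3
  have h := (isVolterraSolution_of_conv hb hs' hm.locInt h1 h2).lweight_eq zero_le_one hb hs' lam
  rw [lweight_one hlam, ENNReal.ofReal_one, one_mul] at h
  intro htop
  rw [htop] at h
  by_cases h0 : lweight lam (Ioi 0) (fun t => ENNReal.ofReal (s' t)) = 0
  · rw [h0, mul_zero, add_zero, eq_comm, ENNReal.ofReal_eq_zero] at h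
    have : 0 < 1 / lam := by positivity
    linarith
  · rw [ENNReal.top_mul h0, add_top] at h
    exact ENNReal.ofReal_ne_top h.symm

theorem CompletelyPositive.lweight_ne_zero (hm : CompletelyPositive m) (hb : IsNonnegRep b m)
    (lam : ℝ) : lweight lam (Ioi 0) (fun t => ENNReal.ofReal (b t)) ≠ 0 := by
  have hb' := hb.measurable
  intro h
  rw [lweight, lintegral_eq_zero_iff (by fun_prop)] at h
  refine hm.ne_zero ?_
  filter_upwards [h, hb.ae_eq] with t ht h2
  have h3 : b t ≤ 0 := by simpa [(Real.exp_pos _).not_ge] using ht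
  rw [← h2]
  exact le_antisymm h3 (hb.nonneg t)

theorem CompletelyPositive.laplace_pos (hm : CompletelyPositive m) {lam : ℝ} (hlam : 0 < lam) :
    0 < laplace m lam := by
  obtain ⟨b, hb⟩ := hm.exists_rep
  rw [hb.laplace_eq]
  exact ENNReal.toReal_pos (hm.lweight_ne_zero hb lam) (hm.lweight_ne_top hb hlam)

theorem CompletelyPositive.lweight_resolvent (hm : CompletelyPositive m) (hb : IsNonnegRep b m)
    {k : ℝ} (hk : 0 < k) {r : ℝ → ℝ} (hr : IsNonnegRep r r) (hsol : IsVolterraSolution k b r b)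
    {lam : ℝ} (hlam : 0 < lam) :
    lweight lam (Ioi 0) (fun t => ENNReal.ofReal (r t))
      = ENNReal.ofReal (laplace m lam / (1 + k * laplace m lam)) := by
  have h := hsol.lweight_eq hk.le hb hr lam
  have hbtop := hm.lweight_ne_top hb hlam
  have hpos := hm.laplace_pos hlam
  have hrtop : lweight lam (Ioi 0) (fun t => ENNReal.ofReal (r t)) ≠ ∞ := by
    refine ne_top_of_le_ne_top hbtop ?_
    rw [← h]
    exact le_self_add
  rw [← ENNReal.ofReal_toReal hrtop]
  congr 1
  have h2 := congrArg ENNReal.toReal h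
  rw [ENNReal.toReal_add hrtop (ENNReal.mul_ne_top ENNReal.ofReal_ne_top
    (ENNReal.mul_ne_top hbtop hrtop)), ENNReal.toReal_mul, ENNReal.toReal_mul,
    ENNReal.toReal_ofReal hk.le, ← hb.laplace_eq] at h2
  rw [eq_div_iff (by positivity)]
  linarith

/-- The transform `m̂ / (1 + k m̂)` is below `1/k` for every `λ > 0`; Fatou's lemma lets `λ → 0`.
The bound does not involve the kernel, which is what makes it usable for perturbed kernels. -/
theorem CompletelyPositive.lintegral_resolvent_le (hm : CompletelyPositive m)
    (hb : IsNonnegRep b m) {k : ℝ} (hk : 0 < k) {r : ℝ → ℝ} (hr : IsNonnegRep r r)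
    (hsol : IsVolterraSolution k b r b) :
    ∫⁻ t in Ioi 0, ENNReal.ofReal (r t) ≤ ENNReal.ofReal (1 / k) := by
  have hr' := hr.measurable
  have hlim : ∀ t : ℝ, Tendsto (fun n : ℕ => ENNReal.ofReal (Real.exp (-(1 / (n + 1 : ℝ)) * t))
      * ENNReal.ofReal (r t)) atTop (𝓝 (ENNReal.ofReal (r t))) := fun t => by
    have h1 : Tendsto (fun n : ℕ => Real.exp (-(1 / (n + 1 : ℝ)) * t)) atTop (𝓝 1) := by
      have := ((tendsto_one_div_add_atTop_nhds_zero_nat (𝕜 := ℝ)).neg.mul_const t).rexp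
      simpa using this
    have h2 := ENNReal.Tendsto.mul_const (b := ENNReal.ofReal (r t))
      (ENNReal.tendsto_ofReal h1) (Or.inr ENNReal.ofReal_ne_top)
    simpa using h2
  have h3 : ∫⁻ t in Ioi 0, ENNReal.ofReal (r t)
      ≤ liminf (fun n : ℕ => lweight (1 / (n + 1 : ℝ)) (Ioi 0) (fun t => ENNReal.ofReal (r t)))
        atTop := by
    refine le_trans (le_of_eq ?_) (lintegral_liminf_le fun n => by fun_prop)
    exact lintegral_congr fun t => (hlim t).liminf_eq.symm
  refine h3.trans ?_
  refine liminf_le_of_frequently_le' (Frequently.of_forall fun n => ?_)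
  have hn : (0 : ℝ) < 1 / (n + 1 : ℝ) := by positivity
  rw [hm.lweight_resolvent hb hk hr hsol hn]
  have hpos := hm.laplace_pos hn
  refine ENNReal.ofReal_le_ofReal ?_
  rw [div_le_div_iff₀ (by positivity) hk]
  linarith

theorem CompletelyPositive.integrable_resolvent (hm : CompletelyPositive m)
    (hb : IsNonnegRep b m) {k : ℝ} (hk : 0 < k) {r : ℝ → ℝ} (hr : IsNonnegRep r r)
    (hsol : IsVolterraSolution k b r b) : Integrable r := by
  refine ⟨hr.measurable.aestronglyMeasurable, ?_⟩
  have h := (hm.lintegral_resolvent_le hb hk hr hsol).trans_lt ENNReal.ofReal_lt_top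
  rw [← lintegral_indicator measurableSet_Ioi] at h
  refine lt_of_eq_of_lt (lintegral_congr fun t => ?_) h
  rw [Real.enorm_of_nonneg (hr.nonneg t)]
  by_cases ht : t ∈ Ioi (0 : ℝ)
  · rw [indicator_of_mem ht]
  · rw [indicator_of_notMem ht, hr.zero t (not_lt.1 ht), ENNReal.ofReal_zero]

theorem CompletelyPositive.resolvent_mass_le (hm : CompletelyPositive m)
    (hb : IsNonnegRep b m) {k : ℝ} (hk : 0 < k) {r : ℝ → ℝ} (hr : IsNonnegRep r r)
    (hsol : IsVolterraSolution k b r b) (t : ℝ) : k * ∫ σ in Ioc 0 t, r σ ≤ 1 := by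
  have hi := hm.integrable_resolvent hb hk hr hsol
  have h1 : ∫ σ in Ioc 0 t, r σ ≤ ∫ σ in Ioi 0, r σ :=
    setIntegral_mono_set hi.integrableOn (ae_of_all _ hr.nonneg)
      (Ioc_subset_Ioi_self.eventuallyLE)
  have h2 : ∫ σ in Ioi 0, r σ ≤ 1 / k := by
    rw [integral_eq_lintegral_of_nonneg_ae (ae_of_all _ hr.nonneg)
      hr.measurable.aestronglyMeasurable]
    exact ENNReal.toReal_le_of_le_ofReal (by positivity)
      (hm.lintegral_resolvent_le hb hk hr hsol)
  calc k * ∫ σ in Ioc 0 t, r σ ≤ k * (1 / k) := by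
        gcongr
        exact h1.trans h2
    _ = 1 := by field_simp

theorem resolvent_ae_le (hb : ∀ t, 0 ≤ b t) {k : ℝ} (hk : 0 ≤ k) {r : ℝ → ℝ}
    (hr : ∀ t, 0 ≤ r t) (hsol : IsVolterraSolution k b r b) :
    ∀ᵐ t ∂volume.restrict (Ioi (0 : ℝ)), r t ≤ b t := by
  filter_upwards [hsol] with t ht
  have : 0 ≤ k * ∫ σ, b (t - σ) * r σ :=
    mul_nonneg hk (integral_nonneg fun σ => mul_nonneg (hb _) (hr _))
  linarith [ht.2]

end CompletelyPositive

/-! ### Continuous dependence of the resolvent kernel -/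

section Stability

/-- The splitting `b' * r' - b * r = (b' - b) * r' + b * (r' - r)` convolves the unknown difference
with the fixed kernel `b`, and the perturbation with `r'`, whose mass has a uniform bound. -/
theorem enorm_resolvent_sub_le {k : ℝ} (hk : 0 ≤ k) {b b' r r' : ℝ → ℝ} (hbm : Measurable b)
    (hbm' : Measurable b') (hrm' : Measurable r')
    (hsol : IsVolterraSolution k b r b) (hsol' : IsVolterraSolution k b' r' b') :
    ∀ᵐ t ∂volume.restrict (Ioi (0 : ℝ)), ‖r' t - r t‖ₑ ≤
      (‖b' t - b t‖ₑ + ENNReal.ofReal k * lconv (fun t => ‖b' t - b t‖ₑ) (fun t => ‖r' t‖ₑ) t)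
      + ENNReal.ofReal k * lconv (fun t => ‖b t‖ₑ) (fun t => ‖r' t - r t‖ₑ) t := by
  filter_upwards [hsol, hsol'] with t h h'
  have e : r' t - r t = (b' t - b t) + (-k) * ∫ σ, (b' (t - σ) * r' σ - b (t - σ) * r σ) := by
    rw [integral_sub h'.1 h.1]
    linarith [h.2, h'.2]
  have hb : ‖∫ σ, (b' (t - σ) * r' σ - b (t - σ) * r σ)‖ₑ
      ≤ lconv (fun t => ‖b' t - b t‖ₑ) (fun t => ‖r' t‖ₑ) t
        + lconv (fun t => ‖b t‖ₑ) (fun t => ‖r' t - r t‖ₑ) t := by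
    refine (enorm_integral_le_lintegral_enorm _).trans ?_
    rw [lconv, lconv, ← lintegral_add_left (by fun_prop)]
    refine lintegral_mono fun σ => ?_
    rw [← enorm_mul, ← enorm_mul]
    refine le_trans (le_of_eq ?_) (enorm_add_le _ _)
    congr 1
    ring
  calc ‖r' t - r t‖ₑ ≤ ‖b' t - b t‖ₑ
        + ‖(-k) * ∫ σ, (b' (t - σ) * r' σ - b (t - σ) * r σ)‖ₑ := by
        rw [e]
        exact enorm_add_le _ _
    _ ≤ ‖b' t - b t‖ₑ + ENNReal.ofReal k *
        (lconv (fun t => ‖b' t - b t‖ₑ) (fun t => ‖r' t‖ₑ) t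
        + lconv (fun t => ‖b t‖ₑ) (fun t => ‖r' t - r t‖ₑ) t) := by
        rw [enorm_mul, enorm_neg, Real.enorm_of_nonneg hk]
        gcongr
    _ = _ := by rw [mul_add, add_assoc]

/-- The resolvent kernel depends Lipschitz continuously, in `L¹(0,T)`, on the kernel. -/
theorem CompletelyPositive.exists_resolvent_stability {m b : ℝ → ℝ} (hm : CompletelyPositive m)
    (hb : IsNonnegRep b m) {k : ℝ} (hk : 0 < k) {r : ℝ → ℝ} (hr : IsNonnegRep r r)
    (hsol : IsVolterraSolution k b r b) (T : ℝ) :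
    ∃ C : ℝ, 0 ≤ C ∧ ∀ m' b' r' : ℝ → ℝ, CompletelyPositive m' → IsNonnegRep b' m' →
      IsNonnegRep r' r' → IsVolterraSolution k b' r' b' → ∀ t ≤ T,
      |(∫ σ in Ioc 0 t, r' σ) - ∫ σ in Ioc 0 t, r σ| ≤ C * ∫ σ in Ioo 0 T, |m' σ - m σ| := by
  have hbm := hb.measurable
  have hrm := hr.measurable
  have hri := hm.integrable_resolvent hb hk hr hsol
  have hk0 : ENNReal.ofReal k ≠ 0 := by simpa using hk
  have hbfin : ∫⁻ t in Ioo 0 T, ‖b t‖ₑ ≠ ∞ := by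
    simpa only [Real.enorm_of_nonneg (hb.nonneg _)] using hb.lintegral_Ioo_ne_top hm.locInt T
  -- The weight depends on `b` and `k` only, so the final constant is independent of the perturbed
  -- kernel.
  obtain ⟨lam, hlam, hsmall⟩ := exists_lweight_le (by fun_prop) hbfin
    (show (0 : ℝ≥0∞) < 2⁻¹ * (ENNReal.ofReal k)⁻¹ by simp)
  -- A factor 2 comes from Gronwall, a factor 2 from the two forcing terms, and `e^{λT}` from
  -- removing the weight.
  refine ⟨4 * Real.exp (lam * T), by positivity, fun m' b' r' hm' hb' hr' hsol' t htT => ?_⟩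
  have hbm' := hb'.measurable
  have hrm' := hr'.measurable
  have hri' := hm'.integrable_resolvent hb' hk hr' hsol'
  have hmono : volume.restrict (Ioo 0 T) ≤ volume.restrict (Ioi (0 : ℝ)) :=
    Measure.restrict_mono Ioo_subset_Ioi_self le_rfl
  have hδ0 : ∀ t ≤ 0, ‖b' t - b t‖ₑ = 0 := fun t ht => by simp [hb.zero t ht, hb'.zero t ht]
  have hβ0 : ∀ t ≤ 0, ‖r' t - r t‖ₑ = 0 := fun t ht => by simp [hr.zero t ht, hr'.zero t ht]
  have hsmall' : ENNReal.ofReal k * lweight lam (Ioo 0 T) (fun t => ‖b t‖ₑ) ≤ 2⁻¹ := by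
    calc _ ≤ ENNReal.ofReal k * (2⁻¹ * (ENNReal.ofReal k)⁻¹) := by gcongr
      _ = 2⁻¹ * (ENNReal.ofReal k * (ENNReal.ofReal k)⁻¹) := by ring
      _ = 2⁻¹ := by rw [ENNReal.mul_inv_cancel hk0 ENNReal.ofReal_ne_top, mul_one]
  have hβfin : lweight lam (Ioo 0 T) (fun t => ‖r' t - r t‖ₑ) ≠ ∞ :=
    ((lweight_le_lintegral hlam _).trans_lt
      ((hri'.sub hri).integrableOn (s := Ioo 0 T)).2).ne
  have h1 := lweight_le_two_mul (lam := lam) (T := T) (β := fun t => ‖r' t - r t‖ₑ)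
    (ρ := fun t => ‖b t‖ₑ) (g := fun t => ‖b' t - b t‖ₑ + ENNReal.ofReal k *
      lconv (fun t => ‖b' t - b t‖ₑ) (fun t => ‖r' t‖ₑ) t) (by fun_prop) (by fun_prop)
    (by
      have := measurable_lconv (A := fun t => ‖b' t - b t‖ₑ) (C := fun t => ‖r' t‖ₑ)
        (by fun_prop) (by fun_prop)
      fun_prop) hβ0 (fun t ht => by simp [hb.zero t ht]) (ENNReal.ofReal k) hβfin hsmall'
    (ae_mono hmono (enorm_resolvent_sub_le hk.le hbm hbm' hrm' hsol hsol'))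
  have hρ' : ENNReal.ofReal k * lweight lam (Ioo 0 T) (fun t => ‖r' t‖ₑ) ≤ 1 := by
    have h2 : lweight lam (Ioo 0 T) (fun t => ‖r' t‖ₑ) ≤ ENNReal.ofReal (1 / k) := by
      refine (lweight_le_lintegral hlam _).trans (le_trans ?_
        (hm'.lintegral_resolvent_le hb' hk hr' hsol'))
      simp only [Real.enorm_of_nonneg (hr'.nonneg _)]
      exact lintegral_mono_set Ioo_subset_Ioi_self
    calc _ ≤ ENNReal.ofReal k * ENNReal.ofReal (1 / k) := by gcongr
      _ = 1 := by rw [← ENNReal.ofReal_mul hk.le, mul_one_div_cancel hk.ne', ENNReal.ofReal_one]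
  have h2 : lweight lam (Ioo 0 T) (fun t => ‖b' t - b t‖ₑ + ENNReal.ofReal k *
      lconv (fun t => ‖b' t - b t‖ₑ) (fun t => ‖r' t‖ₑ) t)
      ≤ 2 * ∫⁻ t in Ioo 0 T, ‖b' t - b t‖ₑ := by
    rw [lweight_add (by fun_prop), lweight_const_mul (measurable_lconv (by fun_prop) (by fun_prop)),
      two_mul]
    refine add_le_add (lweight_le_lintegral hlam _) ?_
    calc _ ≤ ENNReal.ofReal k * (lweight lam (Ioo 0 T) (fun t => ‖b' t - b t‖ₑ)
          * lweight lam (Ioo 0 T) (fun t => ‖r' t‖ₑ)) := by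
          gcongr
          exact lweight_lconv_le lam T (by fun_prop) (by fun_prop) hδ0
            (fun t ht => by simp [hr'.zero t ht])
      _ = (ENNReal.ofReal k * lweight lam (Ioo 0 T) (fun t => ‖r' t‖ₑ))
          * lweight lam (Ioo 0 T) (fun t => ‖b' t - b t‖ₑ) := by ring
      _ ≤ 1 * lweight lam (Ioo 0 T) (fun t => ‖b' t - b t‖ₑ) := by gcongr
      _ ≤ ∫⁻ t in Ioo 0 T, ‖b' t - b t‖ₑ := by
          rw [one_mul]
          exact lweight_le_lintegral hlam _
  have h3 : ∫⁻ t in Ioo 0 T, ‖r' t - r t‖ₑ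
      ≤ ENNReal.ofReal (4 * Real.exp (lam * T)) * ∫⁻ t in Ioo 0 T, ‖m' t - m t‖ₑ := by
    have e : ∫⁻ t in Ioo 0 T, ‖m' t - m t‖ₑ = ∫⁻ t in Ioo 0 T, ‖b' t - b t‖ₑ := by
      refine lintegral_congr_ae ?_
      filter_upwards [ae_mono hmono hb.ae_eq, ae_mono hmono hb'.ae_eq] with t ht ht'
      rw [ht, ht']
    rw [e, ENNReal.ofReal_mul (by norm_num), show ENNReal.ofReal 4 = 2 * 2 by norm_num]
    calc _ ≤ ENNReal.ofReal (Real.exp (lam * T))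
          * lweight lam (Ioo 0 T) (fun t => ‖r' t - r t‖ₑ) :=
          lintegral_le_lweight hlam (by fun_prop)
      _ ≤ ENNReal.ofReal (Real.exp (lam * T)) * (2 * (2 * ∫⁻ t in Ioo 0 T, ‖b' t - b t‖ₑ)) := by
          gcongr
          exact h1.trans (by gcongr)
      _ = _ := by ring
  have hmi : IntegrableOn (fun t => m' t - m t) (Ioo 0 T) :=
    ((hm'.locInt T).mono_set Ioo_subset_Ioc_self).sub
      ((hm.locInt T).mono_set Ioo_subset_Ioc_self)
  calc |(∫ σ in Ioc 0 t, r' σ) - ∫ σ in Ioc 0 t, r σ|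
      = ‖∫ σ in Ioc 0 t, (r' σ - r σ)‖ := by
        rw [integral_sub hri'.integrableOn hri.integrableOn, Real.norm_eq_abs]
    _ ≤ ∫ σ in Ioc 0 t, ‖r' σ - r σ‖ := norm_integral_le_integral_norm _
    _ ≤ ∫ σ in Ioc 0 T, ‖r' σ - r σ‖ :=
        setIntegral_mono_set (hri'.sub hri).norm.integrableOn (ae_of_all _ fun _ => norm_nonneg _)
          (Ioc_subset_Ioc_right htT).eventuallyLE
    _ = (∫⁻ t in Ioo 0 T, ‖r' t - r t‖ₑ).toReal := by
        rw [integral_Ioc_eq_integral_Ioo, integral_norm_eq_lintegral_enorm (by fun_prop)]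
    _ ≤ (ENNReal.ofReal (4 * Real.exp (lam * T)) * ∫⁻ t in Ioo 0 T, ‖m' t - m t‖ₑ).toReal :=
        ENNReal.toReal_mono (ENNReal.mul_ne_top ENNReal.ofReal_ne_top hmi.2.ne) h3
    _ = 4 * Real.exp (lam * T) * ∫ σ in Ioo 0 T, |m' σ - m σ| := by
        rw [ENNReal.toReal_mul, ENNReal.toReal_ofReal (by positivity),
          ← integral_norm_eq_lintegral_enorm hmi.1]
        rfl

end Stability

/-! ### The subordinator of a completely positive kernel

The law at time `τ` of the subordinator with Laplace exponent `1 / b̂` is carried to the unit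
interval by `t ↦ e^{-t}`, where its Laplace transform becomes the function of real moments. -/

section Subordinator

open scoped unitInterval

/-- The real moment of order `lam`. -/
def lmoment (lam : ℝ) (P : Measure I) : ℝ≥0∞ := ∫⁻ x, ENNReal.ofReal ((x : ℝ) ^ lam) ∂P

theorem continuous_coe_rpow {lam : ℝ} (hlam : 0 < lam) : Continuous fun x : I => (x : ℝ) ^ lam :=
  continuous_subtype_val.rpow_const fun _ => Or.inr hlam.le

theorem lmoment_mconv {lam : ℝ} (hlam : 0 < lam) (P Q : Measure I) [SFinite Q] :
    lmoment lam (P.mconv Q) = lmoment lam P * lmoment lam Q := by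
  have hm : Measurable fun x : I => ENNReal.ofReal ((x : ℝ) ^ lam) :=
    (continuous_coe_rpow hlam).measurable.ennreal_ofReal
  rw [lmoment, Measure.lintegral_mconv hm]
  have e : ∀ x y : I, ENNReal.ofReal (((x * y : I) : ℝ) ^ lam)
      = ENNReal.ofReal ((x : ℝ) ^ lam) * ENNReal.ofReal ((y : ℝ) ^ lam) := fun x y => by
    rw [Set.Icc.coe_mul, Real.mul_rpow x.2.1 y.2.1,
      ENNReal.ofReal_mul (Real.rpow_nonneg x.2.1 _)]
  simp_rw [e, lintegral_const_mul _ hm]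
  rw [lintegral_mul_const _ hm]
  rfl

theorem integral_rpow_eq_toReal_lmoment {lam : ℝ} (hlam : 0 < lam) (P : Measure I) :
    ∫ x : I, (x : ℝ) ^ lam ∂P = (lmoment lam P).toReal := by
  rw [integral_eq_lintegral_of_nonneg_ae (ae_of_all _ fun x => Real.rpow_nonneg x.2.1 _)
    (continuous_coe_rpow hlam).aestronglyMeasurable]
  rfl

/-- Convolution powers for the multiplication of the unit interval. -/
def mconvPow (P : Measure I) : ℕ → Measure I
  | 0 => Measure.dirac 1
  | n + 1 => (mconvPow P n).mconv P

theorem isProbabilityMeasure_mconvPow (P : Measure I) [IsProbabilityMeasure P] (n : ℕ) :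
    IsProbabilityMeasure (mconvPow P n) := by
  induction n with
  | zero => exact Measure.dirac.isProbabilityMeasure
  | succ n ih =>
    have := ih
    exact Measure.probabilitymeasure_of_probabilitymeasures_mconv _ _

theorem lmoment_mconvPow {lam : ℝ} (hlam : 0 < lam) (P : Measure I) [IsProbabilityMeasure P]
    (n : ℕ) : lmoment lam (mconvPow P n) = lmoment lam P ^ n := by
  induction n with
  | zero => simp [lmoment, mconvPow]
  | succ n ih => rw [mconvPow, lmoment_mconv hlam, ih, pow_succ]

/-- Probability measures on the unit interval with converging real moments have a limit. -/
theorem exists_measure_of_tendsto_moments {P : ℕ → Measure I}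
    (hP : ∀ n, IsProbabilityMeasure (P n)) {ℓ : ℝ → ℝ}
    (h : ∀ lam : ℝ, 0 < lam → Tendsto (fun n => ∫ x : I, (x : ℝ) ^ lam ∂(P n)) atTop (𝓝 (ℓ lam))) :
    ∃ Q : Measure I, IsProbabilityMeasure Q ∧
      ∀ lam : ℝ, 0 < lam → ∫ x : I, (x : ℝ) ^ lam ∂Q = ℓ lam := by
  let p : ℕ → ProbabilityMeasure I := fun n => ⟨P n, hP n⟩
  let u : Ultrafilter ℕ := hyperfilter ℕ
  -- Probability measures on `[0,1]` form a compact space. Mass escaping to `t = ∞` settles at `x =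
  -- 0`, where `x ^ lam` is continuous and vanishes because `lam > 0`.
  obtain ⟨Q, -, hQ⟩ := isCompact_univ.ultrafilter_le_nhds (u.map p) (by simp)
  have hT : Tendsto p u (𝓝 Q) := hQ
  refine ⟨Q, Q.2, fun lam hlam => ?_⟩
  have h1 := ProbabilityMeasure.tendsto_iff_forall_integral_tendsto.1 hT
    (BoundedContinuousFunction.mkOfCompact ⟨_, continuous_coe_rpow hlam⟩)
  have h2 : Tendsto (fun n => ∫ x : I, (x : ℝ) ^ lam ∂(P n)) u (𝓝 (ℓ lam)) :=
    (h lam hlam).mono_left (Nat.hyperfilter_le_atTop)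
  exact tendsto_nhds_unique h1 h2

/-- The map `t ↦ e^{-t}` from the half-line to the unit interval. -/
def expNeg (t : ℝ) : I :=
  ⟨Real.exp (-max t 0), (Real.exp_pos _).le, Real.exp_le_one_iff.2 (by simp)⟩

theorem measurable_expNeg : Measurable expNeg :=
  Measurable.subtype_mk (by fun_prop)

/-- A nonnegative density of mass at most one on the half-line gives a probability measure on the
unit interval, the missing mass being put at `0 = e^{-∞}`. -/
theorem exists_measure_of_density {q : ℝ → ℝ} (hq : Measurable q)
    (hmass : ∫⁻ t in Ioi 0, ENNReal.ofReal (q t) ≤ 1) :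
    ∃ P : Measure I, IsProbabilityMeasure P ∧ ∀ lam : ℝ, 0 < lam →
      lmoment lam P = lweight lam (Ioi 0) (fun t => ENNReal.ofReal (q t)) := by
  set κ : Measure ℝ := (volume.restrict (Ioi 0)).withDensity (fun t => ENNReal.ofReal (q t)) with hκ
  have hκu : κ univ = ∫⁻ t in Ioi 0, ENNReal.ofReal (q t) := by
    rw [hκ, withDensity_apply _ MeasurableSet.univ, Measure.restrict_univ]
  refine ⟨κ.map expNeg + (1 - κ univ) • Measure.dirac 0, ⟨?_⟩, fun lam hlam => ?_⟩
  · rw [Measure.add_apply, Measure.map_apply measurable_expNeg MeasurableSet.univ, preimage_univ,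
      Measure.smul_apply, measure_univ (μ := Measure.dirac (0 : I)), smul_eq_mul, mul_one]
    exact add_tsub_cancel_of_le (hκu ▸ hmass)
  · have hm : Measurable fun x : I => ENNReal.ofReal ((x : ℝ) ^ lam) :=
      (continuous_coe_rpow hlam).measurable.ennreal_ofReal
    rw [lmoment, lintegral_add_measure, lintegral_smul_measure, lintegral_dirac' _ hm,
      lintegral_map hm measurable_expNeg, hκ,
      lintegral_withDensity_eq_lintegral_mul _ (by fun_prop)
        (show Measurable fun t => ENNReal.ofReal ((expNeg t : ℝ) ^ lam) from
          hm.comp measurable_expNeg)]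
    have h0 : ENNReal.ofReal (((0 : I) : ℝ) ^ lam) = 0 := by
      simp [Real.zero_rpow hlam.ne']
    rw [h0, smul_zero, add_zero, lweight]
    refine setLIntegral_congr_fun measurableSet_Ioi fun t ht => ?_
    simp only [Pi.mul_apply, expNeg]
    rw [mul_comm, max_eq_left (le_of_lt ht), ← Real.exp_mul]
    congr 3
    ring

/-- The laws of the subordinator with Laplace exponent `1 / m̂`. -/
theorem CompletelyPositive.exists_subordinator {m : ℝ → ℝ} (hm : CompletelyPositive m) {τ : ℝ}
    (hτ : 0 ≤ τ) : ∃ Q : Measure I, IsProbabilityMeasure Q ∧ ∀ lam : ℝ, 0 < lam →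
      ∫ x : I, (x : ℝ) ^ lam ∂Q = Real.exp (-τ * (1 / laplace m lam)) := by
  rcases hτ.eq_or_lt with rfl | hτ
  · refine ⟨Measure.dirac 1, Measure.dirac.isProbabilityMeasure, fun lam hlam => ?_⟩
    rw [integral_dirac]
    simp
  obtain ⟨b, hb⟩ := hm.exists_rep
  -- The density `k r_k` with `k = (n + 1)/τ` has transform `(1 + τ/((n + 1) m̂))⁻¹`, whose power `n
  -- + 1` tends to `e^{-τ/m̂}`.
  have hstep : ∀ n : ℕ, ∃ P : Measure I, IsProbabilityMeasure P ∧ ∀ lam : ℝ, 0 < lam →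
      lmoment lam P = ENNReal.ofReal ((1 + τ * (1 / laplace m lam) / (n + 1 : ℕ))⁻¹) := by
    intro n
    have hk : 0 < ((n + 1 : ℕ) : ℝ) / τ := by positivity
    obtain ⟨r, hr, -, hsol⟩ := hm.exists_resolvent hb hk
    have hrm := hr.measurable
    set k := ((n + 1 : ℕ) : ℝ) / τ with hkdef
    have e : ∀ t, ENNReal.ofReal (k * r t) = ENNReal.ofReal k * ENNReal.ofReal (r t) := fun t =>
      ENNReal.ofReal_mul hk.le
    obtain ⟨P, hP, hPm⟩ := exists_measure_of_density (q := fun t => k * r t) (by fun_prop) (by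
      simp_rw [e]
      rw [lintegral_const_mul _ (by fun_prop)]
      calc _ ≤ ENNReal.ofReal k * ENNReal.ofReal (1 / k) := by
            gcongr
            exact hm.lintegral_resolvent_le hb hk hr hsol
        _ = 1 := by
            rw [← ENNReal.ofReal_mul hk.le, mul_one_div_cancel hk.ne', ENNReal.ofReal_one])
    refine ⟨P, hP, fun lam hlam => ?_⟩
    have hpos := hm.laplace_pos hlam
    rw [hPm lam hlam]
    simp_rw [e]
    rw [lweight_const_mul (by fun_prop), hm.lweight_resolvent hb hk hr hsol hlam,
      ← ENNReal.ofReal_mul hk.le]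
    congr 1
    rw [hkdef]
    field_simp
    ring
  choose P hP hPm using hstep
  refine exists_measure_of_tendsto_moments (P := fun n => mconvPow (P n) (n + 1))
    (fun n => isProbabilityMeasure_mconvPow _ _) fun lam hlam => ?_
  have hpos := hm.laplace_pos hlam
  have h1 := ((Real.tendsto_one_add_div_pow_exp (τ * (1 / laplace m lam))).inv₀
    (Real.exp_pos _).ne').comp (tendsto_add_atTop_nat 1)
  rw [← Real.exp_neg, ← neg_mul] at h1
  refine h1.congr fun n => ?_
  rw [integral_rpow_eq_toReal_lmoment hlam, lmoment_mconvPow hlam, hPm n lam hlam,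
    ← ENNReal.ofReal_pow (by positivity), ENNReal.toReal_ofReal (by positivity), inv_pow]
  simp

end Subordinator

/-! ### Existence of the propagation function and of the resolvent family -/

section Propagation

open scoped unitInterval

/-- `w(t, τ)`, the probability that the subordinator at time `τ` is below `t`. -/
def propFun (η : ℝ → Measure I) (t τ : ℝ) : ℝ := (η τ).real {x : I | Real.exp (-t) < x}

/-- The image on the unit interval of the convolution semigroup with Laplace exponent `Φ`. -/
structure IsSubordinator (Φ : ℝ → ℝ) (η : ℝ → Measure I) : Prop where
  prob : ∀ τ, IsProbabilityMeasure (η τ)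
  moment : ∀ τ, 0 ≤ τ → ∀ lam : ℝ, 0 < lam → ∫ x : I, (x : ℝ) ^ lam ∂(η τ) = Real.exp (-τ * Φ lam)

variable {Φ : ℝ → ℝ} {η : ℝ → Measure I}

theorem measurableSet_exp_lt (t : ℝ) : MeasurableSet {x : I | Real.exp (-t) < x} :=
  measurableSet_lt measurable_const measurable_subtype_coe

theorem propFun_nonneg (η : ℝ → Measure I) (t τ : ℝ) : 0 ≤ propFun η t τ := measureReal_nonneg

namespace IsSubordinator

theorem propFun_le_one (h : IsSubordinator Φ η) (t τ : ℝ) : propFun η t τ ≤ 1 :=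
  have := h.prob τ
  measureReal_le_one

theorem monotone_propFun (h : IsSubordinator Φ η) (τ : ℝ) : Monotone fun t => propFun η t τ := by
  intro s t hst
  have := h.prob τ
  refine measureReal_mono fun x hx => ?_
  exact lt_of_le_of_lt (Real.exp_le_exp.2 (by linarith)) hx

theorem propFun_zero (η : ℝ → Measure I) (τ : ℝ) : propFun η 0 τ = 0 := by
  have : {x : I | Real.exp (-0) < x} = ∅ := by
    ext x
    simpa using x.2.2
  rw [propFun, this, measureReal_empty]

theorem propFun_eq_integral (η : ℝ → Measure I) (t τ : ℝ) :
    propFun η t τ = ∫ x, {x : I | Real.exp (-t) < x}.indicator (fun _ => (1 : ℝ)) x ∂(η τ) := by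
  rw [integral_indicator_const _ (measurableSet_exp_lt t), smul_eq_mul, mul_one, propFun]

/-- The strict inequality in the event decides the side: if `e^{-t} < x`, this persists for `s` near
`t`; if not, it fails for all `s ≤ t`. -/
theorem leftContinuous_propFun (h : IsSubordinator Φ η) (t τ : ℝ) :
    ContinuousWithinAt (fun t => propFun η t τ) (Iic t) t := by
  have := h.prob τ
  simp only [ContinuousWithinAt, propFun_eq_integral]
  refine tendsto_integral_filter_of_dominated_convergence (fun _ => 1)
    (Eventually.of_forall fun s => (measurable_const.indicator
      (measurableSet_exp_lt s)).aestronglyMeasurable)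
    (Eventually.of_forall fun s => ae_of_all _ fun x => ?_) (integrable_const _)
    (ae_of_all _ fun x => ?_)
  · refine (norm_indicator_le_norm_self _ _).trans (by simp)
  · refine tendsto_const_nhds.congr' ?_
    by_cases hx : Real.exp (-t) < x
    · have hc : Tendsto (fun s : ℝ => Real.exp (-s)) (𝓝[Iic t] t) (𝓝 (Real.exp (-t))) :=
        (by fun_prop : Continuous fun s : ℝ => Real.exp (-s)).continuousWithinAt
      filter_upwards [hc.eventually (gt_mem_nhds hx)] with s hs
      rw [indicator_of_mem (show x ∈ {x : I | Real.exp (-t) < x} from hx),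
        indicator_of_mem (show x ∈ {x : I | Real.exp (-s) < x} from hs)]
    · filter_upwards [self_mem_nhdsWithin] with s hs
      have : ¬ Real.exp (-s) < x := fun h' => hx
        (lt_of_le_of_lt (Real.exp_le_exp.2 (by linarith [mem_Iic.1 hs])) h')
      rw [indicator_of_notMem (show x ∉ {x : I | Real.exp (-t) < x} from hx),
        indicator_of_notMem (show x ∉ {x : I | Real.exp (-s) < x} from this)]

/-- For `x = e^{-σ}` this is the integral of `e^{-λt}` over `t > σ`; the point `x = 0` stands for `σ
= ∞` and contributes nothing. -/
theorem integral_exp_indicator {lam : ℝ} (hlam : 0 < lam) (x : I) :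
    ∫ t in Ioi (0 : ℝ), Real.exp (-lam * t) *
      {x : I | Real.exp (-t) < x}.indicator (fun _ => (1 : ℝ)) x = (x : ℝ) ^ lam / lam := by
  rcases x.2.1.eq_or_lt with h0 | h0
  · rw [← h0, Real.zero_rpow hlam.ne', zero_div]
    refine (integral_congr_ae (ae_of_all _ fun t => ?_)).trans (integral_zero _ _)
    have : x ∉ {x : I | Real.exp (-t) < x} := by
      simp only [mem_ofPred_eq, ← h0, not_lt]
      exact (Real.exp_pos _).le
    simp [indicator_of_notMem this]
  · have hlog : 0 ≤ -Real.log x := by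
      have := Real.log_nonpos x.2.1 x.2.2
      linarith
    have e : ∀ t, Real.exp (-lam * t) * {x : I | Real.exp (-t) < x}.indicator (fun _ => (1 : ℝ)) x
        = (Ioi (-Real.log x)).indicator (fun t => Real.exp (-lam * t)) t := fun t => by
      have hiff : Real.exp (-t) < x ↔ t ∈ Ioi (-Real.log x) := by
        rw [← Real.lt_log_iff_exp_lt h0, mem_Ioi, neg_lt]
      by_cases ht : t ∈ Ioi (-Real.log x)
      · rw [indicator_of_mem ht, indicator_of_mem (show x ∈ {x : I | Real.exp (-t) < x} from
          hiff.2 ht), mul_one]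
      · rw [indicator_of_notMem ht, indicator_of_notMem (show x ∉ {x : I | Real.exp (-t) < x} from
          fun h => ht (hiff.1 h)), mul_zero]
    simp_rw [e]
    rw [setIntegral_indicator measurableSet_Ioi, Ioi_inter_Ioi, sup_eq_right.2 hlog,
      integral_exp_mul_Ioi (by linarith), Real.rpow_def_of_pos h0]
    rw [neg_div_neg_eq]
    congr 2
    ring

theorem laplace_propFun (h : IsSubordinator Φ η) {τ : ℝ} (hτ : 0 ≤ τ) {lam : ℝ} (hlam : 0 < lam) :
    laplace (fun t => propFun η t τ) lam = Real.exp (-τ * Φ lam) / lam := by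
  have := h.prob τ
  simp only [laplace, propFun_eq_integral, ← integral_const_mul]
  rw [integral_integral_swap]
  · simp_rw [integral_exp_indicator hlam]
    rw [integral_div, h.moment τ hτ lam hlam]
  · have hset : MeasurableSet {q : ℝ × I | Real.exp (-q.1) < q.2} :=
      measurableSet_lt (by fun_prop) (measurable_subtype_coe.comp measurable_snd)
    have hdom : Integrable (fun q : ℝ × I => Real.exp (-lam * q.1))
        ((volume.restrict (Ioi 0)).prod (η τ)) := by
      have := (integrableOn_exp_mul_Ioi (show -lam < 0 by linarith) 0).mul_prod
        (integrable_const (μ := η τ) (1 : ℝ))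
      simpa using this
    refine (hdom.indicator hset).congr (ae_of_all _ fun q => ?_)
    by_cases hq : Real.exp (-q.1) < q.2
    · simp [Function.uncurry, hq]
    · simp [Function.uncurry, hq]

/-- Convolution semigroup law: all moments of positive integer order are exponentials in `τ`, and
they multiply under multiplicative convolution. -/
theorem add_eq_mconv (h : IsSubordinator Φ η) {ρ τ : ℝ} (hρ : 0 ≤ ρ) (hτ : 0 ≤ τ) :
    η (τ + ρ) = (η τ).mconv (η ρ) := by
  have h1 := h.prob τ
  have h2 := h.prob ρ
  have h3 := h.prob (τ + ρ)
  refine ext_of_moments fun n => ?_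
  rcases Nat.eq_zero_or_pos n with rfl | hn
  · simp
  have hn' : (0 : ℝ) < n := by exact_mod_cast hn
  simp_rw [← Real.rpow_natCast]
  rw [h.moment _ (by positivity) _ hn', integral_rpow_eq_toReal_lmoment hn',
    lmoment_mconv hn', ENNReal.toReal_mul, ← integral_rpow_eq_toReal_lmoment hn',
    ← integral_rpow_eq_toReal_lmoment hn', h.moment _ hτ _ hn', h.moment _ hρ _ hn',
    ← Real.exp_add]
  ring_nf

theorem propFun_add (h : IsSubordinator Φ η) {ρ τ : ℝ} (hρ : 0 ≤ ρ) (hτ : 0 ≤ τ) (t : ℝ) :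
    propFun η t (τ + ρ) = ((η τ).prod (η ρ)).real {q | Real.exp (-t) < (q.1 * q.2 : I)} := by
  rw [propFun, h.add_eq_mconv hρ hτ, Measure.mconv, measureReal_def,
    Measure.map_apply measurable_mul (measurableSet_exp_lt t), measureReal_def]
  rfl

/-- The increment from `ρ` to `τ` contributes an independent factor at most one, so the product
exceeds `e^{-t}` less often. -/
theorem antitone_propFun (h : IsSubordinator Φ η) {ρ τ : ℝ} (hρ : 0 ≤ ρ) (hρτ : ρ ≤ τ) (t : ℝ) :
    propFun η t τ ≤ propFun η t ρ := by
  have h1 := h.prob ρ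
  have h2 := h.prob (τ - ρ)
  have e := h.propFun_add (ρ := τ - ρ) (τ := ρ) (by linarith) hρ t
  rw [add_sub_cancel] at e
  rw [e]
  calc _ ≤ ((η ρ).prod (η (τ - ρ))).real ({x : I | Real.exp (-t) < x} ×ˢ univ) := by
        refine measureReal_mono fun q hq => ⟨?_, mem_univ _⟩
        rw [mem_ofPred_eq, Set.Icc.coe_mul] at hq
        refine lt_of_lt_of_le hq ?_
        exact mul_le_of_le_one_right q.1.2.1 q.2.2.2
    _ = propFun η t ρ := by
        rw [measureReal_prod_prod, probReal_univ, mul_one, propFun]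

/-- Two independent increments below `t` and `s` have a sum below `t + s`. -/
theorem mul_propFun_le (h : IsSubordinator Φ η) {ρ τ : ℝ} (hρ : 0 ≤ ρ) (hτ : 0 ≤ τ) (t s : ℝ) :
    propFun η t τ * propFun η s ρ ≤ propFun η (t + s) (τ + ρ) := by
  have h1 := h.prob τ
  have h2 := h.prob ρ
  rw [h.propFun_add hρ hτ, propFun, propFun, ← measureReal_prod_prod]
  refine measureReal_mono fun q hq => ?_
  simp only [mem_ofPred_eq, Set.Icc.coe_mul]
  rw [neg_add, Real.exp_add]
  exact mul_lt_mul'' hq.1 hq.2 (Real.exp_pos _).le (Real.exp_pos _).le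

theorem integral_coe (h : IsSubordinator Φ η) {τ : ℝ} (hτ : 0 ≤ τ) :
    ∫ x : I, (x : ℝ) ∂(η τ) = Real.exp (-τ * Φ 1) := by
  rw [← h.moment τ hτ 1 one_pos]
  simp

theorem integrable_coe (h : IsSubordinator Φ η) (τ : ℝ) :
    Integrable (fun x : I => (x : ℝ)) (η τ) := by
  have := h.prob τ
  refine Integrable.of_bound (by fun_prop) 1 (ae_of_all _ fun x => ?_)
  rw [Real.norm_of_nonneg x.2.1]
  exact x.2.2

/-- Markov's inequality for the variable `x`; it gives decay as `τ → ∞`. -/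
theorem propFun_le_exp (h : IsSubordinator Φ η) {τ : ℝ} (hτ : 0 ≤ τ) (t : ℝ) :
    propFun η t τ ≤ Real.exp t * Real.exp (-τ * Φ 1) := by
  have := h.prob τ
  rw [← h.integral_coe hτ, ← integral_const_mul, propFun_eq_integral]
  refine integral_mono ((integrable_const _).indicator (measurableSet_exp_lt t))
    ((h.integrable_coe τ).const_mul _) fun x => ?_
  by_cases hx : x ∈ {x : I | Real.exp (-t) < x}
  · rw [indicator_of_mem hx]
    have h1 : Real.exp t * Real.exp (-t) ≤ Real.exp t * x :=
      mul_le_mul_of_nonneg_left (le_of_lt hx) (Real.exp_pos _).le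
    rwa [← Real.exp_add, add_neg_cancel, Real.exp_zero] at h1
  · rw [indicator_of_notMem hx]
    exact mul_nonneg (Real.exp_pos _).le x.2.1

/-- Markov's inequality for `1 - x`; it shows that a short increment is small with probability close
to one. -/
theorem one_sub_propFun_le (h : IsSubordinator Φ η) {τ : ℝ} (hτ : 0 ≤ τ) {t : ℝ} (ht : 0 < t) :
    1 - (1 - Real.exp (-τ * Φ 1)) / (1 - Real.exp (-t)) ≤ propFun η t τ := by
  have := h.prob τ
  have hpos : 0 < 1 - Real.exp (-t) := by
    have : Real.exp (-t) < 1 := Real.exp_lt_one_iff.2 (by linarith)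
    linarith
  rw [sub_le_comm, le_div_iff₀ hpos, ← h.integral_coe hτ, propFun_eq_integral]
  have i1 : Integrable ({x : I | Real.exp (-t) < x}.indicator fun _ => (1 : ℝ)) (η τ) :=
    (integrable_const _).indicator (measurableSet_exp_lt t)
  have e1 : (1 : ℝ) = ∫ _ : I, (1 : ℝ) ∂(η τ) := by simp
  nth_rewrite 1 [e1]
  nth_rewrite 4 [e1]
  rw [← integral_sub (integrable_const _) i1, ← integral_sub (integrable_const _)
    (h.integrable_coe τ), ← integral_mul_const]
  refine integral_mono (((integrable_const _).sub i1).mul_const _)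
    ((integrable_const _).sub (h.integrable_coe τ)) fun x => ?_
  by_cases hx : x ∈ {x : I | Real.exp (-t) < x}
  · simp only [indicator_of_mem hx]
    linarith [x.2.2]
  · simp only [indicator_of_notMem hx]
    have : (x : ℝ) ≤ Real.exp (-t) := not_lt.1 hx
    linarith

/-- By monotonicity in `τ` only a lower bound matters. Left-continuity in time gives `s < t` with
`w(s, τ)` still above the given level, and `w(t, ρ) ≥ w(s, τ) w(t - s, ρ - τ)`, whose last factor
tends to one as `ρ ↓ τ`. -/
theorem rightContinuous_propFun (h : IsSubordinator Φ η) {t : ℝ} (ht : 0 ≤ t) {τ : ℝ}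
    (hτ : 0 ≤ τ) : ContinuousWithinAt (fun τ => propFun η t τ) (Ici τ) τ := by
  rcases ht.eq_or_lt with rfl | ht
  · simp only [propFun_zero]
    exact continuousWithinAt_const
  refine tendsto_order.2 ⟨fun a ha => ?_, fun a ha => ?_⟩
  · obtain ⟨s, hs, hst⟩ : ∃ s, a < propFun η s τ ∧ s < t := by
      have h1 : Tendsto (fun t => propFun η t τ) (𝓝[<] t) (𝓝 (propFun η t τ)) :=
        (h.leftContinuous_propFun t τ).mono_left (nhdsWithin_mono _ Iio_subset_Iic_self)
      exact ((h1.eventually (lt_mem_nhds ha)).and self_mem_nhdsWithin).exists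
    have hlim : Tendsto (fun ρ => propFun η s τ * (1 - (1 - Real.exp (-(ρ - τ) * Φ 1))
        / (1 - Real.exp (-(t - s))))) (𝓝[Ici τ] τ) (𝓝 (propFun η s τ)) := by
      have hc : Continuous fun ρ => propFun η s τ * (1 - (1 - Real.exp (-(ρ - τ) * Φ 1))
        / (1 - Real.exp (-(t - s)))) := by fun_prop
      have := hc.continuousWithinAt (s := Ici τ) (x := τ)
      simpa [ContinuousWithinAt] using this
    filter_upwards [hlim.eventually (lt_mem_nhds hs), self_mem_nhdsWithin] with ρ h1 h2
    have h2' : 0 ≤ ρ - τ := sub_nonneg.2 h2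
    refine lt_of_lt_of_le h1 ?_
    have h3 := h.mul_propFun_le h2' hτ s (t - s)
    rw [add_sub_cancel, add_sub_cancel] at h3
    refine le_trans (mul_le_mul_of_nonneg_left ?_ (propFun_nonneg _ _ _)) h3
    exact h.one_sub_propFun_le h2' (by linarith)
  · filter_upwards [self_mem_nhdsWithin] with ρ hρ
    exact lt_of_le_of_lt (h.antitone_propFun hτ hρ t) ha

theorem exists_isNegDtau (h : IsSubordinator Φ η) (hΦ : 0 < Φ 1) {t : ℝ} (ht : 0 ≤ t) :
    ∃ ν : Measure ℝ, IsNegDtau (propFun η) t ν := by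
  let G : StieltjesFunction ℝ :=
    -- The jump at `τ = 0` is the atom of the measure there; for `t = 0` it carries the whole mass.
    { toFun := fun τ => if τ < 0 then 0 else 1 - propFun η t τ
      mono' := fun ρ τ hρτ => by
        change (if ρ < 0 then 0 else 1 - propFun η t ρ) ≤ (if τ < 0 then 0 else 1 - propFun η t τ)
        split_ifs with h1 h2 h2
        · exact le_rfl
        · linarith [h.propFun_le_one t τ]
        · linarith
        · linarith [h.antitone_propFun (not_lt.1 h1) hρτ t]
      right_continuous' := fun τ => by
        rcases lt_or_ge τ 0 with hτ | hτ
        · refine ContinuousAt.continuousWithinAt ?_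
          refine (continuousAt_const (y := (0 : ℝ))).congr ?_
          filter_upwards [Iio_mem_nhds hτ] with ρ hρ
          rw [if_pos (mem_Iio.1 hρ)]
        · have hc : ContinuousWithinAt (fun τ => 1 - propFun η t τ) (Ici τ) τ :=
            continuousWithinAt_const.sub (h.rightContinuous_propFun ht hτ)
          refine hc.congr (fun ρ hρ => ?_) ?_
          · rw [if_neg (not_lt.2 (hτ.trans hρ))]
          · rw [if_neg (not_lt.2 hτ)] }
  have hG : ∀ τ, G τ = if τ < 0 then 0 else 1 - propFun η t τ := fun τ => rfl
  have hbot : Tendsto G atBot (𝓝 0) := by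
    refine tendsto_const_nhds.congr' ?_
    filter_upwards [eventually_lt_atBot 0] with τ hτ
    rw [hG, if_pos hτ]
  have htop : Tendsto G atTop (𝓝 1) := by
    have h1 : Tendsto (fun τ => propFun η t τ) atTop (𝓝 0) := by
      refine tendsto_of_tendsto_of_tendsto_of_le_of_le' tendsto_const_nhds (h := fun τ =>
        Real.exp t * Real.exp (-τ * Φ 1)) ?_ (Eventually.of_forall fun τ => propFun_nonneg _ _ _) ?_
      · rw [← mul_zero (Real.exp t)]
        refine (Real.tendsto_exp_atBot.comp ?_).const_mul _
        simp_rw [neg_mul]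
        exact tendsto_neg_atTop_atBot.comp (tendsto_id.atTop_mul_const hΦ)
      · filter_upwards [eventually_ge_atTop 0] with τ hτ using h.propFun_le_exp hτ t
    have h2 := h1.const_sub 1
    rw [sub_zero] at h2
    refine h2.congr' ?_
    filter_upwards [eventually_ge_atTop 0] with τ hτ
    rw [hG, if_neg (not_lt.2 hτ)]
  refine ⟨G.measure, ?_, ?_, fun τ hτ => ?_⟩
  · rw [G.measure_univ hbot htop]
    simp
  · rw [G.measure_Iio hbot, ENNReal.ofReal_eq_zero, sub_zero]
    have : Function.leftLim G 0 = 0 := by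
      refine leftLim_eq_of_tendsto (tendsto_const_nhds.congr' ?_)
      filter_upwards [self_mem_nhdsWithin] with τ hτ
      rw [hG, if_pos (mem_Iio.1 hτ)]
    exact this.le
  · rw [G.measure_Ioi htop, hG, if_neg (not_lt.2 hτ), sub_sub_cancel]

end IsSubordinator

theorem boundedVariationOn_of_monotoneOn {f : ℝ → ℝ} {s : Set ℝ} (hf : MonotoneOn f s) {a b : ℝ}
    (ha : ∀ x ∈ s, a ≤ f x) (hb : ∀ x ∈ s, f x ≤ b) : BoundedVariationOn f s := by
  have : eVariationOn f s ≤ ENNReal.ofReal (b - a) := by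
    refine iSup_le fun p => ?_
    obtain ⟨n, u, hu, hus⟩ := p
    have e : ∀ i, edist (f (u (i + 1))) (f (u i)) = ENNReal.ofReal (f (u (i + 1)) - f (u i)) :=
      fun i => by
        rw [edist_dist, Real.dist_eq, abs_of_nonneg
          (sub_nonneg.2 (hf (hus i) (hus (i + 1)) (hu (Nat.le_succ i))))]
    simp only [e]
    rw [← ENNReal.ofReal_sum_of_nonneg fun i _ =>
      sub_nonneg.2 (hf (hus i) (hus (i + 1)) (hu (Nat.le_succ i))),
      Finset.sum_range_sub (fun i => f (u i))]
    exact ENNReal.ofReal_le_ofReal (by linarith [ha _ (hus 0), hb _ (hus n)])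
  exact ne_top_of_le_ne_top ENNReal.ofReal_ne_top this

theorem CompletelyPositive.exists_propagation {m : ℝ → ℝ} (hm : CompletelyPositive m) :
    ∃ w : ℝ → ℝ → ℝ, IsPropagationFunction m w ∧
      ∃ ν : ℝ → Measure ℝ, ∀ t, 0 ≤ t → IsNegDtau w t (ν t) := by
  have hex := fun τ : ℝ => hm.exists_subordinator (τ := max τ 0) (le_max_right _ _)
  choose η hη hηm using hex
  have h : IsSubordinator (fun lam => 1 / laplace m lam) η :=
    ⟨hη, fun τ hτ lam hlam => by rw [hηm τ lam hlam, max_eq_left hτ]⟩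
  have hΦ : 0 < 1 / laplace m 1 := one_div_pos.2 (hm.laplace_pos one_pos)
  refine ⟨propFun η, ⟨fun τ _ => (h.monotone_propFun τ).monotoneOn _, fun τ _ =>
    boundedVariationOn_of_monotoneOn ((h.monotone_propFun τ).monotoneOn _)
      (fun t _ => propFun_nonneg η t τ) (fun t _ => h.propFun_le_one t τ),
    fun τ _ => IsSubordinator.propFun_zero η τ, fun τ _ t _ => h.leftContinuous_propFun t τ,
    fun τ hτ lam hlam => h.laplace_propFun hτ hlam⟩, ?_⟩
  have hν : ∀ t : ℝ, ∃ ν : Measure ℝ, 0 ≤ t → IsNegDtau (propFun η) t ν := fun t => by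
    by_cases ht : 0 ≤ t
    · obtain ⟨ν, hν⟩ := h.exists_isNegDtau hΦ ht
      exact ⟨ν, fun _ => hν⟩
    · exact ⟨0, fun h' => absurd h' ht⟩
  choose ν hν using hν
  exact ⟨ν, hν⟩

theorem CompletelyPositive.exists_resolventFamily {d : ℕ} {p : ℝ≥0∞} [Fact (1 ≤ p)] [Fact (p ≠ ∞)]
    {m : ℝ → ℝ} (hm : CompletelyPositive m) :
    ∃ S : ℝ → LpSpace d p → LpSpace d p, IsResolventFamily m S := by
  obtain ⟨w, hw, ν, hν⟩ := hm.exists_propagation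
  refine ⟨fun t v => ∫ τ, heatSemigroup τ v ∂(ν t), w, hw, ν, hν, fun t ht v => ⟨?_, rfl⟩⟩
  have : IsProbabilityMeasure (ν t) := ⟨(hν t ht).univ_eq⟩
  exact integrable_heatSemigroup _ v

end Propagation

/-! ### The Laplace transform of the subordinating measures -/

section SubordinatingMeasure

variable {m b : ℝ → ℝ} {w : ℝ → ℝ → ℝ} {ν : ℝ → Measure ℝ}

theorem IsPropagationFunction.nonneg (hw : IsPropagationFunction m w) {t τ : ℝ} (ht : 0 ≤ t)
    (hτ : 0 ≤ τ) : 0 ≤ w t τ := by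
  rw [← hw.at_zero τ hτ]
  exact hw.mono τ hτ (mem_Ici.2 le_rfl) ht ht

theorem IsNegDtau.le_one {t : ℝ} {ν : Measure ℝ} (hν : IsNegDtau w t ν) {τ : ℝ} (hτ : 0 ≤ τ) :
    w t τ ≤ 1 := by
  have h1 : ENNReal.ofReal (w t τ) ≤ 1 := by
    rw [← hν.tail_eq τ hτ, ← hν.univ_eq]
    exact measure_mono (subset_univ _)
  rwa [ENNReal.ofReal_le_one] at h1

theorem IsNegDtau.isProbabilityMeasure {t : ℝ} {ν : Measure ℝ} (hν : IsNegDtau w t ν) :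
    IsProbabilityMeasure ν := ⟨hν.univ_eq⟩

theorem IsNegDtau.ae_nonneg {t : ℝ} {ν : Measure ℝ} (hν : IsNegDtau w t ν) : ∀ᵐ τ ∂ν, 0 ≤ τ := by
  rw [ae_iff]
  simpa [Iio] using hν.neg_eq

theorem integral_mul_exp_neg (k τ : ℝ) :
    ∫ x in (0 : ℝ)..τ, k * Real.exp (-k * x) = 1 - Real.exp (-k * τ) := by
  have h : ∀ x ∈ uIcc 0 τ, HasDerivAt (fun x => -Real.exp (-k * x)) (k * Real.exp (-k * x)) x :=
    fun x _ => by
      have h1 := ((hasDerivAt_id x).const_mul (-k)).exp.neg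
      refine h1.congr_deriv ?_
      simp [mul_comm]
  rw [intervalIntegral.integral_eq_sub_of_hasDerivAt h
    (Continuous.intervalIntegrable (by fun_prop) _ _)]
  simp
  ring

/-- `1 - ∫ e^{-kτ} ν(dτ)` as an integral of the tail. -/
theorem IsNegDtau.lintegral_one_sub_exp {t : ℝ} {ν : Measure ℝ} (hν : IsNegDtau w t ν) {k : ℝ}
    (hk : 0 < k) : ∫⁻ τ, ENNReal.ofReal (1 - Real.exp (-k * τ)) ∂ν
      = ∫⁻ x in Ioi 0, ENNReal.ofReal (w t x) * ENNReal.ofReal (k * Real.exp (-k * x)) := by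
  have h := lintegral_comp_eq_lintegral_meas_lt_mul ν (f := fun τ : ℝ => τ)
    (g := fun x => k * Real.exp (-k * x)) hν.ae_nonneg aemeasurable_id
    (fun x _ => Continuous.intervalIntegrable (by fun_prop) _ _)
    (ae_of_all _ fun x => by positivity)
  simp_rw [integral_mul_exp_neg k] at h
  rw [h]
  refine setLIntegral_congr_fun measurableSet_Ioi fun x hx => ?_
  rw [← hν.tail_eq x (le_of_lt hx)]
  rfl

theorem IsNegDtau.integrable_exp {t : ℝ} {ν : Measure ℝ} (hν : IsNegDtau w t ν) {k : ℝ}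
    (hk : 0 ≤ k) : Integrable (fun τ => Real.exp (-k * τ)) ν := by
  have := hν.isProbabilityMeasure
  refine Integrable.of_bound (by fun_prop) 1 ?_
  filter_upwards [hν.ae_nonneg] with τ hτ
  rw [Real.norm_of_nonneg (Real.exp_pos _).le, Real.exp_le_one_iff]
  nlinarith

/-- A version of `w` that is jointly measurable. -/
theorem exists_measurable_propagation (hw : IsPropagationFunction m w)
    (hν : ∀ t, 0 ≤ t → IsNegDtau w t (ν t)) :
    ∃ W : ℝ × ℝ → ℝ≥0∞, Measurable W ∧
      ∀ t τ, 0 < t → 0 < τ → W (t, τ) = ENNReal.ofReal (w t τ) := by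
  -- A countable supremum over rational times `s < t`, each term monotone in `τ`, is jointly
  -- measurable; monotonicity and left-continuity in time identify it with `w`. Tonelli's theorem
  -- requires this.
  let W : ℝ × ℝ → ℝ≥0∞ := fun q => ⨆ s : ℚ,
    {a : ℝ × ℝ | (0 : ℝ) < s ∧ (s : ℝ) < a.1}.indicator (fun a => ν s (Ioi a.2)) q
  refine ⟨W, ?_, fun t τ ht hτ => ?_⟩
  · refine Measurable.iSup fun s => ?_
    by_cases hs : (0 : ℝ) < s
    · refine Measurable.indicator ?_ ?_
      · have h1 : Antitone fun x : ℝ => ν s (Ioi x) := fun x y hxy =>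
          measure_mono (Ioi_subset_Ioi hxy)
        exact h1.measurable.comp measurable_snd
      · simp only [hs, true_and]
        exact measurableSet_lt measurable_const measurable_fst
    · simp only [hs, false_and]
      simp
  · apply le_antisymm
    · refine iSup_le fun s => ?_
      by_cases hs : (t, τ) ∈ {a : ℝ × ℝ | (0 : ℝ) < s ∧ (s : ℝ) < a.1}
      · rw [indicator_of_mem hs, (hν s hs.1.le).tail_eq τ hτ.le]
        exact ENNReal.ofReal_le_ofReal (hw.mono τ hτ.le hs.1.le ht.le hs.2.le)
      · rw [indicator_of_notMem hs]
        exact zero_le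
    · refine le_of_forall_lt fun c hc => ?_
      have h1 : Tendsto (fun s => ENNReal.ofReal (w s τ)) (𝓝[<] t) (𝓝 (ENNReal.ofReal (w t τ))) :=
        ENNReal.tendsto_ofReal ((hw.left_cont τ hτ.le t ht).mono_left
          (nhdsWithin_mono _ Iio_subset_Iic_self))
      have h2 := h1.eventually (lt_mem_nhds hc)
      obtain ⟨l, hl, hlt⟩ := (mem_nhdsLT_iff_exists_Ioo_subset' ht).1 h2
      obtain ⟨s, hs1, hs2⟩ := exists_rat_btwn (show max l 0 < t from max_lt hl ht)
      have hs0 : (0 : ℝ) < s := (le_max_right _ _).trans_lt hs1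
      have h3 : c < ENNReal.ofReal (w s τ) := hlt ⟨(le_max_left _ _).trans_lt hs1, hs2⟩
      refine lt_of_lt_of_le h3 (le_trans (le_of_eq ?_) (le_iSup (fun s : ℚ =>
        {a : ℝ × ℝ | (0 : ℝ) < s ∧ (s : ℝ) < a.1}.indicator (fun a => ν s (Ioi a.2)) (t, τ)) s))
      rw [indicator_of_mem (show (t, τ) ∈ {a : ℝ × ℝ | (0 : ℝ) < s ∧ (s : ℝ) < a.1} from ⟨hs0, hs2⟩),
        (hν s hs0.le).tail_eq τ hτ.le]

theorem IsPropagationFunction.measurable_tail (hν : ∀ t, 0 ≤ t → IsNegDtau w t (ν t)) {t : ℝ}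
    (ht : 0 ≤ t) : AEMeasurable (fun x => ENNReal.ofReal (w t x)) (volume.restrict (Ioi 0)) := by
  have h1 : Antitone fun x : ℝ => ν t (Ioi x) := fun x y hxy => measure_mono (Ioi_subset_Ioi hxy)
  refine ⟨_, h1.measurable, ?_⟩
  filter_upwards [ae_restrict_mem measurableSet_Ioi] with x hx
  rw [(hν t ht).tail_eq x (le_of_lt hx)]

theorem IsPropagationFunction.lweight_eq (hw : IsPropagationFunction m w)
    (hν : ∀ t, 0 ≤ t → IsNegDtau w t (ν t)) {τ : ℝ} (hτ : 0 ≤ τ) {lam : ℝ} (hlam : 0 < lam) :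
    ∫⁻ t in Ioi 0, ENNReal.ofReal (Real.exp (-lam * t)) * ENNReal.ofReal (w t τ)
      = ENNReal.ofReal (Real.exp (-τ * (1 / laplace m lam)) / lam) := by
  have hmeas : AEStronglyMeasurable (fun t => w t τ) (volume.restrict (Ioi 0)) :=
    (aemeasurable_restrict_of_monotoneOn measurableSet_Ioi
      ((hw.mono τ hτ).mono Ioi_subset_Ici_self)).aestronglyMeasurable
  have hint : IntegrableOn (fun t => Real.exp (-lam * t) * w t τ) (Ioi 0) :=
    integrableOn_exp_mul_of_bounded hlam hmeas (C := 1) fun t ht => by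
      rw [abs_of_nonneg (hw.nonneg ht.le hτ)]
      exact (hν t ht.le).le_one hτ
  rw [← hw.laplace_eq τ hτ lam hlam, laplace, ofReal_integral_eq_lintegral_ofReal hint]
  · refine lintegral_congr fun t => ?_
    rw [ENNReal.ofReal_mul (Real.exp_pos _).le]
  · filter_upwards [ae_restrict_mem measurableSet_Ioi] with t ht
    exact mul_nonneg (Real.exp_pos _).le (hw.nonneg (le_of_lt ht) hτ)

/-- The double Laplace transform of the tails. -/
theorem CompletelyPositive.lweight_tail (hm : CompletelyPositive m)
    (hw : IsPropagationFunction m w) (hν : ∀ t, 0 ≤ t → IsNegDtau w t (ν t)) {k : ℝ} (hk : 0 < k)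
    {lam : ℝ} (hlam : 0 < lam) :
    lweight lam (Ioi 0) (fun t => ∫⁻ x in Ioi 0,
      ENNReal.ofReal (w t x) * ENNReal.ofReal (k * Real.exp (-k * x)))
      = ENNReal.ofReal (k / (lam * (k + 1 / laplace m lam))) := by
  obtain ⟨W, hWm, hW⟩ := exists_measurable_propagation hw hν
  have hpos := hm.laplace_pos hlam
  have hr : 0 < k + 1 / laplace m lam := by positivity
  calc _ = ∫⁻ t in Ioi 0, ∫⁻ x in Ioi 0, ENNReal.ofReal (Real.exp (-lam * t)) *
        (W (t, x) * ENNReal.ofReal (k * Real.exp (-k * x))) := by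
        refine setLIntegral_congr_fun measurableSet_Ioi fun t ht => ?_
        beta_reduce
        rw [lintegral_const_mul' _ _ ENNReal.ofReal_ne_top]
        congr 1
        refine setLIntegral_congr_fun measurableSet_Ioi fun x hx => ?_
        rw [hW t x ht hx]
    _ = ∫⁻ x in Ioi 0, ∫⁻ t in Ioi 0, ENNReal.ofReal (Real.exp (-lam * t)) *
        (W (t, x) * ENNReal.ofReal (k * Real.exp (-k * x))) := by
        rw [lintegral_lintegral_swap]
        have : Measurable fun q : ℝ × ℝ => ENNReal.ofReal (Real.exp (-lam * q.1)) *
            (W q * ENNReal.ofReal (k * Real.exp (-k * q.2))) := by fun_prop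
        exact this.aemeasurable
    _ = ∫⁻ x in Ioi 0, ENNReal.ofReal (k / lam * Real.exp (-(k + 1 / laplace m lam) * x)) := by
        refine setLIntegral_congr_fun measurableSet_Ioi fun x hx => ?_
        have e : ∫⁻ t in Ioi 0, ENNReal.ofReal (Real.exp (-lam * t)) *
            (W (t, x) * ENNReal.ofReal (k * Real.exp (-k * x)))
            = (∫⁻ t in Ioi 0, ENNReal.ofReal (Real.exp (-lam * t)) * ENNReal.ofReal (w t x))
              * ENNReal.ofReal (k * Real.exp (-k * x)) := by
          rw [← lintegral_mul_const' _ _ ENNReal.ofReal_ne_top]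
          refine setLIntegral_congr_fun measurableSet_Ioi fun t ht => ?_
          rw [hW t x ht hx, mul_assoc]
        rw [e, hw.lweight_eq hν (le_of_lt hx) hlam, ← ENNReal.ofReal_mul (by positivity)]
        congr 1
        rw [show -(k + 1 / laplace m lam) * x = -x * (1 / laplace m lam) + -k * x by ring,
          Real.exp_add]
        ring
    _ = _ := by
        rw [← ofReal_integral_eq_lintegral_ofReal ((integrableOn_exp_mul_Ioi (by linarith) 0
          ).const_mul _) (ae_of_all _ fun x => by positivity), integral_const_mul,
          integral_exp_mul_Ioi (by linarith)]
        congr 1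
        simp only [mul_zero, Real.exp_zero]
        field_simp

theorem lconv_indicator_one {r : ℝ → ℝ≥0∞} (t : ℝ) (hr0 : ∀ t ≤ 0, r t = 0) :
    lconv ((Ioi 0).indicator fun _ => 1) r t = ∫⁻ σ in Ioc 0 t, r σ := by
  rw [lconv, setLIntegral_congr (Ioo_ae_eq_Ioc (a := (0 : ℝ)) (b := t)).symm,
    ← lintegral_indicator measurableSet_Ioo]
  refine lintegral_congr fun σ => ?_
  by_cases h1 : 0 < σ
  · by_cases h2 : σ < t
    · rw [indicator_of_mem (show t - σ ∈ Ioi (0 : ℝ) from sub_pos.2 h2),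
        indicator_of_mem (show σ ∈ Ioo 0 t from ⟨h1, h2⟩), one_mul]
    · rw [indicator_of_notMem (show t - σ ∉ Ioi (0 : ℝ) from fun h => h2 (sub_pos.1 h)),
        indicator_of_notMem (show σ ∉ Ioo 0 t from fun h => h2 h.2), zero_mul]
  · rw [hr0 σ (not_lt.1 h1), mul_zero, indicator_of_notMem (show σ ∉ Ioo 0 t from fun h => h1 h.1)]

/-- The Laplace transform of the integrated resolvent kernel. -/
theorem CompletelyPositive.lweight_integral_resolvent (hm : CompletelyPositive m)
    (hb : IsNonnegRep b m) {k : ℝ} (hk : 0 < k) {r : ℝ → ℝ} (hr : IsNonnegRep r r)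
    (hsol : IsVolterraSolution k b r b) {lam : ℝ} (hlam : 0 < lam) :
    lweight lam (Ioi 0) (fun t => ENNReal.ofReal (k * ∫ σ in Ioc 0 t, r σ))
      = ENNReal.ofReal (k / (lam * (k + 1 / laplace m lam))) := by
  have hrm := hr.measurable
  have hpos := hm.laplace_pos hlam
  have hi := hm.integrable_resolvent hb hk hr hsol
  have hr0 : ∀ t ≤ 0, ENNReal.ofReal (r t) = 0 := fun t ht => by simp [hr.zero t ht]
  have hone : Measurable ((Ioi (0 : ℝ)).indicator fun _ => (1 : ℝ≥0∞)) :=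
    measurable_const.indicator measurableSet_Ioi
  have e : ∀ t, ENNReal.ofReal (k * ∫ σ in Ioc 0 t, r σ) = ENNReal.ofReal k *
      lconv ((Ioi 0).indicator fun _ => 1) (fun t => ENNReal.ofReal (r t)) t := fun t => by
    rw [lconv_indicator_one t hr0, ENNReal.ofReal_mul hk.le,
      ofReal_integral_eq_lintegral_ofReal hi.integrableOn (ae_of_all _ hr.nonneg)]
  simp_rw [e]
  rw [lweight_const_mul (measurable_lconv hone (by fun_prop)),
    lweight_lconv lam hone (by fun_prop)
      (fun t ht => indicator_of_notMem (not_lt.2 ht) _) hr0,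
    hm.lweight_resolvent hb hk hr hsol hlam]
  have h1 : lweight lam (Ioi 0) ((Ioi 0).indicator fun _ => 1) = ENNReal.ofReal (1 / lam) := by
    rw [← lweight_one hlam]
    refine setLIntegral_congr_fun measurableSet_Ioi fun t ht => ?_
    beta_reduce
    rw [indicator_of_mem ht, ENNReal.ofReal_one]
  rw [h1, ← ENNReal.ofReal_mul (by positivity), ← ENNReal.ofReal_mul hk.le]
  congr 1
  field_simp
  ring

theorem eq_of_ae_eq_of_leftContinuous {F G : ℝ → ℝ}
    (h : ∀ᵐ t ∂volume.restrict (Ioi (0 : ℝ)), F t = G t) {t : ℝ} (ht : 0 < t)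
    (hF : ContinuousWithinAt F (Iic t) t) (hG : ContinuousWithinAt G (Iic t) t) : F t = G t := by
  have hfreq : ∃ᶠ s in 𝓝[<] t, F s = G s := by
    intro hev
    obtain ⟨l, hl, hsub⟩ := (mem_nhdsLT_iff_exists_Ioo_subset' ht).1 hev
    have hnull : volume (Ioo (max l 0) t) = 0 := by
      rw [ae_restrict_iff' measurableSet_Ioi, ae_iff] at h
      refine measure_mono_null (fun s hs => ?_) h
      have h1 : s ∈ Ioo l t := ⟨(le_max_left _ _).trans_lt hs.1, hs.2⟩
      have h2 : 0 < s := (le_max_right _ _).trans_lt hs.1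
      exact fun h' => hsub h1 (h' h2)
    rw [Real.volume_Ioo, ENNReal.ofReal_eq_zero] at hnull
    have := max_lt (mem_Iio.1 hl) ht
    linarith
  exact tendsto_nhds_unique_of_frequently_eq
    (hF.mono_left (nhdsWithin_mono _ Iio_subset_Iic_self))
    (hG.mono_left (nhdsWithin_mono _ Iio_subset_Iic_self)) hfreq

theorem continuous_integral_Ioc {r : ℝ → ℝ} (hi : Integrable r) (hr0 : ∀ t ≤ 0, r t = 0) :
    Continuous fun t => ∫ σ in Ioc 0 t, r σ := by
  have h := intervalIntegral.continuous_primitive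
    (fun a b => hi.intervalIntegrable (a := a) (b := b)) 0
  refine h.congr fun t => ?_
  rcases le_total 0 t with ht | ht
  · rw [intervalIntegral.integral_of_le ht]
  · rw [Ioc_eq_empty (not_lt.2 ht), intervalIntegral.integral_of_ge ht, Measure.restrict_empty,
      integral_zero_measure, neg_eq_zero]
    refine setIntegral_eq_zero_of_forall_eq_zero fun x hx => hr0 x hx.2

/-- The Laplace transform of the subordinating measures in terms of the resolvent kernel. -/
theorem CompletelyPositive.integral_exp_eq (hm : CompletelyPositive m) (hb : IsNonnegRep b m)
    (hw : IsPropagationFunction m w) (hν : ∀ t, 0 ≤ t → IsNegDtau w t (ν t)) {k : ℝ} (hk : 0 < k)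
    {r : ℝ → ℝ} (hr : IsNonnegRep r r) (hsol : IsVolterraSolution k b r b) {t : ℝ} (ht : 0 ≤ t) :
    ∫ τ, Real.exp (-k * τ) ∂(ν t) = 1 - k * ∫ σ in Ioc 0 t, r σ := by
  have hi := hm.integrable_resolvent hb hk hr hsol
  -- `F` is one minus the transform of `ν t`, written through the tails; `G` is the integrated
  -- resolvent kernel. The claim is `F = G`.
  set F : ℝ → ℝ := fun t => (∫⁻ x in Ioi 0,
    ENNReal.ofReal (w t x) * ENNReal.ofReal (k * Real.exp (-k * x))).toReal with hF
  set G : ℝ → ℝ := fun t => k * ∫ σ in Ioc 0 t, r σ with hG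
  have hFeq : ∀ t, 0 ≤ t → ∫ τ, Real.exp (-k * τ) ∂(ν t) = 1 - F t := fun t ht => by
    have := (hν t ht).isProbabilityMeasure
    have hie := (hν t ht).integrable_exp hk.le
    have h1 : F t = ∫ τ, (1 - Real.exp (-k * τ)) ∂(ν t) := by
      rw [hF, integral_eq_lintegral_of_nonneg_ae _ (by fun_prop)]
      · beta_reduce
        rw [(hν t ht).lintegral_one_sub_exp hk]
      · filter_upwards [(hν t ht).ae_nonneg] with τ hτ
        simp only [Pi.zero_apply, sub_nonneg, Real.exp_le_one_iff]
        nlinarith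
    rw [h1, integral_sub (integrable_const _) hie]
    simp
  have hke : IntegrableOn (fun x => k * Real.exp (-k * x)) (Ioi 0) :=
    (integrableOn_exp_mul_Ioi (by linarith) 0).const_mul _
  have hwm : ∀ t, 0 ≤ t → AEStronglyMeasurable (fun x => w t x * (k * Real.exp (-k * x)))
      (volume.restrict (Ioi 0)) := fun t ht => by
    have h1 := (IsPropagationFunction.measurable_tail hν ht).ennreal_toReal
    have h2 : AEMeasurable (fun x => w t x) (volume.restrict (Ioi 0)) := by
      refine h1.congr ?_
      filter_upwards [ae_restrict_mem measurableSet_Ioi] with x hx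
      rw [ENNReal.toReal_ofReal (hw.nonneg ht (le_of_lt hx))]
    exact (h2.mul (by fun_prop)).aestronglyMeasurable
  have hFint : ∀ t, 0 ≤ t → F t = ∫ x in Ioi 0, w t x * (k * Real.exp (-k * x)) := fun t ht => by
    rw [integral_eq_lintegral_of_nonneg_ae _ (hwm t ht), hF]
    · beta_reduce
      congr 1
      refine setLIntegral_congr_fun measurableSet_Ioi fun x hx => ?_
      rw [ENNReal.ofReal_mul (hw.nonneg ht (le_of_lt hx))]
    · filter_upwards [ae_restrict_mem measurableSet_Ioi] with x hx
      exact mul_nonneg (hw.nonneg ht (le_of_lt hx)) (by positivity)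
  have hbound : ∀ t, 0 ≤ t → ∀ x, 0 < x → ‖w t x * (k * Real.exp (-k * x))‖
      ≤ k * Real.exp (-k * x) := fun t ht x hx => by
    rw [norm_mul, Real.norm_of_nonneg (hw.nonneg ht hx.le), Real.norm_of_nonneg (by positivity)]
    exact mul_le_of_le_one_left (by positivity) ((hν t ht).le_one hx.le)
  have hFnn : ∀ t, 0 ≤ F t := fun t => ENNReal.toReal_nonneg
  have hF1 : ∀ t, 0 ≤ t → F t ≤ 1 := fun t ht => by
    have h1 := hFeq t ht
    have h2 : 0 ≤ ∫ τ, Real.exp (-k * τ) ∂(ν t) := integral_nonneg fun _ => (Real.exp_pos _).le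
    linarith
  have hFleft : ∀ t, 0 < t → ContinuousWithinAt F (Iic t) t := fun t ht => by
    have h1 : Tendsto (fun s => ∫ x in Ioi 0, w s x * (k * Real.exp (-k * x))) (𝓝[Iic t] t)
        (𝓝 (∫ x in Ioi 0, w t x * (k * Real.exp (-k * x)))) := by
      have hev : ∀ᶠ s in 𝓝[Iic t] t, 0 ≤ s :=
        mem_nhdsWithin_of_mem_nhds (Ici_mem_nhds ht)
      refine tendsto_integral_filter_of_dominated_convergence (fun x => k * Real.exp (-k * x))
        ?_ ?_ hke ?_
      · filter_upwards [hev] with s hs using hwm s hs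
      · filter_upwards [hev] with s hs
        filter_upwards [ae_restrict_mem measurableSet_Ioi] with x hx using hbound s hs x hx
      · filter_upwards [ae_restrict_mem measurableSet_Ioi] with x hx
        exact Tendsto.mul_const _ (hw.left_cont x (le_of_lt hx) t ht)
    rw [ContinuousWithinAt, hFint t ht.le]
    refine h1.congr' ?_
    filter_upwards [mem_nhdsWithin_of_mem_nhds (Ici_mem_nhds ht)] with s hs
    rw [hFint s hs]
  have hGc : Continuous G := continuous_const.mul (continuous_integral_Ioc hi hr.zero)
  have hGnn : ∀ t, 0 ≤ G t := fun t =>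
    mul_nonneg hk.le (integral_nonneg hr.nonneg)
  have hFmono : MonotoneOn F (Ioi 0) := fun s hs t ht hst => by
    have hs' : 0 ≤ s := le_of_lt hs
    have ht' : 0 ≤ t := le_of_lt ht
    rw [hFint s hs', hFint t ht']
    have hint : ∀ t, 0 ≤ t → IntegrableOn (fun x => w t x * (k * Real.exp (-k * x))) (Ioi 0) :=
      fun t ht => hke.mono' (hwm t ht) (by
        filter_upwards [ae_restrict_mem measurableSet_Ioi] with x hx using hbound t ht x hx)
    refine setIntegral_mono_on (hint s hs') (hint t ht') measurableSet_Ioi fun x hx => ?_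
    have hx' : 0 ≤ x := le_of_lt hx
    exact mul_le_mul_of_nonneg_right (hw.mono x hx' hs' ht' hst) (by positivity)
  have hFmeas : AEStronglyMeasurable F (volume.restrict (Ioi 0)) :=
    (aemeasurable_restrict_of_monotoneOn measurableSet_Ioi hFmono).aestronglyMeasurable
  have hlap : ∀ H : ℝ → ℝ, (∀ t, 0 ≤ H t) → AEStronglyMeasurable H (volume.restrict (Ioi 0)) →
      ∀ lam : ℝ, laplace H lam = (lweight lam (Ioi 0) (fun t => ENNReal.ofReal (H t))).toReal := by
    intro H hH hHm lam
    rw [laplace, integral_eq_lintegral_of_nonneg_ae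
      (ae_of_all _ fun t => mul_nonneg (Real.exp_pos _).le (hH t)) (by fun_prop), lweight]
    congr 1
    refine lintegral_congr fun t => ?_
    rw [ENNReal.ofReal_mul (Real.exp_pos _).le]
  -- Both transforms in time equal `k / (λ (k + 1/m̂))`, and bounded functions are determined almost
  -- everywhere by their transforms.
  have hae : ∀ᵐ t ∂volume.restrict (Ioi (0 : ℝ)), F t = G t := by
    refine ae_eq_of_laplace_eq (C := 1) hFmeas hGc.aestronglyMeasurable (fun t ht => ?_)
      (fun t ht => ?_) fun lam hlam => ?_
    · rw [abs_of_nonneg (hFnn t)]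
      exact hF1 t ht.le
    · rw [abs_of_nonneg (hGnn t)]
      exact hm.resolvent_mass_le hb hk hr hsol t
    · rw [hlap F hFnn hFmeas, hlap G hGnn hGc.aestronglyMeasurable,
        hm.lweight_integral_resolvent hb hk hr hsol hlam, ← hm.lweight_tail hw hν hk hlam]
      congr 1
      refine setLIntegral_congr_fun measurableSet_Ioi fun t ht => ?_
      beta_reduce
      rw [hF]
      beta_reduce
      rw [ENNReal.ofReal_toReal]
      rw [← (hν t (le_of_lt ht)).lintegral_one_sub_exp hk]
      have := (hν t (le_of_lt ht)).isProbabilityMeasure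
      refine ne_top_of_le_ne_top ENNReal.one_ne_top ?_
      calc _ ≤ ∫⁻ _, 1 ∂(ν t) := lintegral_mono fun τ => by
            rw [ENNReal.ofReal_le_one]
            linarith [Real.exp_pos (-k * τ)]
        _ = 1 := by simp
  rw [hFeq t ht]
  congr 1
  -- Left-continuity identifies the values only for `t > 0`; at `t = 0` both sides vanish because `w
  -- 0 x = 0`.
  rcases ht.eq_or_lt with rfl | ht
  · rw [hFint 0 le_rfl, Ioc_self, Measure.restrict_empty, integral_zero_measure, mul_zero]
    refine setIntegral_eq_zero_of_forall_eq_zero fun x hx => ?_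
    rw [hw.at_zero x (le_of_lt hx), zero_mul]
  · exact eq_of_ae_eq_of_leftContinuous hae ht (hFleft t ht) hGc.continuousWithinAt

end SubordinatingMeasure

/-! ### Relaxation functions and the resolvent family -/

section ResolventFamily

/-- A nonnegative measurable version of a kernel. -/
def kernelRep (m : ℝ → ℝ) : ℝ → ℝ := Classical.epsilon fun b => IsNonnegRep b m

/-- The resolvent kernel `r` of `r + k m * r = m`. -/
def resolventKernel (m : ℝ → ℝ) (k : ℝ) : ℝ → ℝ :=
  Classical.epsilon fun r => IsNonnegRep r r ∧ IsVolterraSolution k (kernelRep m) r (kernelRep m)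

/-- The relaxation function `1 - k ∫₀ᵗ r`, the solution of `s + k m * s = 1`. -/
def relaxation (m : ℝ → ℝ) (k t : ℝ) : ℝ := 1 - k * ∫ σ in Ioc 0 t, resolventKernel m k σ

variable {m : ℝ → ℝ}

theorem CompletelyPositive.isNonnegRep_kernelRep (hm : CompletelyPositive m) :
    IsNonnegRep (kernelRep m) m :=
  Classical.epsilon_spec hm.exists_rep

theorem CompletelyPositive.resolventKernel_spec (hm : CompletelyPositive m) {k : ℝ} (hk : 0 < k) :
    IsNonnegRep (resolventKernel m k) (resolventKernel m k) ∧
      IsVolterraSolution k (kernelRep m) (resolventKernel m k) (kernelRep m) := by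
  obtain ⟨r, h1, -, h2⟩ := hm.exists_resolvent hm.isNonnegRep_kernelRep hk
  exact Classical.epsilon_spec (p := fun r => IsNonnegRep r r ∧
    IsVolterraSolution k (kernelRep m) r (kernelRep m)) ⟨r, h1, h2⟩

theorem CompletelyPositive.continuous_relaxation (hm : CompletelyPositive m) {k : ℝ}
    (hk : 0 ≤ k) : Continuous (relaxation m k) := by
  rcases hk.eq_or_lt with rfl | hk
  · simp only [funext fun t => show relaxation m 0 t = 1 by simp [relaxation]]
    exact continuous_const
  · obtain ⟨h1, h2⟩ := hm.resolventKernel_spec hk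
    exact continuous_const.sub (continuous_const.mul (continuous_integral_Ioc
      (hm.integrable_resolvent hm.isNonnegRep_kernelRep hk h1 h2) h1.zero))

theorem CompletelyPositive.exists_relaxation_stability (hm : CompletelyPositive m) {k : ℝ}
    (hk : 0 ≤ k) (T : ℝ) : ∃ C : ℝ, 0 ≤ C ∧ ∀ m' : ℝ → ℝ, CompletelyPositive m' → ∀ t ≤ T,
      |relaxation m' k t - relaxation m k t| ≤ C * ∫ σ in Ioo 0 T, |m' σ - m σ| := by
  rcases hk.eq_or_lt with rfl | hk
  · refine ⟨0, le_rfl, fun m' _ t _ => ?_⟩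
    simp [relaxation]
  obtain ⟨h1, h2⟩ := hm.resolventKernel_spec hk
  obtain ⟨C, hC0, hC⟩ := hm.exists_resolvent_stability hm.isNonnegRep_kernelRep hk h1 h2 T
  refine ⟨k * C, by positivity, fun m' hm' t ht => ?_⟩
  obtain ⟨h1', h2'⟩ := hm'.resolventKernel_spec hk
  have h := hC m' _ _ hm' hm'.isNonnegRep_kernelRep h1' h2' t ht
  have e : relaxation m' k t - relaxation m k t = -k * ((∫ σ in Ioc 0 t, resolventKernel m' k σ)
      - ∫ σ in Ioc 0 t, resolventKernel m k σ) := by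
    simp only [relaxation]
    ring
  rw [e, abs_mul, abs_neg, abs_of_pos hk, mul_assoc]
  exact mul_le_mul_of_nonneg_left h hk.le

variable {w : ℝ → ℝ → ℝ} {ν : ℝ → Measure ℝ}

theorem CompletelyPositive.integral_exp_eq_relaxation (hm : CompletelyPositive m)
    (hw : IsPropagationFunction m w) (hν : ∀ t, 0 ≤ t → IsNegDtau w t (ν t)) {k : ℝ} (hk : 0 ≤ k)
    {t : ℝ} (ht : 0 ≤ t) : ∫ τ, Real.exp (-k * τ) ∂(ν t) = relaxation m k t := by
  rcases hk.eq_or_lt with rfl | hk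
  · have := (hν t ht).isProbabilityMeasure
    simp [relaxation]
  obtain ⟨h1, h2⟩ := hm.resolventKernel_spec hk
  exact hm.integral_exp_eq hm.isNonnegRep_kernelRep hw hν hk h1 h2 ht

/-- The resolvent kernel lies below `m`, as the convolution term is nonnegative. -/
theorem CompletelyPositive.one_sub_relaxation_le (hm : CompletelyPositive m) {k : ℝ} (hk : 0 < k)
    {t T : ℝ} (htT : t ≤ T) : 1 - relaxation m k t ≤ k * ∫ σ in Ioo 0 T, m σ := by
  obtain ⟨h1, h2⟩ := hm.resolventKernel_spec hk
  have hb := hm.isNonnegRep_kernelRep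
  have hi := hm.integrable_resolvent hb hk h1 h2
  have hmono : volume.restrict (Ioo 0 T) ≤ volume.restrict (Ioi (0 : ℝ)) :=
    Measure.restrict_mono Ioo_subset_Ioi_self le_rfl
  rw [relaxation, sub_sub_cancel]
  refine mul_le_mul_of_nonneg_left ?_ hk.le
  calc ∫ σ in Ioc 0 t, resolventKernel m k σ ≤ ∫ σ in Ioc 0 T, resolventKernel m k σ :=
        setIntegral_mono_set hi.integrableOn (ae_of_all _ h1.nonneg)
          (Ioc_subset_Ioc_right htT).eventuallyLE
    _ = ∫ σ in Ioo 0 T, resolventKernel m k σ := integral_Ioc_eq_integral_Ioo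
    _ ≤ ∫ σ in Ioo 0 T, m σ := by
        refine integral_mono_ae hi.integrableOn
          ((hm.locInt T).mono_set Ioo_subset_Ioc_self) ?_
        filter_upwards [ae_mono hmono (resolvent_ae_le hb.nonneg hk.le h1.nonneg h2),
          ae_mono hmono hb.ae_eq] with t h3 h4
        rwa [← h4]

/-- Chebyshev's inequality with `k = 1/R`: for `τ > R` one has `1 - e^{-τ/R} ≥ 1 - e^{-1} ≥ 1/2`.
The bound involves the kernel only through its mass on `(0,T)`, which gives tightness uniformly in
`t` and in the kernel. -/
theorem CompletelyPositive.tail_le (hm : CompletelyPositive m) (hw : IsPropagationFunction m w)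
    (hν : ∀ t, 0 ≤ t → IsNegDtau w t (ν t)) {t T : ℝ} (ht : 0 ≤ t) (htT : t ≤ T) {R : ℝ}
    (hR : 0 < R) : (ν t).real (Ioi R) ≤ 2 * (∫ σ in Ioo 0 T, m σ) / R := by
  have := (hν t ht).isProbabilityMeasure
  have hk : 0 < 1 / R := by positivity
  have hie := (hν t ht).integrable_exp hk.le
  have hhalf : (1 : ℝ) / 2 ≤ 1 - Real.exp (-1) := by
    have h2 : (2 : ℝ) ≤ Real.exp 1 := by linarith [Real.add_one_le_exp (1 : ℝ)]
    have h3 : Real.exp (-1) ≤ 1 / 2 := by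
      rw [Real.exp_neg, ← one_div]
      exact one_div_le_one_div_of_le (by norm_num) h2
    linarith
  have h1 : 1 / 2 * (ν t).real (Ioi R) ≤ 1 - relaxation m (1 / R) t := by
    have e : 1 - relaxation m (1 / R) t = ∫ τ, (1 - Real.exp (-(1 / R) * τ)) ∂(ν t) := by
      rw [integral_sub (integrable_const _) hie, hm.integral_exp_eq_relaxation hw hν hk.le ht]
      simp
    rw [e, mul_comm, ← smul_eq_mul, ← integral_indicator_const _ measurableSet_Ioi]
    refine integral_mono_ae ((integrable_const _).indicator measurableSet_Ioi)
      ((integrable_const _).sub hie) ?_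
    filter_upwards [(hν t ht).ae_nonneg] with τ hτ
    by_cases hτR : τ ∈ Ioi R
    · rw [indicator_of_mem hτR]
      have h4 : Real.exp (-(1 / R) * τ) ≤ Real.exp (-1) := by
        refine Real.exp_le_exp.2 ?_
        rw [neg_mul, neg_le_neg_iff, one_div_mul_eq_div, le_div_iff₀ hR, one_mul]
        exact le_of_lt hτR
      linarith
    · rw [indicator_of_notMem hτR, sub_nonneg, Real.exp_le_one_iff, neg_mul]
      have : 0 ≤ 1 / R * τ := by positivity
      linarith
  have h2 := hm.one_sub_relaxation_le hk htT
  have h3 : 1 / R * (∫ σ in Ioo 0 T, m σ) = (∫ σ in Ioo 0 T, m σ) / R := by ring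
  have h4 : 2 * (∫ σ in Ioo 0 T, m σ) / R = 2 * ((∫ σ in Ioo 0 T, m σ) / R) := by ring
  rw [h4]
  linarith

variable {d : ℕ} {p : ℝ≥0∞} [Fact (1 ≤ p)] [Fact (p ≠ ∞)] {S : ℝ → LpSpace d p → LpSpace d p}

theorem IsResolventFamily.norm_sub_le (hS : IsResolventFamily m S) {t : ℝ} (ht : 0 ≤ t)
    (u v : LpSpace d p) : ‖S t u - S t v‖ ≤ ‖u - v‖ := by
  obtain ⟨w, hw, ν, hν, hSν⟩ := hS
  have := (hν t ht).isProbabilityMeasure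
  rw [(hSν t ht u).2, (hSν t ht v).2, ← integral_sub (hSν t ht u).1 (hSν t ht v).1]
  simp_rw [← heatSemigroup_sub]
  refine (norm_integral_le_of_norm_le_const (C := ‖u - v‖)
    (ae_of_all _ fun τ => norm_heatSemigroup_le τ _)).trans ?_
  simp

/-- The resolvent families of all kernels with bounded mass on `(0,T)` are approximated, on a given
vector, by one and the same combination of relaxation functions. -/
theorem exists_resolventFamily_approx (v : LpSpace d p) (B : ℝ) {ε : ℝ} (hε : 0 < ε) :
    ∃ N : ℕ, ∃ c : ℕ → LpSpace d p, ∀ (m : ℝ → ℝ) (S : ℝ → LpSpace d p → LpSpace d p) (T : ℝ),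
      CompletelyPositive m → IsResolventFamily m S → ∫ σ in Ioo 0 T, m σ ≤ B →
      ∀ t ∈ Icc 0 T, ‖S t v - ∑ k ∈ Finset.range (N + 1), relaxation m k t • c k‖ ≤ ε := by
  -- Only the orbit of `v` and the tail constant `2 * B` enter, so `N` and `c` serve all admissible
  -- kernels.
  obtain ⟨N, c, h⟩ := exists_laplace_sum_approx (continuous_heatSemigroup v)
    (fun τ => norm_heatSemigroup_le τ v) (2 * B) hε
  refine ⟨N, c, fun m S T hm hS hB t ht => ?_⟩
  obtain ⟨w, hw, ν, hν, hSν⟩ := hS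
  have h1 := h (ν t) (hν t ht.1).isProbabilityMeasure (hν t ht.1).neg_eq fun R hR =>
    (hm.tail_le hw hν ht.1 ht.2 hR).trans (by gcongr)
  rw [(hSν t ht.1 v).2]
  simpa only [hm.integral_exp_eq_relaxation hw hν (Nat.cast_nonneg _) ht.1] using h1

/-- A uniform limit of finite sums of continuous relaxation functions times fixed vectors. -/
theorem IsResolventFamily.continuousOn (hm : CompletelyPositive m) (hS : IsResolventFamily m S)
    (v : LpSpace d p) (T : ℝ) : ContinuousOn (fun t => S t v) (Icc 0 T) := by
  refine continuousOn_of_uniform_approx_of_continuousOn fun U hU => ?_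
  obtain ⟨ε, hε, hεU⟩ := Metric.mem_uniformity_dist.1 hU
  obtain ⟨N, c, h⟩ := exists_resolventFamily_approx v (∫ σ in Ioo 0 T, m σ) (half_pos hε)
  refine ⟨fun t => ∑ k ∈ Finset.range (N + 1), relaxation m k t • c k, ?_, fun t ht => hεU ?_⟩
  · have := fun k : ℕ => hm.continuous_relaxation (Nat.cast_nonneg (α := ℝ) k)
    fun_prop
  · rw [dist_eq_norm]
    exact (h m S T hm hS le_rfl t ht).trans_lt (half_lt_self hε)

/-- Convergence of kernels in `L¹(0,T)` implies strong convergence of the resolvent families,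
uniformly on `[0,T]`. -/
theorem IsResolventFamily.exists_stability (hm : CompletelyPositive m)
    (hS : IsResolventFamily m S) (v : LpSpace d p) (T : ℝ) {ε : ℝ} (hε : 0 < ε) :
    ∃ δ > 0, ∀ (m' : ℝ → ℝ) (S' : ℝ → LpSpace d p → LpSpace d p), CompletelyPositive m' →
      IsResolventFamily m' S' → ∫ σ in Ioo 0 T, |m' σ - m σ| < δ →
      ∀ t ∈ Icc 0 T, ‖S' t v - S t v‖ ≤ ε := by
  obtain ⟨N, c, h⟩ := exists_resolventFamily_approx v ((∫ σ in Ioo 0 T, m σ) + 1)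
    (show 0 < ε / 3 by positivity)
  choose C hC0 hC using fun k : ℕ => hm.exists_relaxation_stability (Nat.cast_nonneg (α := ℝ) k) T
  set K := ∑ k ∈ Finset.range (N + 1), C k * ‖c k‖ with hK
  have hK0 : 0 ≤ K := Finset.sum_nonneg fun k _ => mul_nonneg (hC0 k) (norm_nonneg _)
  -- The bound 1 keeps the mass of `m'` within the range of the common approximation; the other
  -- makes the two finite sums `ε / 3`-close.
  refine ⟨min 1 (ε / 3 / (K + 1)), by positivity, fun m' S' hm' hS' hδ t ht => ?_⟩
  set D := ∫ σ in Ioo 0 T, |m' σ - m σ| with hD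
  have hD0 : 0 ≤ D := integral_nonneg fun _ => abs_nonneg _
  have hmi : IntegrableOn m (Ioo 0 T) := (hm.locInt T).mono_set Ioo_subset_Ioc_self
  have hmi' : IntegrableOn m' (Ioo 0 T) := (hm'.locInt T).mono_set Ioo_subset_Ioc_self
  have hB : ∫ σ in Ioo 0 T, m' σ ≤ (∫ σ in Ioo 0 T, m σ) + 1 := by
    have h1 : (∫ σ in Ioo 0 T, m' σ) - ∫ σ in Ioo 0 T, m σ ≤ D := by
      rw [← integral_sub hmi' hmi]
      exact integral_mono (hmi'.sub hmi) (hmi'.sub hmi).abs fun σ => le_abs_self _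
    have h2 := hδ.trans_le (min_le_left _ _)
    linarith
  have h1 := h m' S' T hm' hS' hB t ht
  have h2 := h m S T hm hS (by linarith) t ht
  have h3 : ‖∑ k ∈ Finset.range (N + 1), relaxation m' k t • c k
      - ∑ k ∈ Finset.range (N + 1), relaxation m k t • c k‖ ≤ ε / 3 := by
    rw [← Finset.sum_sub_distrib]
    calc _ ≤ ∑ k ∈ Finset.range (N + 1), ‖relaxation m' k t • c k - relaxation m k t • c k‖ :=
          norm_sum_le _ _
      _ ≤ ∑ k ∈ Finset.range (N + 1), C k * ‖c k‖ * D := by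
          refine Finset.sum_le_sum fun k _ => ?_
          rw [← sub_smul, norm_smul, Real.norm_eq_abs]
          calc _ ≤ C k * D * ‖c k‖ := by
                gcongr
                exact hC k m' hm' t ht.2
            _ = _ := by ring
      _ = K * D := by rw [hK, Finset.sum_mul]
      _ ≤ (K + 1) * (ε / 3 / (K + 1)) := by
          gcongr
          · linarith
          · exact (hδ.trans_le (min_le_right _ _)).le
      _ = ε / 3 := by field_simp
  set P' := ∑ k ∈ Finset.range (N + 1), relaxation m' k t • c k
  set P := ∑ k ∈ Finset.range (N + 1), relaxation m k t • c k
  calc ‖S' t v - S t v‖ = ‖(S' t v - P') + (P' - P) - (S t v - P)‖ := by congr 1; abel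
    _ ≤ ‖S' t v - P'‖ + ‖P' - P‖ + ‖S t v - P‖ :=
        (_root_.norm_sub_le _ _).trans (add_le_add_left (norm_add_le _ _) _)
    _ ≤ ε := by linarith

/-- On `[0,T]` the resolvent family depends only on the kernel on `(0,T)`. -/
theorem IsResolventFamily.eq_of_ae_eq {m' : ℝ → ℝ} {S' : ℝ → LpSpace d p → LpSpace d p}
    (hm : CompletelyPositive m) (hS : IsResolventFamily m S) (hm' : CompletelyPositive m')
    (hS' : IsResolventFamily m' S') {T : ℝ} (h : m' =ᵐ[volume.restrict (Ioo 0 T)] m) {t : ℝ}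
    (ht : t ∈ Icc 0 T) (v : LpSpace d p) : S' t v = S t v := by
  have h0 : ∫ σ in Ioo 0 T, |m' σ - m σ| = 0 := by
    refine (integral_congr_ae ?_).trans (integral_zero _ _)
    filter_upwards [h] with σ hσ
    simp [hσ]
  -- The kernels have `L¹(0,T)` distance zero, so the stability estimate applies with every `ε`.
  refine sub_eq_zero.1 (norm_le_zero_iff.1 (le_of_forall_pos_le_add fun ε hε => ?_))
  obtain ⟨δ, hδ, hstab⟩ := hS.exists_stability hm v T hε
  rw [zero_add]
  exact hstab m' S' hm' hS' (by rwa [h0]) t ht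

end ResolventFamily

/-! ### The generalized mild equation for a strongly continuous family of contractions -/

section MildEquation

variable {X : Type*} [NormedAddCommGroup X]

/-- A strongly continuous family of (possibly nonlinear) nonexpansive maps on `[0,T]`. -/
structure IsContractionFamily (T : ℝ) (S : ℝ → X → X) : Prop where
  norm_sub_le : ∀ t ∈ Icc 0 T, ∀ u v, ‖S t u - S t v‖ ≤ ‖u - v‖
  continuousOn : ∀ v, ContinuousOn (fun t => S t v) (Icc 0 T)

variable {T : ℝ} {S S' : ℝ → X → X} {f : X → X}

/-- Continuity in time together with a Lipschitz bound uniform in time gives joint continuity;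
clamping time to `[0,T]` extends it to the whole line. -/
theorem IsContractionFamily.continuous_uncurry (hT : 0 ≤ T) (hS : IsContractionFamily T S) :
    Continuous fun q : ℝ × X => S (projIcc 0 T hT q.1) q.2 := by
  refine continuous_prod_of_continuous_lipschitzWith' _ 1 (fun t => ?_) fun v => ?_
  · refine LipschitzWith.of_dist_le_mul fun u v => ?_
    rw [NNReal.coe_one, one_mul, dist_eq_norm, dist_eq_norm]
    exact hS.norm_sub_le _ (projIcc 0 T hT t).2 u v
  · exact (hS.continuousOn v).comp_continuous (continuous_subtype_val.comp continuous_projIcc)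
      fun t => (projIcc 0 T hT t).2

/-- The integrand of the mild equation, extended continuously to all times. -/
def mildIntegrand (hT : 0 ≤ T) (S : ℝ → X → X) (f : X → X) (u : C(Icc (0 : ℝ) T, X))
    (t σ : ℝ) : X :=
  S (projIcc 0 T hT (t - σ)) (f (u (projIcc 0 T hT σ)))

theorem continuous_mildIntegrand (hT : 0 ≤ T) (hS : IsContractionFamily T S) (hf : Continuous f)
    (u : C(Icc (0 : ℝ) T, X)) : Continuous (Function.uncurry (mildIntegrand hT S f u)) := by
  have h1 : Continuous fun q : ℝ × ℝ => (q.1 - q.2, f (u (projIcc 0 T hT q.2))) :=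
    (continuous_fst.sub continuous_snd).prodMk
      (hf.comp (u.continuous.comp (continuous_projIcc.comp continuous_snd)))
  exact (hS.continuous_uncurry hT).comp h1

theorem mildIntegrand_eq (hT : 0 ≤ T) (S : ℝ → X → X) (f : X → X) (u : C(Icc (0 : ℝ) T, X))
    {t σ : ℝ} (ht : t ≤ T) (hσ : σ ∈ Icc 0 t) :
    mildIntegrand hT S f u t σ = S (t - σ) (f (u (projIcc 0 T hT σ))) := by
  rw [mildIntegrand, projIcc_of_mem hT ⟨by linarith [hσ.2], by linarith [hσ.1]⟩]

theorem norm_mildIntegrand_sub_le (hT : 0 ≤ T) (hS : IsContractionFamily T S) {L : ℝ}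
    (hL : ∀ u v, ‖f u - f v‖ ≤ L * ‖u - v‖) (u v : C(Icc (0 : ℝ) T, X)) (t σ : ℝ) :
    ‖mildIntegrand hT S f u t σ - mildIntegrand hT S f v t σ‖
      ≤ L * ‖u (projIcc 0 T hT σ) - v (projIcc 0 T hT σ)‖ :=
  (hS.norm_sub_le _ (projIcc 0 T hT (t - σ)).2 _ _).trans (hL _ _)

theorem continuous_of_norm_sub_le {L : ℝ} (hL : ∀ u v, ‖f u - f v‖ ≤ L * ‖u - v‖) :
    Continuous f :=
  (LipschitzWith.of_dist_le_mul (K := L.toNNReal) fun u v => by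
    rw [dist_eq_norm, dist_eq_norm]
    exact (hL u v).trans (mul_le_mul_of_nonneg_right (Real.le_coe_toNNReal L)
      (norm_nonneg _))).continuous

/-- Strong convergence of nonexpansive families is uniform on compact sets. -/
theorem eventually_forall_mem_compact {ι : Type*} {l : Filter ι} {R : ι → ℝ → X → X}
    (hR : ∀ i, IsContractionFamily T (R i)) (hS : IsContractionFamily T S)
    (h : ∀ v, ∀ ε > 0, ∀ᶠ i in l, ∀ t ∈ Icc 0 T, ‖R i t v - S t v‖ ≤ ε) {K : Set X}
    (hK : IsCompact K) {ε : ℝ} (hε : 0 < ε) :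
    ∀ᶠ i in l, ∀ t ∈ Icc 0 T, ∀ x ∈ K, ‖R i t x - S t x‖ ≤ ε := by
  obtain ⟨F, hF, hKF⟩ := Metric.totallyBounded_iff.1 hK.totallyBounded (ε / 3) (by positivity)
  have h1 : ∀ᶠ i in l, ∀ y ∈ F, ∀ t ∈ Icc 0 T, ‖R i t y - S t y‖ ≤ ε / 3 :=
    (eventually_all_finite hF).2 fun y _ => h y (ε / 3) (by positivity)
  filter_upwards [h1] with i hi t ht x hx
  obtain ⟨y, hy, hxy⟩ := mem_iUnion₂.1 (hKF hx)
  rw [Metric.mem_ball, dist_eq_norm] at hxy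
  have a1 := (hR i).norm_sub_le t ht x y
  have a2 := hS.norm_sub_le t ht x y
  have a3 := hi y hy t ht
  calc ‖R i t x - S t x‖ = ‖(R i t x - R i t y) + (R i t y - S t y) - (S t x - S t y)‖ := by
        congr 1
        abel
    _ ≤ ‖R i t x - R i t y‖ + ‖R i t y - S t y‖ + ‖S t x - S t y‖ :=
        (norm_sub_le _ _).trans (add_le_add_left (norm_add_le _ _) _)
    _ ≤ ε := by linarith

theorem intervalIntegrable_mildIntegrand (hT : 0 ≤ T) (hS : IsContractionFamily T S)
    (hf : Continuous f) (u : C(Icc (0 : ℝ) T, X)) (t a b : ℝ) :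
    IntervalIntegrable (mildIntegrand hT S f u t) volume a b :=
  ((continuous_mildIntegrand hT hS hf u).comp (Continuous.prodMk_right t)).intervalIntegrable a b

variable [NormedSpace ℝ X]

/-- The right-hand side of the mild equation. -/
def mildOperator (hT : 0 ≤ T) (hS : IsContractionFamily T S) (hf : Continuous f)
    (φ u : C(Icc (0 : ℝ) T, X)) : C(Icc (0 : ℝ) T, X) where
  toFun t := φ t + ∫ σ in (0 : ℝ)..t, mildIntegrand hT S f u t σ
  continuous_toFun := by
    have h1 := intervalIntegral.continuous_parametric_intervalIntegral_of_continuous (μ := volume)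
      (a₀ := 0) (continuous_mildIntegrand hT hS hf u) continuous_id
    exact φ.continuous.add (h1.comp continuous_subtype_val)

theorem isGeneralizedMildSolution_iff (hT : 0 ≤ T) (hS : IsContractionFamily T S)
    (hf : Continuous f) (φ u : C(Icc (0 : ℝ) T, X)) :
    IsGeneralizedMildSolution hT S f φ u ↔ mildOperator hT hS hf φ u = u := by
  have hcongr : ∀ t : Icc (0 : ℝ) T, EqOn (mildIntegrand hT S f u t)
      (fun σ => S (t - σ) (f (u (projIcc 0 T hT σ)))) (uIcc 0 (t : ℝ)) := fun t σ hσ => by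
    rw [uIcc_of_le t.2.1] at hσ
    exact mildIntegrand_eq hT S f u t.2.2 hσ
  constructor
  · intro h
    ext t
    change φ t + ∫ σ in (0 : ℝ)..t, mildIntegrand hT S f u t σ = u t
    rw [intervalIntegral.integral_congr (hcongr t)]
    exact (h t).2.symm
  · intro h t
    refine ⟨(intervalIntegrable_congr ((hcongr t).mono uIoc_subset_uIcc)).1
      (intervalIntegrable_mildIntegrand hT hS hf u t 0 t), ?_⟩
    rw [← intervalIntegral.integral_congr (hcongr t)]
    exact (congrArg (fun g : C(Icc (0 : ℝ) T, X) => g t) h).symm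

/-- Picard estimate: each application integrates the previous power of `t`, and the factorial makes
some iterate a contraction whatever `L` and `T` are. -/
theorem norm_iterate_mildOperator_sub_le (hT : 0 ≤ T) (hS : IsContractionFamily T S)
    (hf : Continuous f) {L : ℝ} (hL0 : 0 ≤ L) (hL : ∀ u v, ‖f u - f v‖ ≤ L * ‖u - v‖)
    (φ u v : C(Icc (0 : ℝ) T, X)) (n : ℕ) (t : Icc (0 : ℝ) T) :
    ‖(mildOperator hT hS hf φ)^[n] u t - (mildOperator hT hS hf φ)^[n] v t‖
      ≤ (L * t) ^ n / n.factorial * ‖u - v‖ := by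
  induction n generalizing t with
  | zero =>
    simp only [Function.iterate_zero, id_eq, pow_zero, Nat.factorial_zero, Nat.cast_one, div_one,
      one_mul]
    exact (u - v).norm_coe_le_norm t
  | succ n ih =>
    rw [Function.iterate_succ_apply', Function.iterate_succ_apply']
    set u' := (mildOperator hT hS hf φ)^[n] u
    set v' := (mildOperator hT hS hf φ)^[n] v
    change ‖(φ t + ∫ σ in (0 : ℝ)..t, mildIntegrand hT S f u' t σ)
      - (φ t + ∫ σ in (0 : ℝ)..t, mildIntegrand hT S f v' t σ)‖ ≤ _
    rw [add_sub_add_left_eq_sub, ← intervalIntegral.integral_sub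
      (intervalIntegrable_mildIntegrand hT hS hf u' t 0 t)
      (intervalIntegrable_mildIntegrand hT hS hf v' t 0 t)]
    have hbound : ∀ σ ∈ Ioc (0 : ℝ) t, ‖mildIntegrand hT S f u' t σ - mildIntegrand hT S f v' t σ‖
        ≤ L ^ (n + 1) / n.factorial * ‖u - v‖ * σ ^ n := fun σ hσ => by
      have hmem : σ ∈ Icc 0 T := ⟨hσ.1.le, hσ.2.trans t.2.2⟩
      refine (norm_mildIntegrand_sub_le hT hS hL u' v' t σ).trans ?_
      have h1 := ih (projIcc 0 T hT σ)
      have h2 : ((projIcc 0 T hT σ : Icc (0 : ℝ) T) : ℝ) = σ := by rw [projIcc_of_mem hT hmem]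
      rw [h2] at h1
      refine (mul_le_mul_of_nonneg_left h1 hL0).trans (le_of_eq ?_)
      rw [mul_pow]
      ring
    refine (intervalIntegral.norm_integral_le_of_norm_le t.2.1 (ae_of_all _ hbound)
      (Continuous.intervalIntegrable (by fun_prop) _ _)).trans (le_of_eq ?_)
    rw [intervalIntegral.integral_const_mul, integral_pow, mul_pow, Nat.factorial_succ]
    push_cast
    have h3 : (n.factorial : ℝ) ≠ 0 := by exact_mod_cast n.factorial_ne_zero
    field_simp
    ring

theorem exists_mildOperator_fixed [CompleteSpace X] (hT : 0 ≤ T) (hS : IsContractionFamily T S)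
    (hf : Continuous f) {L : ℝ} (hL0 : 0 ≤ L) (hL : ∀ u v, ‖f u - f v‖ ≤ L * ‖u - v‖)
    (φ : C(Icc (0 : ℝ) T, X)) : ∃ u, mildOperator hT hS hf φ u = u := by
  have hlim := FloorSemiring.tendsto_pow_div_factorial_atTop (L * T)
  obtain ⟨n, hn⟩ := (hlim.eventually (gt_mem_nhds one_pos)).exists
  have hnn : 0 ≤ (L * T) ^ n / n.factorial := by positivity
  have hc : ContractingWith ⟨(L * T) ^ n / n.factorial, hnn⟩ (mildOperator hT hS hf φ)^[n] := by
    refine ⟨by exact_mod_cast hn, LipschitzWith.of_dist_le_mul fun u v => ?_⟩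
    rw [dist_eq_norm, dist_eq_norm, ContinuousMap.norm_le _ (by positivity)]
    intro t
    refine (norm_iterate_mildOperator_sub_le hT hS hf hL0 hL φ u v n t).trans ?_
    refine mul_le_mul_of_nonneg_right ?_ (norm_nonneg _)
    change _ ≤ (L * T) ^ n / n.factorial
    have h0 : 0 ≤ L * (t : ℝ) := mul_nonneg hL0 t.2.1
    gcongr
    exact t.2.2
  exact ⟨_, hc.isFixedPt_fixedPoint_iterate⟩

/-- A Gronwall estimate for continuous functions on `[0,T]`. -/
theorem le_of_le_add_integral (hT : 0 ≤ T) {L δ : ℝ} (hL : 0 < L) (hδ : 0 ≤ δ) {D : ℝ → ℝ}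
    (hD : Continuous D)
    (h : ∀ t ∈ Icc 0 T, D t ≤ δ + L * ∫ σ in (0 : ℝ)..t, D σ) :
    ∀ t ∈ Icc 0 T, D t ≤ 2 * δ * Real.exp (2 * L * T) := by
  -- Maximise `e^{-2Lt} D t`. With the exponent `2L` the integral term at the maximum point costs at
  -- most `M / 2`, which is absorbed.
  obtain ⟨s, hs, hmax⟩ := isCompact_Icc.exists_isMaxOn (nonempty_Icc.2 hT)
    (f := fun t => Real.exp (-(2 * L) * t) * D t) (by fun_prop)
  set M := Real.exp (-(2 * L) * s) * D s with hM
  have hle : ∀ t ∈ Icc 0 T, D t ≤ M * Real.exp (2 * L * t) := fun t ht => by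
    have h1 : Real.exp (-(2 * L) * t) * D t ≤ M := hmax ht
    have h2 := mul_le_mul_of_nonneg_right h1 (Real.exp_pos (2 * L * t)).le
    rwa [mul_right_comm, ← Real.exp_add, show -(2 * L) * t + 2 * L * t = 0 by ring, Real.exp_zero,
      one_mul] at h2
  have hint : ∫ σ in (0 : ℝ)..s, D σ ≤ M * ((Real.exp (2 * L * s) - 1) / (2 * L)) := by
    have h1 : ∫ σ in (0 : ℝ)..s, D σ ≤ ∫ σ in (0 : ℝ)..s, M * Real.exp (2 * L * σ) :=
      intervalIntegral.integral_mono_on hs.1 (hD.intervalIntegrable _ _)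
        (Continuous.intervalIntegrable (by fun_prop) _ _)
        fun σ hσ => hle σ ⟨hσ.1, hσ.2.trans hs.2⟩
    refine h1.trans (le_of_eq ?_)
    rw [intervalIntegral.integral_const_mul, intervalIntegral.integral_comp_mul_left
      (f := Real.exp) (by positivity), integral_exp]
    rw [mul_zero, Real.exp_zero, smul_eq_mul]
    ring
  have hM2 : M ≤ 2 * δ := by
    rcases le_or_gt M 0 with h0 | h0
    · linarith
    have h1 : D s ≤ δ + M / 2 * (Real.exp (2 * L * s) - 1) := by
      refine (h s hs).trans ?_
      have h2 := mul_le_mul_of_nonneg_left hint hL.le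
      have h3 : L * (M * ((Real.exp (2 * L * s) - 1) / (2 * L)))
          = M / 2 * (Real.exp (2 * L * s) - 1) := by field_simp
      linarith
    have h2 := mul_le_mul_of_nonneg_left h1 (Real.exp_pos (-(2 * L) * s)).le
    have h3 : Real.exp (-(2 * L) * s) * Real.exp (2 * L * s) = 1 := by
      rw [← Real.exp_add, show -(2 * L) * s + 2 * L * s = 0 by ring, Real.exp_zero]
    have h4 : Real.exp (-(2 * L) * s) ≤ 1 := by
      rw [Real.exp_le_one_iff]
      nlinarith [hs.1]
    have h5 : 0 < Real.exp (-(2 * L) * s) := Real.exp_pos _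
    rw [← hM] at h2
    have h6 : Real.exp (-(2 * L) * s) * (δ + M / 2 * (Real.exp (2 * L * s) - 1))
        = Real.exp (-(2 * L) * s) * δ + M / 2 - Real.exp (-(2 * L) * s) * (M / 2) := by
      linear_combination (M / 2) * h3
    have h7 : Real.exp (-(2 * L) * s) * δ ≤ δ := mul_le_of_le_one_left hδ h4
    have h8 : 0 ≤ Real.exp (-(2 * L) * s) * (M / 2) := by positivity
    linarith
  intro t ht
  refine (hle t ht).trans ?_
  have h1 : Real.exp (2 * L * t) ≤ Real.exp (2 * L * T) := by
    refine Real.exp_le_exp.2 ?_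
    have := ht.2
    gcongr
  calc M * Real.exp (2 * L * t) ≤ 2 * δ * Real.exp (2 * L * t) := by gcongr
    _ ≤ 2 * δ * Real.exp (2 * L * T) := by gcongr

/-- Stability of solutions under perturbation of the family and of the forcing term. -/
theorem dist_le_of_mildOperator_fixed (hT : 0 ≤ T) (hS : IsContractionFamily T S)
    (hS' : IsContractionFamily T S') (hf : Continuous f) {L : ℝ} (hL0 : 0 < L)
    (hL : ∀ u v, ‖f u - f v‖ ≤ L * ‖u - v‖) {φ φ' u u' : C(Icc (0 : ℝ) T, X)}
    (hu : mildOperator hT hS hf φ u = u) (hu' : mildOperator hT hS' hf φ' u' = u') {ε : ℝ}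
    (hε : 0 ≤ ε) (hSS' : ∀ t ∈ Icc 0 T, ∀ s : Icc (0 : ℝ) T,
      ‖S' t (f (u s)) - S t (f (u s))‖ ≤ ε) :
    dist u' u ≤ 2 * (dist φ' φ + ε * T) * Real.exp (2 * L * T) := by
  set D : ℝ → ℝ := fun t => ‖u' (projIcc 0 T hT t) - u (projIcc 0 T hT t)‖ with hD
  have hDc : Continuous D := ((u'.continuous.comp continuous_projIcc).sub
    (u.continuous.comp continuous_projIcc)).norm
  have key : ∀ t ∈ Icc 0 T, D t ≤ (dist φ' φ + ε * T) + L * ∫ σ in (0 : ℝ)..t, D σ := by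
    intro t ht
    have e : ∀ {R : ℝ → X → X} (hR : IsContractionFamily T R) (ψ v : C(Icc (0 : ℝ) T, X)),
        mildOperator hT hR hf ψ v = v → v ⟨t, ht⟩ = ψ ⟨t, ht⟩
          + ∫ σ in (0 : ℝ)..t, mildIntegrand hT R f v t σ := fun hR ψ v hv =>
      (congrArg (fun g : C(Icc (0 : ℝ) T, X) => g ⟨t, ht⟩) hv).symm
    have hi := intervalIntegrable_mildIntegrand hT hS hf u t 0 t
    have hi' := intervalIntegrable_mildIntegrand hT hS' hf u' t 0 t
    simp only [hD, projIcc_of_mem hT ht]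
    rw [e hS φ u hu, e hS' φ' u' hu', add_sub_add_comm,
      ← intervalIntegral.integral_sub hi' hi]
    have h1 : ‖φ' ⟨t, ht⟩ - φ ⟨t, ht⟩‖ ≤ dist φ' φ := by
      rw [← dist_eq_norm]
      exact ContinuousMap.dist_apply_le_dist _
    have h2 : ‖∫ σ in (0 : ℝ)..t, (mildIntegrand hT S' f u' t σ - mildIntegrand hT S f u t σ)‖
        ≤ ∫ σ in (0 : ℝ)..t, (L * D σ + ε) := by
      refine intervalIntegral.norm_integral_le_of_norm_le ht.1 (ae_of_all _ fun σ _ => ?_)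
        (Continuous.intervalIntegrable (by fun_prop) _ _)
      -- The intermediate term is `S'` applied along `u`, so the two families are compared only at
      -- the values `f (u s)` of the unperturbed solution.
      have h3 := norm_mildIntegrand_sub_le hT hS' hL u' u t σ
      have h4 : ‖mildIntegrand hT S' f u t σ - mildIntegrand hT S f u t σ‖ ≤ ε :=
        hSS' _ (projIcc 0 T hT (t - σ)).2 _
      exact (norm_sub_le_norm_sub_add_norm_sub _ (mildIntegrand hT S' f u t σ) _).trans
        (add_le_add h3 h4)
    rw [intervalIntegral.integral_add (Continuous.intervalIntegrable (by fun_prop) _ _)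
      (Continuous.intervalIntegrable (by fun_prop) _ _), intervalIntegral.integral_const_mul,
      intervalIntegral.integral_const, sub_zero, smul_eq_mul] at h2
    have h5 : t * ε ≤ ε * T := by
      rw [mul_comm]
      exact mul_le_mul_of_nonneg_left ht.2 hε
    refine (norm_add_le _ _).trans ?_
    linarith
  have hδ : 0 ≤ dist φ' φ + ε * T := by positivity
  have hfin := le_of_le_add_integral hT hL0 hδ hDc key
  rw [ContinuousMap.dist_le (by positivity)]
  intro t
  have h1 := hfin t t.2
  simp only [hD, projIcc_val] at h1
  rwa [dist_eq_norm]

theorem IsResolventFamily.isContractionFamily {d : ℕ} {p : ℝ≥0∞} [Fact (1 ≤ p)] [Fact (p ≠ ∞)]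
    {m : ℝ → ℝ} {S : ℝ → LpSpace d p → LpSpace d p} (hm : CompletelyPositive m)
    (hS : IsResolventFamily m S) (T : ℝ) : IsContractionFamily T S :=
  ⟨fun _ ht => hS.norm_sub_le ht.1, fun v => hS.continuousOn hm v T⟩

end MildEquation

end RayleighStokes

end

open RayleighStokes in
theorem mainTheorem4 (d : ℕ) (p : ℝ≥0∞) [Fact (1 ≤ p)] [Fact (p ≠ ∞)]
    (f : LpSpace d p → LpSpace d p) (hf0 : f 0 = 0)
    (hf : ∃ L : ℝ, 0 < L ∧ ∀ u v, ‖f u - f v‖ ≤ L * ‖u - v‖)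
    (T : ℝ) (hT : 0 < T) :
    (∀ m : ℝ → ℝ, CompletelyPositive m →
      ∃ S : ℝ → LpSpace d p → LpSpace d p, IsResolventFamily m S) ∧
    ∃ U : C(Icc (0 : ℝ) T, LpSpace d p) × kernelSet T → C(Icc (0 : ℝ) T, LpSpace d p),
      (∀ (φ : C(Icc (0 : ℝ) T, LpSpace d p)) (g : kernelSet T) (m : ℝ → ℝ)
        (S : ℝ → LpSpace d p → LpSpace d p),
        CompletelyPositive m →
        m =ᵐ[volume.restrict (Ioo (0 : ℝ) T)] (g : Lp ℝ 1 (volume.restrict (Ioo (0 : ℝ) T))) →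
        IsResolventFamily m S →
        ∀ u : C(Icc (0 : ℝ) T, LpSpace d p),
          IsGeneralizedMildSolution hT.le S f φ u ↔ u = U (φ, g)) ∧
      Continuous U := by
  obtain ⟨L, hL0, hL⟩ := hf
  have hfc := continuous_of_norm_sub_le hL
  refine ⟨fun m hm => hm.exists_resolventFamily, ?_⟩
  -- One kernel and one resolvent family are fixed for each class in `kernelSet T`; the choice is
  -- harmless, as any other pair yields the same operators on `[0,T]`.
  choose M hM hMg using fun g : kernelSet T => g.2
  choose R hR using fun g : kernelSet T => (hM g).exists_resolventFamily (d := d) (p := p)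
  have hC : ∀ g, IsContractionFamily T (R g) := fun g => (hR g).isContractionFamily (hM g) T
  choose U hU using fun q : C(Icc (0 : ℝ) T, LpSpace d p) × kernelSet T =>
    exists_mildOperator_fixed hT.le (hC q.2) hfc hL0.le hL q.1
  refine ⟨U, fun φ g m S hm hmg hS u => ?_, ?_⟩
  · have hCS := hS.isContractionFamily hm T
    have hSR : ∀ t ∈ Icc 0 T, ∀ v, S t v = R g t v := fun t ht v =>
      (hR g).eq_of_ae_eq (hM g) hm hS (hmg.trans (hMg g).symm) ht v
    have huniq : ∀ u : C(Icc (0 : ℝ) T, LpSpace d p),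
        mildOperator hT.le hCS hfc φ u = u → u = U (φ, g) := fun u hu => by
      -- The stability estimate with identical data and perturbation size zero yields uniqueness.
      have h := dist_le_of_mildOperator_fixed hT.le (hC g) hCS hfc hL0 hL (hU (φ, g)) hu le_rfl
        fun t ht s => by rw [hSR t ht, sub_self, norm_zero]
      rw [dist_self, zero_mul, add_zero, mul_zero, zero_mul] at h
      exact dist_le_zero.1 h
    rw [isGeneralizedMildSolution_iff hT.le hCS hfc]
    refine ⟨huniq u, fun h => ?_⟩
    obtain ⟨u', hu'⟩ := exists_mildOperator_fixed hT.le hCS hfc hL0.le hL φ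
    rw [h, ← huniq u' hu', hu']
  · refine continuous_iff_continuousAt.2 fun ⟨φ, g⟩ => ?_
    refine Metric.tendsto_nhds.2 fun ε hε => ?_
    set E := Real.exp (2 * L * T) with hE
    have hE0 : 0 < E := Real.exp_pos _
    set δ := ε / (4 * E * (1 + T)) with hδdef
    have hδ : 0 < δ := by positivity
    have hconv : ∀ v, ∀ ε > 0, ∀ᶠ g' in 𝓝 g, ∀ t ∈ Icc 0 T, ‖R g' t v - R g t v‖ ≤ ε := by
      intro v ε hε
      obtain ⟨δ, hδ, hstab⟩ := (hR g).exists_stability (hM g) v T hε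
      filter_upwards [Metric.ball_mem_nhds g hδ] with g' hg'
      refine hstab _ _ (hM g') (hR g') ?_
      rw [Metric.mem_ball, Subtype.dist_eq, dist_eq_norm, L1.norm_eq_integral_norm] at hg'
      refine lt_of_eq_of_lt (integral_congr_ae ?_) hg'
      filter_upwards [hMg g, hMg g', Lp.coeFn_sub (g' : Lp ℝ 1 (volume.restrict (Ioo (0 : ℝ) T)))
        (g : Lp ℝ 1 (volume.restrict (Ioo (0 : ℝ) T)))] with t h1 h2 h3
      rw [h3, Pi.sub_apply, h1, h2, Real.norm_eq_abs]
    -- Strong convergence of the families becomes uniform on this compact set, the only place where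
    -- the stability estimate tests them.
    have hK : IsCompact (range fun s => f (U (φ, g) s)) :=
      isCompact_range (hfc.comp (U (φ, g)).continuous)
    have h1 := eventually_forall_mem_compact hC (hC g) hconv hK hδ
    rw [nhds_prod_eq]
    filter_upwards [Eventually.prod_mk (Metric.ball_mem_nhds φ hδ) h1] with q hq
    have h2 := dist_le_of_mildOperator_fixed hT.le (hC g) (hC q.2) hfc hL0 hL (hU (φ, g)) (hU q)
      hδ.le fun t ht s => hq.2 t ht _ (mem_range_self s)
    refine h2.trans_lt ?_
    have h3 : dist q.1 φ < δ := hq.1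
    calc 2 * (dist q.1 φ + δ * T) * E ≤ 2 * (δ + δ * T) * E := by gcongr
      _ = ε / 2 := by
          rw [hδdef]
          field_simp
          ring
      _ < ε := half_lt_self hε
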